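/- Fix real numbers $\omega_0>0$, $\gamma>0$, $T_->0$, $\theta>0$, exponents $a\le 0$, $b\ge 0$ with $b-a=\tfrac12$, and a smooth $1$-periodic function $\mathcal F:\mathbb R\to\mathbb R$ with $\int_0^1\mathcal F(t)\,dt=0$ and $\int_0^1\mathcal F(t)^2\,dt>0$. For $n\ge 1$ put $\theta_n=n^b\theta$ and $\mathcal F_n(t)=n^a\mathcal F(t/\theta_n)$, and consider the chain of $n+1$ particles with configurations $(\mathbf q,\mathbf p)\in\mathbb R^{n+1}\times\mathbb R^{n+1}$, $\mathbf q=(q_0,\dots,q_n)$, $\mathbf p=(p_0,\dots,p_n)$, whose dynamics has the time-dependent generator $$\mathcal G_tF=\sum_{x=0}^n p_x\,\partial_{q_x}F+\sum_{x=0}^n\big(\Delta_{\rm N}q_x-\omega_0^2q_x\big)\partial_{p_x}F+\mathcal F_n(t)\,\partial_{p_n}F+\gamma\sum_{x=1}^n\big(F(\mathbf q,\mathbf p^x)-F(\mathbf q,\mathbf p)\big)+2\gamma\big(T_-\partial_{p_0}^2F-p_0\,\partial_{p_0}F\big),$$ where $\Delta_{\rm N}q_x=q_{x+1}+q_{x-1}-2q_x$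 with the conventions $q_{-1}=q_0$, $q_{n+1}=q_n$, and $\mathbf p^x$ is $\mathbf p$ with the sign of $p_x$ reversed. A periodic stationary state is a family $(\mu_t)_{t\ge0}$ of Borel probability measures on $\mathbb R^{2(n+1)}$ with $\mu_{t+\theta_n}=\mu_t$ for all $t\ge 0$ that solves the forward equation $\partial_t\mu_t=\mathcal G_t^*\mu_t$, that is, $\frac{d}{dt}\int F\,d\mu_t=\int\mathcal G_tF\,d\mu_t$ for all $t\ge0$ (one-sided derivative at $t=0$) and all $F\in C_c^\infty(\mathbb R^{2(n+1)})$. For such a state write $$\langle p_x^2\rangle=\frac1{\theta_n}\int_0^{\theta_n}\int p_x^2\,d\mu_t\,dt,\qquad x=0,\dots,n.$$ Then there is a constant $C>0$, depending on $\omega_0,\gamma,T_-,\theta,a,b,\mathcal F$ but not on $n$, such that for every $n\ge1$ and every periodic stationary state $(\mu_t)_{t\ge0}$, each $p_x^2$ is integrable with respect to each $\mu_t$, its mean is integrable in $t$ over $[0,\theta_n]$, and $$\sum_{x=0}^{n-1}\big(\langle p_x^2\rangle-\langle p_{x+1}^2\rangle\big)^2\le\frac{C}{n+1},\qquad \sup_{x=0,\dots,n}\langle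 p_x^2\rangle\le C.$$ -/

import Mathlib

open MeasureTheory
open scoped ContDiff

noncomputable section

namespace ForcedChain

/-- Configurations `(q, p)` with `q = (q_0, …, q_n)` and `p = (p_0, …, p_n)`. -/
abbrev Phase (n : ℕ) : Type := (Fin (n + 1) → ℝ) × (Fin (n + 1) → ℝ)

/-- `q_{x+1}`, with the convention `q_{n+1} = q_n`. -/
def rightNeighbour {n : ℕ} (q : Fin (n + 1) → ℝ) (x : Fin (n + 1)) : ℝ :=
  if h : (x : ℕ) + 1 < n + 1 then q ⟨(x : ℕ) + 1, h⟩ else q x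

/-- `q_{x-1}`, with the convention `q_{-1} = q_0` (truncated subtraction gives `0 - 1 = 0`). -/
def leftNeighbour {n : ℕ} (q : Fin (n + 1) → ℝ) (x : Fin (n + 1)) : ℝ :=
  q ⟨(x : ℕ) - 1, lt_of_le_of_lt (Nat.sub_le _ _) x.isLt⟩

/-- The discrete Neumann Laplacian on `{0, …, n}`. -/
def neumannLaplacian {n : ℕ} (q : Fin (n + 1) → ℝ) (x : Fin (n + 1)) : ℝ :=
  rightNeighbour q x + leftNeighbour q x - 2 * q x

/-- The partial derivative `∂F/∂q_x`. -/
def partialQ {n : ℕ} (x : Fin (n + 1)) (F : Phase n → ℝ) (z : Phase n) : ℝ :=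
  fderiv ℝ F z (Pi.single x 1, 0)

/-- The partial derivative `∂F/∂p_x`. -/
def partialP {n : ℕ} (x : Fin (n + 1)) (F : Phase n → ℝ) (z : Phase n) : ℝ :=
  fderiv ℝ F z (0, Pi.single x 1)

/-- The configuration in which the sign of the momentum `p_x` is reversed. -/
def flipAt {n : ℕ} (x : Fin (n + 1)) (z : Phase n) : Phase n :=
  (z.1, Function.update z.2 x (-z.2 x))

/-- The Hamiltonian part of the generator, with force `f` acting on the particle `n`. -/
def hamiltonianPart {n : ℕ} (ω₀ f : ℝ) (F : Phase n → ℝ) (z : Phase n) : ℝ :=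
  ∑ x, z.2 x * partialQ x F z
    + ∑ x, (neumannLaplacian z.1 x - ω₀ ^ 2 * z.1 x) * partialP x F z
    + f * partialP (Fin.last n) F z

/-- The random reversal of the velocities of the particles `1, …, n`. -/
def flipPart {n : ℕ} (F : Phase n → ℝ) (z : Phase n) : ℝ :=
  ∑ x : Fin n, (F (flipAt x.succ z) - F z)

/-- The Langevin thermostat at temperature `T`, acting on the particle `0`. -/
def thermostatPart {n : ℕ} (T : ℝ) (F : Phase n → ℝ) (z : Phase n) : ℝ :=
  T * partialP 0 (partialP 0 F) z - z.2 0 * partialP 0 F z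

/-- The generator of the dynamics at a time at which the force equals `f`. -/
def generator {n : ℕ} (ω₀ γ T f : ℝ) (F : Phase n → ℝ) (z : Phase n) : ℝ :=
  hamiltonianPart ω₀ f F z + γ * flipPart F z + 2 * γ * thermostatPart T F z

/-- The force `n ^ a 𝓕(t / θ_n)` acting on the last particle at time `t`, where `τ = θ_n`. -/
def force (n : ℕ) (a τ : ℝ) (𝓕 : ℝ → ℝ) (t : ℝ) : ℝ := (n : ℝ) ^ a * 𝓕 (t / τ)

/-- A periodic stationary state, with period `τ`, of the chain of `n + 1` particles driven by the
force `f`: a family `(μ_t)_{t ≥ 0}` of probability measures that is periodic with period `τ` and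
solves the forward equation `∂_t μ_t = 𝒢_t^* μ_t`, tested against smooth compactly supported
functions. Nothing is assumed on the moments of `μ_t`, and the values of `μ` at negative times
play no role. -/
structure IsPeriodicStationaryState {n : ℕ} (ω₀ γ T : ℝ) (f : ℝ → ℝ) (τ : ℝ)
    (μ : ℝ → Measure (Phase n)) : Prop where
  isProbabilityMeasure : ∀ t, 0 ≤ t → IsProbabilityMeasure (μ t)
  forward : ∀ F : Phase n → ℝ, ContDiff ℝ ∞ F → HasCompactSupport F → ∀ t, 0 ≤ t →
    HasDerivWithinAt (fun s => ∫ z, F z ∂(μ s)) (∫ z, generator ω₀ γ T (f t) F z ∂(μ t))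
      (Set.Ici 0) t
  periodic : ∀ t, 0 ≤ t → μ (t + τ) = μ t

/-- `F` has a well-defined average over a period: it is integrable with respect to each `μ_t`,
and its mean is an integrable function of the time over a period. -/
def HasTimeAverage {n : ℕ} (τ : ℝ) (μ : ℝ → Measure (Phase n)) (F : Phase n → ℝ) : Prop :=
  (∀ t, 0 ≤ t → Integrable F (μ t)) ∧
    IntervalIntegrable (fun t => ∫ z, F z ∂(μ t)) volume 0 τ

/-- The average `⟨F⟩` of `F` over a period. -/
def timeAverage {n : ℕ} (τ : ℝ) (μ : ℝ → Measure (Phase n)) (F : Phase n → ℝ) : ℝ :=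
  τ⁻¹ * ∫ t in (0 : ℝ)..τ, ∫ z, F z ∂(μ t)

/-- The observable `p_x²`. -/
def momentumSq {n : ℕ} (x : Fin (n + 1)) (z : Phase n) : ℝ := z.2 x ^ 2

end ForcedChain

end

/-! The drift is linear, the reversals only change signs and the thermostat is Gaussian, so the
first and second moments obey closed equations. Write `A` for `stiffness n ω₀`, that is `ω₀² - Δ_N`.
Let `Q`, `S`, `P` be the period averages of the covariances qq, qp, pp. The force is deterministic
and drops out of the covariances, and derivatives of periodic functions average to zero. Hence `S`
is antisymmetric, `P = QA + 2γS` and `[A, S] = 4γ(D - P)`, where `D` is diagonal with entries `d_0 =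
T` and `d_x = ⟨p_x²⟩` for `x ≥ 1`: a reversal damps correlations but conserves `p_x²`.

Two consequences carry the proof. Pairing the last equation with `P` gives `tr D(D - P) ≥ tr(A S Sᵀ)
≥ ω₀²‖S‖²` (`hsNormSq_current_le`). Moreover `[D, A]` is a linear expression in `S` with bounded
coefficients, and its nearest-neighbour entries are the increments of `d` up to sign; so `‖∇d‖²` is
at most a constant times `‖S‖²` (`sum_sq_gradient_le`). Let `w_x` be the averaged square of the mean
velocity. Then `d_x - P_xx = w_x` for `x ≥ 1`, and since `tr(D - P) = 0` the dissipation equals `∑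
(d_x - d_0) w_x`. By Cauchy–Schwarz, `|d_x - d_0| ≤ √(n‖∇d‖²)`. If `∑ w_x = O(1/n)`, the inequality
for `u = √(n‖∇d‖²)` closes on itself as `u² ≤ const · u` (`profile_bounds`).

The bound on `∑ w_x` comes from differentiating the mean equation: the mean velocities solve a
damped pinned chain driven by the derivative of the force, and an energy estimate bounds them by it
uniformly in `n` (`average_sq_velocity_le`). The mean square of that derivative is of order `n^(2a -
2b) = 1/n`. Finally `⟨p_0²⟩ = T + ∑ w_x`, which affects only the first increment.

A periodic state is not assumed to have moments, so these have to be produced first. A quadratic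
Lyapunov function exists by duality: otherwise Hahn–Banach gives a nonzero functional that behaves
like the second moments at zero temperature, and the two consequences above force it to vanish
(`dual_eq_zero`). Concave truncations of the Lyapunov function, integrated over one period, give
finite second moments at some time, hence at all times (`exists_moment_bound`). The forward equation
then extends to observables of quadratic growth by dominated convergence. The moment bounds may
depend on `n`; they serve only to justify the moment equations. -/

namespace ForcedChain

open Filter Topology

variable {n : ℕ}

/-! ### The generator on smooth functions -/

/-- The acceleration of the particle `x`, without friction, when the force equals `f`. -/
noncomputable def accel (ω₀ f : ℝ) (q : Fin (n + 1) → ℝ) (x : Fin (n + 1)) : ℝ :=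
  neumannLaplacian q x - ω₀ ^ 2 * q x + if x = Fin.last n then f else 0

/-- The Hamiltonian vector field. -/
noncomputable def drift (ω₀ f : ℝ) (z : Phase n) : Phase n := (z.2, accel ω₀ f z.1)

lemma hamiltonianPart_eq (ω₀ f : ℝ) (F : Phase n → ℝ) (z : Phase n) :
    hamiltonianPart ω₀ f F z = fderiv ℝ F z (drift ω₀ f z) := by
  have h : drift ω₀ f z = ∑ x, z.2 x • ((Pi.single x 1, 0) : Phase n)
      + ∑ x, (neumannLaplacian z.1 x - ω₀ ^ 2 * z.1 x) • ((0, Pi.single x 1) : Phase n)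
      + f • ((0, Pi.single (Fin.last n) 1) : Phase n) := by
    ext x
    · simp [drift, Prod.fst_sum, Finset.sum_apply, Pi.single_apply]
    · simp [drift, accel, Prod.snd_sum, Finset.sum_apply, Pi.single_apply]
  rw [h]
  simp only [hamiltonianPart, map_add, map_sum, map_smul, partialQ, partialP, smul_eq_mul]

lemma continuous_flipAt (x : Fin (n + 1)) : Continuous (flipAt x : Phase n → Phase n) := by
  unfold flipAt
  fun_prop

/-- The reversal of a velocity as a continuous linear map. -/
noncomputable def flipCLM (x : Fin (n + 1)) : Phase n →L[ℝ] Phase n where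
  toFun := flipAt x
  map_add' z w := by
    ext y
    · simp [flipAt]
    · by_cases h : y = x
      · subst h; simp [flipAt]; ring
      · simp [flipAt, h]
  map_smul' c z := by
    ext y
    · simp [flipAt]
    · by_cases h : y = x
      · subst h; simp [flipAt]
      · simp [flipAt, h]
  cont := continuous_flipAt x

lemma contDiff_flipAt (x : Fin (n + 1)) : ContDiff ℝ ∞ (flipAt x : Phase n → Phase n) :=
  (flipCLM x).contDiff

lemma norm_flipAt (x : Fin (n + 1)) (z : Phase n) : ‖flipAt x z‖ = ‖z‖ := by
  have h : ‖Function.update z.2 x (-z.2 x)‖ = ‖z.2‖ := by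
    rw [Pi.norm_def, Pi.norm_def]
    congr 2
    ext y
    by_cases hy : y = x
    · subst hy; simp
    · simp [hy]
  simp only [flipAt, Prod.norm_def, h]

lemma contDiff_partialP {F : Phase n → ℝ} (hF : ContDiff ℝ ∞ F) (x : Fin (n + 1)) :
    ContDiff ℝ ∞ (partialP x F) := by
  unfold partialP
  exact (hF.fderiv_right (m := ∞) (by simp)).clm_apply contDiff_const

lemma contDiff_neumannLaplacian (x : Fin (n + 1)) :
    ContDiff ℝ ∞ (fun q : Fin (n + 1) → ℝ => neumannLaplacian q x) := by
  unfold neumannLaplacian rightNeighbour leftNeighbour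
  split_ifs <;> fun_prop

lemma contDiff_drift (ω₀ f : ℝ) : ContDiff ℝ ∞ (drift ω₀ f : Phase n → Phase n) := by
  refine contDiff_snd.prodMk (contDiff_pi.2 fun x => ?_)
  unfold accel
  have := (contDiff_neumannLaplacian x).comp (contDiff_fst (𝕜 := ℝ) (E := Fin (n + 1) → ℝ)
    (F := Fin (n + 1) → ℝ))
  simp only [Function.comp_def] at this
  have h2 : ContDiff ℝ ∞ fun z : Phase n => z.1 x := by fun_prop
  exact (this.sub (contDiff_const.mul h2)).add contDiff_const

lemma contDiff_generator (ω₀ γ T f : ℝ) {F : Phase n → ℝ} (hF : ContDiff ℝ ∞ F) :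
    ContDiff ℝ ∞ (generator ω₀ γ T f F) := by
  unfold generator
  refine (ContDiff.add ?_ (contDiff_const.mul ?_)).add (contDiff_const.mul ?_)
  · simp only [funext (hamiltonianPart_eq ω₀ f F)]
    exact (hF.fderiv_right (m := ∞) (by simp)).clm_apply (contDiff_drift ω₀ f)
  · unfold flipPart
    exact ContDiff.sum fun x _ => (hF.comp (contDiff_flipAt _)).sub hF
  · unfold thermostatPart
    have : ContDiff ℝ ∞ fun z : Phase n => z.2 0 := by fun_prop
    exact (contDiff_const.mul (contDiff_partialP (contDiff_partialP hF 0) 0)).sub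
      (this.mul (contDiff_partialP hF 0))

lemma hasCompactSupport_partialP {F : Phase n → ℝ} (hF : HasCompactSupport F)
    (x : Fin (n + 1)) : HasCompactSupport (partialP x F) := by
  unfold partialP
  exact hF.fderiv_apply ℝ _

lemma hasCompactSupport_comp_flipAt {F : Phase n → ℝ} (hF : HasCompactSupport F)
    (x : Fin (n + 1)) : HasCompactSupport fun z => F (flipAt x z) := by
  obtain ⟨R, hR⟩ := hF.isBounded.exists_norm_le
  refine HasCompactSupport.intro (isCompact_closedBall (0 : Phase n) R) fun z hz => ?_
  by_contra h
  have := hR _ (subset_tsupport _ h)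
  rw [norm_flipAt] at this
  exact hz (by simpa using this)

lemma hasCompactSupport_sum {ι : Type*} (s : Finset ι) {F : ι → Phase n → ℝ}
    (hF : ∀ i ∈ s, HasCompactSupport (F i)) : HasCompactSupport fun z => ∑ i ∈ s, F i z := by
  classical
  induction s using Finset.induction_on with
  | empty =>
    simp only [Finset.sum_empty]
    exact HasCompactSupport.zero
  | insert i s his ih =>
    simp only [Finset.sum_insert his]
    exact (hF i (by simp)).add (ih fun j hj => hF j (by simp [hj]))

lemma hasCompactSupport_generator (ω₀ γ T f : ℝ) {F : Phase n → ℝ}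
    (hF : HasCompactSupport F) : HasCompactSupport (generator ω₀ γ T f F) := by
  have h1 : HasCompactSupport (hamiltonianPart ω₀ f F) := by
    simp only [funext (hamiltonianPart_eq ω₀ f F)]
    refine (hF.fderiv ℝ).mono fun z hz => ?_
    contrapose! hz
    simp [Function.notMem_support.1 hz]
  have h2 : HasCompactSupport (flipPart F) :=
    hasCompactSupport_sum _ fun x _ => (hasCompactSupport_comp_flipAt hF x.succ).sub hF
  have h3 : HasCompactSupport (thermostatPart T F) :=
    HasCompactSupport.sub (f := fun z => T * partialP 0 (partialP 0 F) z)
      (f' := fun z => z.2 0 * partialP 0 F z)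
      (hasCompactSupport_partialP (hasCompactSupport_partialP hF 0) 0).mul_left
      (hasCompactSupport_partialP hF 0).mul_left
  exact (h1.add (HasCompactSupport.mul_left (f := fun _ => γ) h2)).add
    (HasCompactSupport.mul_left (f := fun _ => 2 * γ) h3)

/-- The time dependence sits in a single first-order term. Continuity in time and growth bounds
therefore need checking only for the unforced generator and for the derivative in `p_n`. -/
lemma generator_eq_zero_add (ω₀ γ T f : ℝ) (F : Phase n → ℝ) (z : Phase n) :
    generator ω₀ γ T f F z = generator ω₀ γ T 0 F z + f * partialP (Fin.last n) F z := by
  unfold generator hamiltonianPart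
  ring

lemma partialP_mul {F G : Phase n → ℝ} (hF : ContDiff ℝ ∞ F) (hG : ContDiff ℝ ∞ G)
    (x : Fin (n + 1)) :
    partialP x (fun z => F z * G z) = fun z => F z * partialP x G z + G z * partialP x F z := by
  ext z
  unfold partialP
  rw [fderiv_fun_mul (hF.differentiable (by simp) z) (hG.differentiable (by simp) z)]
  simp

lemma partialP_add {F G : Phase n → ℝ} (hF : ContDiff ℝ ∞ F) (hG : ContDiff ℝ ∞ G)
    (x : Fin (n + 1)) :
    partialP x (fun z => F z + G z) = fun z => partialP x F z + partialP x G z := by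
  ext z
  unfold partialP
  rw [fderiv_fun_add (hF.differentiable (by simp) z) (hG.differentiable (by simp) z)]
  simp

lemma generator_add (ω₀ γ T f : ℝ) {F G : Phase n → ℝ} (hF : ContDiff ℝ ∞ F)
    (hG : ContDiff ℝ ∞ G) (z : Phase n) :
    generator ω₀ γ T f (fun z => F z + G z) z
      = generator ω₀ γ T f F z + generator ω₀ γ T f G z := by
  have h2 := partialP_add (contDiff_partialP hF 0) (contDiff_partialP hG 0) 0
  unfold generator
  simp only [hamiltonianPart_eq, thermostatPart, partialP_add hF hG, h2]
  rw [fderiv_fun_add (hF.differentiable (by simp) z) (hG.differentiable (by simp) z)]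
  have : flipPart (fun z => F z + G z) z = flipPart F z + flipPart G z := by
    unfold flipPart
    rw [← Finset.sum_add_distrib]
    exact Finset.sum_congr rfl fun x _ => by ring
  rw [this]
  simp
  ring

lemma partialP_const_mul {F : Phase n → ℝ} (hF : ContDiff ℝ ∞ F) (c : ℝ) (x : Fin (n + 1)) :
    partialP x (fun z => c * F z) = fun z => c * partialP x F z := by
  ext z
  unfold partialP
  rw [fderiv_const_mul (hF.differentiable (by simp) z)]
  simp

lemma generator_const_mul (ω₀ γ T f c : ℝ) {F : Phase n → ℝ} (hF : ContDiff ℝ ∞ F)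
    (z : Phase n) :
    generator ω₀ γ T f (fun z => c * F z) z = c * generator ω₀ γ T f F z := by
  unfold generator
  simp only [hamiltonianPart_eq, thermostatPart, partialP_const_mul hF,
    partialP_const_mul (contDiff_partialP hF 0)]
  rw [fderiv_const_mul (hF.differentiable (by simp) z)]
  have : flipPart (fun z => c * F z) z = c * flipPart F z := by
    unfold flipPart
    rw [Finset.mul_sum]
    exact Finset.sum_congr rfl fun x _ => by ring
  rw [this]
  simp
  ring

lemma generator_const (ω₀ γ T f c : ℝ) (z : Phase n) :
    generator ω₀ γ T f (fun _ => c) z = 0 := by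
  have h (x : Fin (n + 1)) (c : ℝ) : partialP x (fun _ : Phase n => c) = fun _ => 0 := by
    ext z
    simp [partialP]
  unfold generator
  simp [hamiltonianPart_eq, thermostatPart, flipPart, h]

lemma generator_sum (ω₀ γ T f : ℝ) {ι : Type*} (s : Finset ι) {F : ι → Phase n → ℝ}
    (hF : ∀ i, ContDiff ℝ ∞ (F i)) (z : Phase n) :
    generator ω₀ γ T f (fun z => ∑ i ∈ s, F i z) z = ∑ i ∈ s, generator ω₀ γ T f (F i) z := by
  classical
  induction s using Finset.induction_on with
  | empty => simpa using generator_const ω₀ γ T f 0 z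
  | insert i s his ih =>
    simp only [Finset.sum_insert his]
    rw [generator_add _ _ _ _ (hF i) (ContDiff.sum fun j _ => hF j), ih]

/-- The product rule, for a factor that does not depend on the signs of the velocities. -/
lemma generator_mul (ω₀ γ T f : ℝ) {F η : Phase n → ℝ} (hF : ContDiff ℝ ∞ F)
    (hη : ContDiff ℝ ∞ η) (hflip : ∀ x z, η (flipAt x z) = η z) (z : Phase n) :
    generator ω₀ γ T f (fun z => F z * η z) z
      = η z * generator ω₀ γ T f F z + F z * generator ω₀ γ T f η z
        + 4 * γ * T * partialP 0 F z * partialP 0 η z := by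
  have h2 : partialP 0 (partialP 0 (fun z => F z * η z)) z
      = F z * partialP 0 (partialP 0 η) z + η z * partialP 0 (partialP 0 F) z
        + 2 * (partialP 0 F z * partialP 0 η z) := by
    rw [partialP_mul hF hη, partialP_add (hF.mul (contDiff_partialP hη 0))
      (hη.mul (contDiff_partialP hF 0)), partialP_mul hF (contDiff_partialP hη 0),
      partialP_mul hη (contDiff_partialP hF 0)]
    ring
  unfold generator
  simp only [hamiltonianPart_eq, thermostatPart, h2]
  rw [partialP_mul hF hη, fderiv_fun_mul (hF.differentiable (by simp) z)
    (hη.differentiable (by simp) z)]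
  -- The jump part has no cross term, because `η` has the same value before and after a reversal.
  -- The only carré du champ term is the one of the thermostat.
  have h3 : flipPart (fun z => F z * η z) z = η z * flipPart F z := by
    unfold flipPart
    rw [Finset.mul_sum]
    exact Finset.sum_congr rfl fun x _ => by simp only [hflip]; ring
  have h4 : flipPart η z = 0 := by simp [flipPart, hflip]
  rw [h3, h4]
  simp
  ring

/-- The chain rule for a concave function of an observable. -/
lemma generator_comp_le {ω₀ γ T : ℝ} (f : ℝ) (hγ : 0 ≤ γ) (hT : 0 ≤ T) {V : Phase n → ℝ}
    (hV : ContDiff ℝ ∞ V) {φ : ℝ → ℝ} (hφ : ContDiff ℝ ∞ φ)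
    (hconc : ∀ u v, φ u ≤ φ v + deriv φ v * (u - v)) (hφ2 : ∀ v, deriv (deriv φ) v ≤ 0)
    (z : Phase n) :
    generator ω₀ γ T f (fun z => φ (V z)) z ≤ deriv φ (V z) * generator ω₀ γ T f V z := by
  have key {ψ : ℝ → ℝ} (hψ : ContDiff ℝ ∞ ψ) (z : Phase n) :
      fderiv ℝ (fun z => ψ (V z)) z = deriv ψ (V z) • fderiv ℝ V z :=
    ((hψ.differentiable (by simp) _).hasDerivAt.comp_hasFDerivAt z
      (hV.differentiable (by simp) z).hasFDerivAt).fderiv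
  have hφ' : ContDiff ℝ ∞ (deriv φ) := (contDiff_infty_iff_deriv.1 hφ).2
  have kp {ψ : ℝ → ℝ} (hψ : ContDiff ℝ ∞ ψ) :
      partialP 0 (fun z => ψ (V z)) = fun z => deriv ψ (V z) * partialP 0 V z := by
    ext z
    simp [partialP, key hψ]
  have h2 : partialP 0 (partialP 0 (fun z => φ (V z))) z
      = deriv φ (V z) * partialP 0 (partialP 0 V) z
        + partialP 0 V z * (deriv (deriv φ) (V z) * partialP 0 V z) := by
    rw [kp hφ, partialP_mul (F := fun z => deriv φ (V z)) (hφ'.comp hV) (contDiff_partialP hV 0), kp hφ']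
  -- The jumps are handled by the tangent-line inequality at `V z`; the second-order term of the
  -- thermostat has a sign because `φ'' ≤ 0`.
  have h3 : flipPart (fun z => φ (V z)) z ≤ deriv φ (V z) * flipPart V z := by
    unfold flipPart
    rw [Finset.mul_sum]
    refine Finset.sum_le_sum fun x _ => ?_
    linarith [hconc (V (flipAt x.succ z)) (V z)]
  have h4 : 0 ≤ γ * T * (partialP 0 V z ^ 2 * -deriv (deriv φ) (V z)) := by
    have := hφ2 (V z)
    exact mul_nonneg (mul_nonneg hγ hT) (mul_nonneg (sq_nonneg _) (by linarith))
  have h5 := mul_le_mul_of_nonneg_left h3 hγ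
  unfold generator
  simp only [hamiltonianPart_eq, thermostatPart, h2]
  rw [key hφ, kp hφ]
  simp
  nlinarith

/-! ### The generator on polynomials of degree at most two -/

lemma contDiff_fst_apply (x : Fin (n + 1)) : ContDiff ℝ ∞ fun z : Phase n => z.1 x := by fun_prop

lemma contDiff_snd_apply (x : Fin (n + 1)) : ContDiff ℝ ∞ fun z : Phase n => z.2 x := by fun_prop

lemma fderiv_fst_apply (x : Fin (n + 1)) (z w : Phase n) :
    fderiv ℝ (fun z : Phase n => z.1 x) z w = w.1 x := by
  have : (fun z : Phase n => z.1 x) = ((ContinuousLinearMap.proj (R := ℝ) (φ := fun _ => ℝ) x).comp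
      (ContinuousLinearMap.fst ℝ (Fin (n + 1) → ℝ) (Fin (n + 1) → ℝ)) : Phase n → ℝ) := rfl
  rw [this, ContinuousLinearMap.fderiv]
  rfl

lemma fderiv_snd_apply (x : Fin (n + 1)) (z w : Phase n) :
    fderiv ℝ (fun z : Phase n => z.2 x) z w = w.2 x := by
  have : (fun z : Phase n => z.2 x) = ((ContinuousLinearMap.proj (R := ℝ) (φ := fun _ => ℝ) x).comp
      (ContinuousLinearMap.snd ℝ (Fin (n + 1) → ℝ) (Fin (n + 1) → ℝ)) : Phase n → ℝ) := rfl
  rw [this, ContinuousLinearMap.fderiv]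
  rfl

lemma partialP_fst_apply (y x : Fin (n + 1)) :
    partialP y (fun z : Phase n => z.1 x) = fun _ => 0 := by
  ext z
  simp [partialP, fderiv_fst_apply]

lemma partialP_snd_apply (y x : Fin (n + 1)) :
    partialP y (fun z : Phase n => z.2 x) = fun _ => if x = y then 1 else 0 := by
  ext z
  simp [partialP, fderiv_snd_apply, Pi.single_apply]

lemma partialP_const (y : Fin (n + 1)) (c : ℝ) :
    partialP y (fun _ : Phase n => c) = fun _ => 0 := by
  ext z
  simp [partialP]

lemma sum_ite_eq_succ (x : Fin (n + 1)) (c : ℝ) :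
    ∑ y : Fin n, (if x = y.succ then c else 0) = if x = 0 then 0 else c := by
  refine Fin.cases ?_ (fun i => ?_) x
  · simp [(Fin.succ_ne_zero _).symm]
  · simp

lemma flipAt_snd_apply (x y : Fin (n + 1)) (z : Phase n) :
    (flipAt y z).2 x = if x = y then -z.2 x else z.2 x := by
  by_cases h : x = y
  · subst h; simp [flipAt]
  · simp [flipAt, h]

lemma generator_fst_apply (ω₀ γ T f : ℝ) (x : Fin (n + 1)) (z : Phase n) :
    generator ω₀ γ T f (fun z => z.1 x) z = z.2 x := by
  simp [generator, hamiltonianPart_eq, fderiv_fst_apply, flipPart, thermostatPart,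
    partialP_fst_apply, partialP_const, flipAt, drift]

lemma flipPart_snd_apply (x : Fin (n + 1)) (z : Phase n) :
    flipPart (fun z => z.2 x) z = if x = 0 then 0 else -2 * z.2 x := by
  rw [← sum_ite_eq_succ]
  refine Finset.sum_congr rfl fun y _ => ?_
  simp only [flipAt_snd_apply]
  split_ifs <;> ring

/-- The rates are matched: a reversal at rate `γ` damps the mean of `p_x` at rate `2γ`, which is
also the Langevin friction at the particle `0`. Hence the same damping at every site. -/
lemma generator_snd_apply (ω₀ γ T f : ℝ) (x : Fin (n + 1)) (z : Phase n) :
    generator ω₀ γ T f (fun z => z.2 x) z = accel ω₀ f z.1 x - 2 * γ * z.2 x := by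
  simp only [generator, hamiltonianPart_eq, fderiv_snd_apply, flipPart_snd_apply, thermostatPart,
    partialP_snd_apply, partialP_const, drift]
  by_cases hx : x = 0
  · subst hx; simp; ring
  · simp [hx]; ring

lemma generator_fst_mul_fst (ω₀ γ T f : ℝ) (x y : Fin (n + 1)) (z : Phase n) :
    generator ω₀ γ T f (fun z => z.1 x * z.1 y) z = z.2 x * z.1 y + z.1 x * z.2 y := by
  rw [generator_mul _ _ _ _ (contDiff_fst_apply x) (contDiff_fst_apply y) (fun _ _ => rfl)]
  simp only [generator_fst_apply, partialP_fst_apply]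
  ring

lemma generator_fst_mul_snd (ω₀ γ T f : ℝ) (x y : Fin (n + 1)) (z : Phase n) :
    generator ω₀ γ T f (fun z => z.1 x * z.2 y) z
      = z.2 x * z.2 y + z.1 x * accel ω₀ f z.1 y - 2 * γ * (z.1 x * z.2 y) := by
  -- In `generator_mul` the second factor must be insensitive to reversals, so the position is put
  -- last.
  have : (fun z : Phase n => z.1 x * z.2 y) = fun z => z.2 y * z.1 x := by ext; ring
  rw [this, generator_mul _ _ _ _ (contDiff_snd_apply y) (contDiff_fst_apply x) (fun _ _ => rfl)]
  simp only [generator_fst_apply, generator_snd_apply, partialP_fst_apply]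
  ring

lemma flipPart_snd_mul_snd (x y : Fin (n + 1)) (z : Phase n) :
    flipPart (fun z => z.2 x * z.2 y) z
      = if x = y then 0 else
        (if x = 0 then 0 else -2 * (z.2 x * z.2 y)) + if y = 0 then 0 else -2 * (z.2 x * z.2 y) := by
  by_cases hxy : x = y
  · subst hxy
    simp only [flipPart, flipAt_snd_apply, if_true]
    refine Finset.sum_eq_zero fun i _ => ?_
    split_ifs <;> ring
  · rw [if_neg hxy, ← sum_ite_eq_succ, ← sum_ite_eq_succ, ← Finset.sum_add_distrib]
    refine Finset.sum_congr rfl fun i _ => ?_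
    simp only [flipAt_snd_apply]
    split_ifs with h1 h2 <;> first | exact absurd (h1.trans h2.symm) hxy | ring

/-- Uniform damping `4γ` is split off for all pairs. On the diagonal the reversals conserve `p_x²`,
so `4γ p_x²` has to be restored for `x ≥ 1`, while at `0` the thermostat injects `4γT`. This last
term becomes the source `d` of the covariance equations. -/
lemma generator_snd_mul_snd (ω₀ γ T f : ℝ) (x y : Fin (n + 1)) (z : Phase n) :
    generator ω₀ γ T f (fun z => z.2 x * z.2 y) z
      = accel ω₀ f z.1 x * z.2 y + z.2 x * accel ω₀ f z.1 y - 4 * γ * (z.2 x * z.2 y)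
        + if x = y then 4 * γ * (if x = 0 then T else z.2 x ^ 2) else 0 := by
  have hd : fderiv ℝ (fun z : Phase n => z.2 x * z.2 y) z (drift ω₀ f z)
      = accel ω₀ f z.1 x * z.2 y + z.2 x * accel ω₀ f z.1 y := by
    rw [fderiv_fun_mul ((contDiff_snd_apply x).differentiable (by simp) z)
      ((contDiff_snd_apply y).differentiable (by simp) z)]
    simp only [_root_.add_apply, _root_.smul_apply, fderiv_snd_apply,
      smul_eq_mul, drift]
    ring
  have hp : partialP 0 (fun z : Phase n => z.2 x * z.2 y) = fun z =>
      z.2 x * (if y = 0 then 1 else 0) + z.2 y * (if x = 0 then 1 else 0) := by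
    rw [partialP_mul (contDiff_snd_apply x) (contDiff_snd_apply y)]
    simp only [partialP_snd_apply]
  have hpp : partialP 0 (fun z : Phase n =>
      z.2 x * (if y = 0 then (1 : ℝ) else 0) + z.2 y * (if x = 0 then 1 else 0))
      = fun _ => 2 * ((if x = 0 then 1 else 0) * (if y = 0 then 1 else 0)) := by
    rw [partialP_add ((contDiff_snd_apply x).mul contDiff_const)
      ((contDiff_snd_apply y).mul contDiff_const),
      partialP_mul (contDiff_snd_apply x) contDiff_const,
      partialP_mul (contDiff_snd_apply y) contDiff_const]
    simp only [partialP_snd_apply, partialP_const]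
    ext
    ring
  simp only [generator, hamiltonianPart_eq, hd, flipPart_snd_mul_snd, thermostatPart, hp, hpp]
  by_cases hx : x = 0 <;> by_cases hy : y = 0
  · subst hx; subst hy; simp; ring
  · subst hx; simp [hy, Ne.symm hy]; ring
  · subst hy; simp [hx]; ring
  · by_cases hxy : x = y
    · subst hxy; simp [hx]; ring
    · simp [hx, hy, hxy]; ring

/-! ### The stiffness matrix and the commutator estimate -/

/-- The index of the right neighbour of `x`. -/
def rightIdx (x : Fin (n + 1)) : Fin (n + 1) :=
  if h : (x : ℕ) + 1 < n + 1 then ⟨(x : ℕ) + 1, h⟩ else x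

/-- The index of the left neighbour of `x`. -/
def leftIdx (x : Fin (n + 1)) : Fin (n + 1) :=
  ⟨(x : ℕ) - 1, lt_of_le_of_lt (Nat.sub_le _ _) x.isLt⟩

lemma rightNeighbour_eq (q : Fin (n + 1) → ℝ) (x : Fin (n + 1)) :
    rightNeighbour q x = q (rightIdx x) := by
  unfold rightNeighbour rightIdx
  split_ifs <;> rfl

lemma leftNeighbour_eq (q : Fin (n + 1) → ℝ) (x : Fin (n + 1)) :
    leftNeighbour q x = q (leftIdx x) := rfl

lemma rightIdx_castSucc (x : Fin n) : rightIdx x.castSucc = x.succ := by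
  ext
  simp [rightIdx]

lemma rightIdx_last : rightIdx (Fin.last n) = Fin.last n := by
  ext
  simp [rightIdx]

lemma leftIdx_succ (x : Fin n) : leftIdx x.succ = x.castSucc := by
  ext
  simp [leftIdx]

lemma leftIdx_zero : leftIdx (0 : Fin (n + 1)) = 0 := by
  ext
  simp [leftIdx]

/-- The right shift misses `0` and hits `n` twice, the left shift misses `n` and hits `0` twice:
together they hit each site exactly twice. -/
lemma sum_neighbours (g : Fin (n + 1) → ℝ) :
    ∑ x, g (rightIdx x) + ∑ x, g (leftIdx x) = 2 * ∑ x, g x := by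
  rw [Fin.sum_univ_castSucc (fun x => g (rightIdx x)), Fin.sum_univ_succ (fun x => g (leftIdx x))]
  simp only [rightIdx_castSucc, rightIdx_last, leftIdx_succ, leftIdx_zero]
  have h1 := Fin.sum_univ_castSucc g
  have h2 := Fin.sum_univ_succ g
  linarith

/-- Excluding `x = y` removes the self-loops created by the Neumann conventions at the two ends;
this gives the symmetry of the stiffness matrix. -/
lemma eq_rightIdx_or_iff {x y : Fin (n + 1)} (h : x ≠ y) : y = rightIdx x ↔ x = leftIdx y := by
  have h' : (x : ℕ) ≠ y := fun h' => h (Fin.ext h')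
  have hx := x.isLt
  have hy := y.isLt
  unfold rightIdx leftIdx
  split_ifs <;> rw [Fin.ext_iff, Fin.ext_iff] <;> dsimp only <;> omega

/-- The matrix of `ω₀² - Δ_N`. -/
def stiffness (n : ℕ) (ω₀ : ℝ) : Matrix (Fin (n + 1)) (Fin (n + 1)) ℝ :=
  Matrix.of fun x y => (if y = x then 2 + ω₀ ^ 2 else 0)
    - (if y = rightIdx x then 1 else 0) - if y = leftIdx x then 1 else 0

lemma stiffness_apply (ω₀ : ℝ) (x y : Fin (n + 1)) :
    stiffness n ω₀ x y = (if y = x then 2 + ω₀ ^ 2 else 0)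
      - (if y = rightIdx x then 1 else 0) - if y = leftIdx x then 1 else 0 := rfl

lemma sum_stiffness_mul (ω₀ : ℝ) (v : Fin (n + 1) → ℝ) (x : Fin (n + 1)) :
    ∑ y, stiffness n ω₀ x y * v y = (2 + ω₀ ^ 2) * v x - v (rightIdx x) - v (leftIdx x) := by
  simp [stiffness_apply, sub_mul, Finset.sum_sub_distrib, ite_mul]

lemma accel_eq (ω₀ f : ℝ) (q : Fin (n + 1) → ℝ) (x : Fin (n + 1)) :
    accel ω₀ f q x
      = -∑ y, stiffness n ω₀ x y * q y + if x = Fin.last n then f else 0 := by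
  rw [sum_stiffness_mul, accel, neumannLaplacian, rightNeighbour_eq, leftNeighbour_eq]
  ring

lemma stiffness_symm (ω₀ : ℝ) (x y : Fin (n + 1)) :
    stiffness n ω₀ x y = stiffness n ω₀ y x := by
  by_cases h : x = y
  · rw [h]
  · simp only [stiffness_apply, eq_rightIdx_or_iff h, eq_rightIdx_or_iff (Ne.symm h), h, Ne.symm h,
      if_false]
    ring

lemma stiffness_transpose (ω₀ : ℝ) : (stiffness n ω₀).transpose = stiffness n ω₀ := by
  ext x y
  exact stiffness_symm ω₀ y x

/-- Because these entries do not vanish, the commutator of a diagonal matrix with the stiffness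
matrix sees the discrete gradient of the diagonal. -/
lemma stiffness_castSucc_succ (ω₀ : ℝ) (x : Fin n) :
    stiffness n ω₀ x.castSucc x.succ = -1 := by
  have h1 : x.succ ≠ x.castSucc := by
    intro h
    have := congrArg Fin.val h
    simp at this
  have h2 : x.succ ≠ leftIdx x.castSucc := by
    intro h
    have := congrArg Fin.val h
    simp [leftIdx] at this
    omega
  simp [stiffness_apply, rightIdx_castSucc, h1, h2]

lemma sum_sq_neighbours (v : Fin (n + 1) → ℝ) :
    ∑ x, v (rightIdx x) ^ 2 + ∑ x, v (leftIdx x) ^ 2 = 2 * ∑ x, v x ^ 2 :=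
  sum_neighbours fun x => v x ^ 2

/-- A bound for the square of the operator norm of the stiffness matrix. -/
noncomputable def stiffnessBound (ω₀ : ℝ) : ℝ := 3 * ((2 + ω₀ ^ 2) ^ 2 + 2)

/-- Site by site `(a - b - c)² ≤ 3(a² + b² + c²)`, and the two shifts together contribute twice the
sum of squares. The bound does not depend on `n`. -/
lemma sum_sq_stiffness_le (ω₀ : ℝ) (v : Fin (n + 1) → ℝ) :
    ∑ x, (∑ y, stiffness n ω₀ x y * v y) ^ 2 ≤ stiffnessBound ω₀ * ∑ x, v x ^ 2 := by
  have h : ∑ x, (∑ y, stiffness n ω₀ x y * v y) ^ 2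
      ≤ ∑ x, 3 * ((2 + ω₀ ^ 2) ^ 2 * v x ^ 2 + v (rightIdx x) ^ 2 + v (leftIdx x) ^ 2) := by
    refine Finset.sum_le_sum fun x _ => ?_
    rw [sum_stiffness_mul]
    nlinarith [sq_nonneg ((2 + ω₀ ^ 2) * v x + v (rightIdx x)),
      sq_nonneg ((2 + ω₀ ^ 2) * v x + v (leftIdx x)), sq_nonneg (v (rightIdx x) - v (leftIdx x))]
  refine h.trans (le_of_eq ?_)
  rw [← Finset.mul_sum, Finset.sum_add_distrib, Finset.sum_add_distrib, ← Finset.mul_sum, add_assoc,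
    sum_sq_neighbours, stiffnessBound]
  ring

/-- The Neumann Laplacian is nonpositive, so the pinning `ω₀²` is a spectral gap uniform in `n`. -/
lemma sum_mul_stiffness_ge (ω₀ : ℝ) (v : Fin (n + 1) → ℝ) :
    ω₀ ^ 2 * ∑ x, v x ^ 2 ≤ ∑ x, v x * ∑ y, stiffness n ω₀ x y * v y := by
  have h : ∑ x, ((1 + ω₀ ^ 2) * v x ^ 2 - (1 / 2) * (v (rightIdx x) ^ 2 + v (leftIdx x) ^ 2))
      ≤ ∑ x, v x * ∑ y, stiffness n ω₀ x y * v y := by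
    refine Finset.sum_le_sum fun x _ => ?_
    rw [sum_stiffness_mul]
    nlinarith [sq_nonneg (v x - v (rightIdx x)), sq_nonneg (v x - v (leftIdx x))]
  refine le_trans (le_of_eq ?_) h
  rw [Finset.sum_sub_distrib, ← Finset.mul_sum, ← Finset.mul_sum, Finset.sum_add_distrib,
    sum_sq_neighbours]
  ring

/-- The square of the Hilbert–Schmidt norm. -/
def hsNormSq {m : Type*} [Fintype m] (M : Matrix m m ℝ) : ℝ := ∑ x, ∑ y, M x y ^ 2

section hs

variable {m : Type*} [Fintype m]

lemma hsNormSq_nonneg (M : Matrix m m ℝ) : 0 ≤ hsNormSq M :=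
  Finset.sum_nonneg fun _ _ => Finset.sum_nonneg fun _ _ => sq_nonneg _

lemma hsNormSq_transpose (M : Matrix m m ℝ) : hsNormSq M.transpose = hsNormSq M :=
  Finset.sum_comm

lemma hsNormSq_neg (M : Matrix m m ℝ) : hsNormSq (-M) = hsNormSq M := by
  simp [hsNormSq]

lemma hsNormSq_add_le (M N : Matrix m m ℝ) :
    hsNormSq (M + N) ≤ 2 * hsNormSq M + 2 * hsNormSq N := by
  unfold hsNormSq
  simp only [Finset.mul_sum, ← Finset.sum_add_distrib]
  refine Finset.sum_le_sum fun x _ => Finset.sum_le_sum fun y _ => ?_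
  rw [Matrix.add_apply]
  nlinarith [sq_nonneg (M x y - N x y)]

lemma hsNormSq_sub_le (M N : Matrix m m ℝ) :
    hsNormSq (M - N) ≤ 2 * hsNormSq M + 2 * hsNormSq N := by
  rw [sub_eq_add_neg, ← hsNormSq_neg N]
  exact hsNormSq_add_le _ _

lemma hsNormSq_smul (c : ℝ) (M : Matrix m m ℝ) : hsNormSq (c • M) = c ^ 2 * hsNormSq M := by
  simp [hsNormSq, Finset.mul_sum, mul_pow]

lemma sq_apply_le_hsNormSq (M : Matrix m m ℝ) (x y : m) : M x y ^ 2 ≤ hsNormSq M :=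
  (Finset.single_le_sum (f := fun y => M x y ^ 2) (fun _ _ => sq_nonneg _)
    (Finset.mem_univ y)).trans
    (Finset.single_le_sum (f := fun x => ∑ y, M x y ^ 2)
      (fun _ _ => Finset.sum_nonneg fun _ _ => sq_nonneg _) (Finset.mem_univ x))

lemma eq_zero_of_hsNormSq_le_zero {M : Matrix m m ℝ} (h : hsNormSq M ≤ 0) : M = 0 := by
  ext x y
  exact pow_eq_zero_iff two_ne_zero |>.1
    (le_antisymm ((sq_apply_le_hsNormSq M x y).trans h) (sq_nonneg _))

lemma trace_mul_transpose_self (M : Matrix m m ℝ) : (M * M.transpose).trace = hsNormSq M := by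
  simp [Matrix.trace, Matrix.mul_apply, hsNormSq, sq]

end hs

lemma hsNormSq_stiffness_mul_le (ω₀ : ℝ) (M : Matrix (Fin (n + 1)) (Fin (n + 1)) ℝ) :
    hsNormSq (stiffness n ω₀ * M) ≤ stiffnessBound ω₀ * hsNormSq M := by
  unfold hsNormSq
  rw [Finset.sum_comm, Finset.sum_comm (f := fun x y => M x y ^ 2), Finset.mul_sum]
  exact Finset.sum_le_sum fun y _ => sum_sq_stiffness_le ω₀ fun x => M x y

lemma hsNormSq_mul_stiffness_le (ω₀ : ℝ) (M : Matrix (Fin (n + 1)) (Fin (n + 1)) ℝ) :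
    hsNormSq (M * stiffness n ω₀) ≤ stiffnessBound ω₀ * hsNormSq M := by
  rw [← hsNormSq_transpose, Matrix.transpose_mul, stiffness_transpose, ← hsNormSq_transpose M]
  exact hsNormSq_stiffness_mul_le _ _

lemma hsNormSq_le_trace (ω₀ : ℝ) (M : Matrix (Fin (n + 1)) (Fin (n + 1)) ℝ) :
    ω₀ ^ 2 * hsNormSq M ≤ (stiffness n ω₀ * (M * M.transpose)).trace := by
  have h : (stiffness n ω₀ * (M * M.transpose)).trace
      = ∑ y, ∑ x, M x y * ∑ z, stiffness n ω₀ x z * M z y := by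
    rw [← Matrix.mul_assoc, Finset.sum_comm]
    simp only [Matrix.trace, Matrix.diag_apply, Matrix.mul_apply, Matrix.transpose_apply]
    exact Finset.sum_congr rfl fun x _ => Finset.sum_congr rfl fun y _ => mul_comm _ _
  rw [h, hsNormSq, Finset.sum_comm, Finset.mul_sum]
  exact Finset.sum_le_sum fun y _ => sum_mul_stiffness_ge ω₀ fun x => M x y

/-- The constant of the bound of the temperature gradient by the currents. -/
noncomputable def gradientConst (ω₀ γ : ℝ) : ℝ :=
  32 * γ ^ 2 * stiffnessBound ω₀ + 2 * stiffnessBound ω₀ ^ 2 / γ ^ 2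

lemma stiffnessBound_pos (ω₀ : ℝ) : 0 < stiffnessBound ω₀ := by
  unfold stiffnessBound
  positivity

lemma gradientConst_nonneg (ω₀ γ : ℝ) : 0 ≤ gradientConst ω₀ γ := by
  have := stiffnessBound_pos ω₀
  unfold gradientConst
  positivity

/-! ### Consequences of the stationary covariance equations -/

section covariance

variable {ω₀ γ : ℝ} {P Q S : Matrix (Fin (n + 1)) (Fin (n + 1)) ℝ} {d : Fin (n + 1) → ℝ}

lemma trace_diagonal_mul (P : Matrix (Fin (n + 1)) (Fin (n + 1)) ℝ) (d : Fin (n + 1) → ℝ) :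
    (Matrix.diagonal d * (Matrix.diagonal d - P)).trace = ∑ x, d x * (d x - P x x) := by
  simp [Matrix.trace, Matrix.diagonal_mul]

/-- The dissipation of the covariance equations controls the currents. -/
lemma hsNormSq_current_le (hγ : 0 < γ) (hP : P.transpose = P) (hQ : Q.transpose = Q)
    (hS : S.transpose = -S) (h1 : P = Q * stiffness n ω₀ + (2 * γ) • S)
    (h2 : stiffness n ω₀ * S - S * stiffness n ω₀ = (4 * γ) • (Matrix.diagonal d - P)) :
    ω₀ ^ 2 * hsNormSq S ≤ ∑ x, d x * (d x - P x x) := by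
  set A := stiffness n ω₀ with hA
  have hAt : A.transpose = A := stiffness_transpose ω₀
  have h1' : P = A * Q - (2 * γ) • S := by
    have := congrArg Matrix.transpose h1
    rw [hP, Matrix.transpose_add, Matrix.transpose_mul, Matrix.transpose_smul, hAt, hQ, hS] at this
    rw [this, smul_neg, sub_eq_add_neg]
  set M := Matrix.diagonal d - P with hM
  have hMt : M.transpose = M := by
    rw [hM, Matrix.transpose_sub, Matrix.diagonal_transpose, hP]
  -- Both `PA` and `AP` contain `AQA`, so `Q` cancels and the commutator depends on `S` alone.
  have hcomm : P * A - A * P = (-(2 * γ)) • (S * A + A * S) := by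
    have e1 : P * A = A * Q * A - (2 * γ) • (S * A) := by
      rw [h1', Matrix.sub_mul, Matrix.smul_mul]
    have e2 : A * P = A * Q * A + (2 * γ) • (A * S) := by
      rw [h1, Matrix.mul_add, Matrix.mul_smul, Matrix.mul_assoc]
    rw [e1, e2, neg_smul, smul_add]
    abel
  -- By cyclicity `tr P[A, S] = tr [P, A]S`. The left side is `4γ tr PM`; the right side is `-4γ tr
  -- A S²`, and `S² = -S Sᵀ` makes it nonnegative.
  have h3 : (4 * γ) * (P * M).trace = (4 * γ) * (A * (S * S.transpose)).trace := by
    have e : (P * (A * S - S * A)).trace = ((P * A - A * P) * S).trace := by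
      rw [Matrix.mul_sub, Matrix.sub_mul, Matrix.trace_sub, Matrix.trace_sub, ← Matrix.mul_assoc,
        ← Matrix.mul_assoc P S A, Matrix.trace_mul_comm (P * S) A, ← Matrix.mul_assoc]
    rw [h2, hcomm, Matrix.mul_smul, Matrix.trace_smul, Matrix.smul_mul, Matrix.trace_smul,
      Matrix.add_mul, Matrix.trace_add, Matrix.trace_mul_comm (S * A) S, ← Matrix.mul_assoc,
      Matrix.trace_mul_comm (S * S) A, Matrix.mul_assoc] at e
    rw [hS, Matrix.mul_neg, Matrix.mul_neg, Matrix.trace_neg]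
    simp only [smul_eq_mul] at e
    rw [e]
    ring
  have h4 : (P * M).trace = (A * (S * S.transpose)).trace :=
    mul_left_cancel₀ (by positivity) h3
  -- `D = P + M` with `M` symmetric; the extra `‖M‖²` is nonnegative and is discarded below.
  have h5 : (Matrix.diagonal d * M).trace = (P * M).trace + hsNormSq M := by
    rw [← trace_mul_transpose_self, hMt, ← Matrix.trace_add, ← Matrix.add_mul, hM]
    simp
  rw [← trace_diagonal_mul, h5, h4]
  linarith [hsNormSq_le_trace ω₀ S, hsNormSq_nonneg M]

/-- The currents control the temperature gradient. -/
lemma sum_sq_gradient_le (hγ : 0 < γ) (hP : P.transpose = P) (hQ : Q.transpose = Q)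
    (hS : S.transpose = -S) (h1 : P = Q * stiffness n ω₀ + (2 * γ) • S)
    (h2 : stiffness n ω₀ * S - S * stiffness n ω₀ = (4 * γ) • (Matrix.diagonal d - P)) :
    ∑ x : Fin n, (d x.castSucc - d x.succ) ^ 2 ≤ gradientConst ω₀ γ * hsNormSq S := by
  set A := stiffness n ω₀ with hA
  have hAt : A.transpose = A := stiffness_transpose ω₀
  have h1' : P = A * Q - (2 * γ) • S := by
    have := congrArg Matrix.transpose h1
    rw [hP, Matrix.transpose_add, Matrix.transpose_mul, Matrix.transpose_smul, hAt, hQ, hS] at this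
    rw [this, smul_neg, sub_eq_add_neg]
  have hcomm : P * A - A * P = (-(2 * γ)) • (S * A + A * S) := by
    have e1 : P * A = A * Q * A - (2 * γ) • (S * A) := by
      rw [h1', Matrix.sub_mul, Matrix.smul_mul]
    have e2 : A * P = A * Q * A + (2 * γ) • (A * S) := by
      rw [h1, Matrix.mul_add, Matrix.mul_smul, Matrix.mul_assoc]
    rw [e1, e2, neg_smul, smul_add]
    abel
  set B := A * S - S * A with hB
  -- Splitting `D` into `P` and a multiple of `[A, S]` makes `[D, A]` linear in `S`, through `[P,
  -- A]` and a double commutator.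
  have hD : Matrix.diagonal d = P + (4 * γ)⁻¹ • B := by
    rw [h2, smul_smul, inv_mul_cancel₀ (by positivity), one_smul]
    abel
  have hDA : Matrix.diagonal d * A - A * Matrix.diagonal d
      = (-(2 * γ)) • (S * A + A * S) + (4 * γ)⁻¹ • (B * A - A * B) := by
    rw [← hcomm, hD, Matrix.add_mul, Matrix.mul_add, Matrix.smul_mul, Matrix.mul_smul, smul_sub]
    abel
  have hK := stiffnessBound_pos ω₀
  have b1 : hsNormSq (S * A + A * S) ≤ 4 * stiffnessBound ω₀ * hsNormSq S := by
    linarith [hsNormSq_add_le (S * A) (A * S), hsNormSq_stiffness_mul_le ω₀ S,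
      hsNormSq_mul_stiffness_le ω₀ S]
  have b2 : hsNormSq B ≤ 4 * stiffnessBound ω₀ * hsNormSq S := by
    linarith [hsNormSq_sub_le (A * S) (S * A), hsNormSq_stiffness_mul_le ω₀ S,
      hsNormSq_mul_stiffness_le ω₀ S]
  have b3 : hsNormSq (B * A - A * B) ≤ 4 * stiffnessBound ω₀ * hsNormSq B := by
    linarith [hsNormSq_sub_le (B * A) (A * B), hsNormSq_stiffness_mul_le ω₀ B,
      hsNormSq_mul_stiffness_le ω₀ B]
  have b4 : hsNormSq (B * A - A * B) ≤ 16 * stiffnessBound ω₀ ^ 2 * hsNormSq S := by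
    refine b3.trans ?_
    have := mul_le_mul_of_nonneg_left b2 (by positivity : 0 ≤ 4 * stiffnessBound ω₀)
    linarith
  -- With `K = stiffnessBound ω₀`, the two terms of `gradientConst` are `2(2γ)² · 4K` and `2(4γ)⁻² ·
  -- 16K²`.
  have b5 : hsNormSq (Matrix.diagonal d * A - A * Matrix.diagonal d)
      ≤ gradientConst ω₀ γ * hsNormSq S := by
    rw [hDA]
    refine (hsNormSq_add_le _ _).trans ?_
    rw [hsNormSq_smul, hsNormSq_smul]
    have c1 := mul_le_mul_of_nonneg_left b1 (by positivity : 0 ≤ 2 * (-(2 * γ)) ^ 2)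
    have c2 := mul_le_mul_of_nonneg_left b4 (by positivity : 0 ≤ 2 * ((4 * γ)⁻¹) ^ 2)
    have e : gradientConst ω₀ γ * hsNormSq S
        = 2 * (-(2 * γ)) ^ 2 * (4 * stiffnessBound ω₀ * hsNormSq S)
          + 2 * ((4 * γ)⁻¹) ^ 2 * (16 * stiffnessBound ω₀ ^ 2 * hsNormSq S) := by
      unfold gradientConst
      field_simp
      ring
    rw [e]
    linarith
  refine le_trans ?_ b5
  have hent (x : Fin n) : (d x.castSucc - d x.succ) ^ 2
      = (Matrix.diagonal d * A - A * Matrix.diagonal d) x.castSucc x.succ ^ 2 := by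
    rw [Matrix.sub_apply, Matrix.diagonal_mul, Matrix.mul_diagonal, hA, stiffness_castSucc_succ]
    ring
  unfold hsNormSq
  rw [Fin.sum_univ_castSucc]
  refine le_trans (Finset.sum_le_sum fun x _ => ?_) (le_add_of_nonneg_right
    (Finset.sum_nonneg fun _ _ => sq_nonneg _))
  rw [hent]
  exact Finset.single_le_sum
    (f := fun y => (Matrix.diagonal d * A - A * Matrix.diagonal d) x.castSucc y ^ 2)
    (fun _ _ => sq_nonneg _) (Finset.mem_univ _)

end covariance

/-! ### A quadratic Lyapunov function -/

/-- The sum of the squares of all coordinates. -/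
def sqNorm (z : Phase n) : ℝ := ∑ x, z.1 x ^ 2 + ∑ x, z.2 x ^ 2

lemma sqNorm_nonneg (z : Phase n) : 0 ≤ sqNorm z :=
  add_nonneg (Finset.sum_nonneg fun _ _ => sq_nonneg _) (Finset.sum_nonneg fun _ _ => sq_nonneg _)

lemma contDiff_sqNorm : ContDiff ℝ ∞ (sqNorm : Phase n → ℝ) := by
  unfold sqNorm
  fun_prop

lemma sq_fst_le_sqNorm (z : Phase n) (x : Fin (n + 1)) : z.1 x ^ 2 ≤ sqNorm z :=
  (Finset.single_le_sum (f := fun x => z.1 x ^ 2) (fun _ _ => sq_nonneg _)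
    (Finset.mem_univ x)).trans (le_add_of_nonneg_right (Finset.sum_nonneg fun _ _ => sq_nonneg _))

lemma sq_snd_le_sqNorm (z : Phase n) (x : Fin (n + 1)) : z.2 x ^ 2 ≤ sqNorm z :=
  (Finset.single_le_sum (f := fun x => z.2 x ^ 2) (fun _ _ => sq_nonneg _)
    (Finset.mem_univ x)).trans (le_add_of_nonneg_left (Finset.sum_nonneg fun _ _ => sq_nonneg _))

lemma abs_fst_le_sqrt (z : Phase n) (x : Fin (n + 1)) : |z.1 x| ≤ √(sqNorm z) :=
  Real.abs_le_sqrt (sq_fst_le_sqNorm z x)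

lemma abs_snd_le_sqrt (z : Phase n) (x : Fin (n + 1)) : |z.2 x| ≤ √(sqNorm z) :=
  Real.abs_le_sqrt (sq_snd_le_sqNorm z x)

lemma norm_le_sqrt_sqNorm (z : Phase n) : ‖z‖ ≤ √(sqNorm z) := by
  rw [Prod.norm_def]
  refine max_le ?_ ?_
  · exact (pi_norm_le_iff_of_nonneg (Real.sqrt_nonneg _)).2 fun x => abs_fst_le_sqrt z x
  · exact (pi_norm_le_iff_of_nonneg (Real.sqrt_nonneg _)).2 fun x => abs_snd_le_sqrt z x

lemma sqNorm_flipAt (x : Fin (n + 1)) (z : Phase n) : sqNorm (flipAt x z) = sqNorm z := by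
  unfold sqNorm
  congr 1
  refine Finset.sum_congr rfl fun y _ => ?_
  rw [flipAt_snd_apply]
  split_ifs <;> ring

/-- The indices of the quadratic monomials `q_x q_y`, `q_x p_y`, `p_x p_y`. -/
abbrev QuadIndex (n : ℕ) : Type :=
  (Fin (n + 1) × Fin (n + 1)) ⊕ (Fin (n + 1) × Fin (n + 1)) ⊕ (Fin (n + 1) × Fin (n + 1))

/-- The quadratic monomials. -/
def quadMonomial (z : Phase n) : QuadIndex n → ℝ
  | .inl i => z.1 i.1 * z.1 i.2
  | .inr (.inl i) => z.1 i.1 * z.2 i.2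
  | .inr (.inr i) => z.2 i.1 * z.2 i.2

/-- The quadratic form with given coefficients. -/
def quadForm (v : QuadIndex n → ℝ) (z : Phase n) : ℝ := ∑ i, v i * quadMonomial z i

lemma quadForm_add (v w : QuadIndex n → ℝ) (z : Phase n) :
    quadForm (v + w) z = quadForm v z + quadForm w z := by
  simp [quadForm, add_mul, Finset.sum_add_distrib]

lemma quadForm_smul (c : ℝ) (v : QuadIndex n → ℝ) (z : Phase n) :
    quadForm (c • v) z = c * quadForm v z := by
  simp only [quadForm, Finset.mul_sum, Pi.smul_apply, smul_eq_mul, mul_assoc]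

lemma quadForm_sum {ι : Type*} (s : Finset ι) (v : ι → QuadIndex n → ℝ) (z : Phase n) :
    quadForm (∑ j ∈ s, v j) z = ∑ j ∈ s, quadForm (v j) z := by
  unfold quadForm
  rw [Finset.sum_comm]
  simp [Finset.sum_apply, Finset.sum_mul]

lemma quadForm_single (i : QuadIndex n) (z : Phase n) :
    quadForm (Pi.single i 1) z = quadMonomial z i := by
  simp [quadForm, Pi.single_apply]

lemma contDiff_quadMonomial (i : QuadIndex n) :
    ContDiff ℝ ∞ fun z : Phase n => quadMonomial z i := by
  rcases i with i | i | i
  · exact (contDiff_fst_apply i.1).mul (contDiff_fst_apply i.2)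
  · exact (contDiff_fst_apply i.1).mul (contDiff_snd_apply i.2)
  · exact (contDiff_snd_apply i.1).mul (contDiff_snd_apply i.2)

lemma contDiff_quadForm (v : QuadIndex n → ℝ) : ContDiff ℝ ∞ (quadForm v) :=
  ContDiff.sum fun i _ => contDiff_const.mul (contDiff_quadMonomial i)

lemma abs_mul_le_of_abs_le_sqrt {a b s : ℝ} (hs : 0 ≤ s) (ha : |a| ≤ √s) (hb : |b| ≤ √s) :
    |a * b| ≤ s := by
  rw [abs_mul]
  calc |a| * |b| ≤ √s * √s := mul_le_mul ha hb (abs_nonneg _) (Real.sqrt_nonneg _)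
    _ = s := Real.mul_self_sqrt hs

lemma abs_quadMonomial_le (i : QuadIndex n) (z : Phase n) : |quadMonomial z i| ≤ sqNorm z := by
  rcases i with i | i | i <;>
  exact abs_mul_le_of_abs_le_sqrt (sqNorm_nonneg z) (by first | exact abs_fst_le_sqrt _ _ | exact abs_snd_le_sqrt _ _)
    (by first | exact abs_fst_le_sqrt _ _ | exact abs_snd_le_sqrt _ _)

lemma abs_quadForm_le (v : QuadIndex n → ℝ) (z : Phase n) :
    |quadForm v z| ≤ Fintype.card (QuadIndex n) * ‖v‖ * sqNorm z := by
  unfold quadForm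
  refine (Finset.abs_sum_le_sum_abs _ _).trans ?_
  have : ∀ i ∈ Finset.univ, |v i * quadMonomial z i| ≤ ‖v‖ * sqNorm z := fun i _ => by
    rw [abs_mul]
    exact mul_le_mul (norm_le_pi_norm v i) (abs_quadMonomial_le i z) (abs_nonneg _) (norm_nonneg _)
  refine (Finset.sum_le_card_nsmul _ _ _ this).trans (le_of_eq ?_)
  rw [nsmul_eq_mul, Finset.card_univ]
  ring

/-- The coefficients of the positive definite quadratic forms. -/
def posForms (n : ℕ) : Set (QuadIndex n → ℝ) :=
  {v | ∃ c : ℝ, 0 < c ∧ ∀ z, c * sqNorm z ≤ quadForm v z}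

lemma convex_posForms : Convex ℝ (posForms n) := by
  rintro v ⟨c, hc, hv⟩ w ⟨d, hd, hw⟩ a b ha hb hab
  refine ⟨a * c + b * d, ?_, fun z => ?_⟩
  · rcases ha.eq_or_lt with rfl | ha
    · have : b = 1 := by linarith
      subst this
      linarith
    · have := mul_pos ha hc
      have := mul_nonneg hb hd.le
      linarith
  · rw [quadForm_add, quadForm_smul, quadForm_smul]
    have h1 := mul_le_mul_of_nonneg_left (hv z) ha
    have h2 := mul_le_mul_of_nonneg_left (hw z) hb
    linarith

lemma isOpen_posForms : IsOpen (posForms n) := by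
  rw [Metric.isOpen_iff]
  rintro v ⟨c, hc, hv⟩
  set N : ℝ := (Fintype.card (QuadIndex n) : ℝ) with hN
  have hN0 : 0 ≤ N := Nat.cast_nonneg _
  -- Within this radius the perturbation costs at most half of the lower bound `c`; `N + 1` instead
  -- of `N` keeps the denominator visibly positive.
  refine ⟨c / (2 * (N + 1)), by positivity, fun w hw => ⟨c / 2, by positivity, fun z => ?_⟩⟩
  have h1 := abs_quadForm_le (w - v) z
  rw [Metric.mem_ball, dist_eq_norm] at hw
  have h2 : quadForm w z = quadForm v z + quadForm (w - v) z := by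
    rw [← quadForm_add]
    congr 1
    abel
  have h3 : N * ‖w - v‖ ≤ c / 2 := by
    calc N * ‖w - v‖ ≤ (N + 1) * (c / (2 * (N + 1))) :=
          mul_le_mul (by linarith) hw.le (norm_nonneg _) (by positivity)
      _ = c / 2 := by field_simp
  have h4 := mul_le_mul_of_nonneg_right h3 (sqNorm_nonneg z)
  have h5 := neg_abs_le (quadForm (w - v) z)
  have h6 := hv z
  rw [h2]
  linarith

/-- The coefficients of `sqNorm`. -/
def sqNormCoeff (n : ℕ) : QuadIndex n → ℝ
  | .inl i => if i.1 = i.2 then 1 else 0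
  | .inr (.inl _) => 0
  | .inr (.inr i) => if i.1 = i.2 then 1 else 0

lemma quadForm_sqNormCoeff (z : Phase n) : quadForm (sqNormCoeff n) z = sqNorm z := by
  simp [quadForm, Fintype.sum_prod_type, sqNormCoeff, quadMonomial, sqNorm, sq]

/-- The pairs of quadratic forms `(V, W)` for which `𝒢V + W` is a constant, without force. -/
def dissipationPairs (n : ℕ) (ω₀ γ T : ℝ) : Submodule ℝ ((QuadIndex n → ℝ) × (QuadIndex n → ℝ)) where
  carrier := {u | ∃ k : ℝ, ∀ z, generator ω₀ γ T 0 (quadForm u.1) z + quadForm u.2 z = k}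
  add_mem' := by
    rintro u v ⟨k, hk⟩ ⟨l, hl⟩
    refine ⟨k + l, fun z => ?_⟩
    have : quadForm (u + v).1 = fun z => quadForm u.1 z + quadForm v.1 z :=
      funext fun z => quadForm_add _ _ z
    rw [this, generator_add _ _ _ _ (contDiff_quadForm _) (contDiff_quadForm _), Prod.snd_add,
      quadForm_add, ← hk z, ← hl z]
    ring
  zero_mem' := by
    refine ⟨0, fun z => ?_⟩
    have : quadForm (0 : (QuadIndex n → ℝ) × (QuadIndex n → ℝ)).1 = fun _ => 0 :=
      funext fun z => by simp [quadForm]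
    rw [this, generator_const]
    simp [quadForm]
  smul_mem' := by
    rintro c u ⟨k, hk⟩
    refine ⟨c * k, fun z => ?_⟩
    have : quadForm (c • u).1 = fun z => c * quadForm u.1 z :=
      funext fun z => quadForm_smul _ _ z
    rw [this, generator_const_mul _ _ _ _ _ (contDiff_quadForm _), Prod.smul_snd, quadForm_smul,
      ← hk z]
    ring

lemma mem_dissipationPairs {ω₀ γ T : ℝ} {v w : QuadIndex n → ℝ} (k : ℝ)
    (h : ∀ z, generator ω₀ γ T 0 (quadForm v) z + quadForm w z = k) :
    (v, w) ∈ dissipationPairs n ω₀ γ T := ⟨k, h⟩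

lemma quadForm_single_eq (i : QuadIndex n) :
    quadForm (Pi.single i 1) = fun z => quadMonomial z i := funext fun z => quadForm_single i z

/-! ### Moment equations of a separating functional -/

section duality

variable {ω₀ γ T : ℝ} {g : ((QuadIndex n → ℝ) × (QuadIndex n → ℝ)) →ₗ[ℝ] ℝ}

/-- `q_x q_y` and `q_y q_x` are distinct indices, so the coefficients are not determined by the
form. Coefficients of the zero form give an element of `dissipationPairs`, so `g (0, ·)` depends
only on the form; this yields the symmetry of the matrices of moments. -/
lemma dual_swap (hg : ∀ u ∈ dissipationPairs n ω₀ γ T, g u = 0) {v w : QuadIndex n → ℝ}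
    (h : ∀ z, quadForm v z = quadForm w z) : g (0, v) = g (0, w) := by
  have h1 : ((0 : QuadIndex n → ℝ), v - w) ∈ dissipationPairs n ω₀ γ T := by
    refine mem_dissipationPairs 0 fun z => ?_
    have e : quadForm (0 : QuadIndex n → ℝ) = fun _ => 0 := funext fun z => by simp [quadForm]
    have e2 : quadForm (v - w) z = 0 := by
      have := quadForm_add (v - w) w z
      rw [sub_add_cancel, h z] at this
      linarith
    rw [e, generator_const, e2, add_zero]
  have h2 := hg _ h1
  have h3 : ((0 : QuadIndex n → ℝ), v - w) = (0, v) - (0, w) := by simp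
  rw [h3, map_sub] at h2
  linarith

/-- Constants are invisible to `g`, so the heat input `4γT` disappears. Read `g (0, ·)` as second
moments at zero temperature and `g (·, 0)` as their time derivative. -/
lemma dual_eq (hg : ∀ u ∈ dissipationPairs n ω₀ γ T, g u = 0) (v w : QuadIndex n → ℝ) (k : ℝ)
    (h : ∀ z, generator ω₀ γ T 0 (quadForm v) z = quadForm w z + k) : g (v, 0) = g (0, w) := by
  have h1 : (v, -w) ∈ dissipationPairs n ω₀ γ T := by
    refine mem_dissipationPairs k fun z => ?_
    have : -w = (-1 : ℝ) • w := by simp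
    rw [h z, this, quadForm_smul]
    ring
  have h2 := hg _ h1
  have h3 : (v, -w) = (v, 0) - (0, w) := by simp
  rw [h3, map_sub] at h2
  linarith

/-- Together with `dual_fst_snd` and `dual_snd_snd`, these are the closed moment equations in the
reading of `dual_eq`. -/
lemma dual_fst_fst (hg : ∀ u ∈ dissipationPairs n ω₀ γ T, g u = 0) (x y : Fin (n + 1)) :
    g (Pi.single (.inl (x, y)) 1, 0) = g (0, Pi.single (.inr (.inl (x, y))) 1)
      + g (0, Pi.single (.inr (.inl (y, x))) 1) := by
  rw [dual_eq hg _ (Pi.single (.inr (.inl (x, y))) 1 + Pi.single (.inr (.inl (y, x))) 1) 0,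
    ← map_add]
  · simp
  · intro z
    rw [quadForm_add, quadForm_single, quadForm_single, quadForm_single_eq]
    simp only [quadMonomial]
    rw [generator_fst_mul_fst]
    ring

lemma dual_fst_snd (hg : ∀ u ∈ dissipationPairs n ω₀ γ T, g u = 0) (x y : Fin (n + 1)) :
    g (Pi.single (.inr (.inl (x, y))) 1, 0) = g (0, Pi.single (.inr (.inr (x, y))) 1)
      - ∑ z, stiffness n ω₀ y z * g (0, Pi.single (.inl (x, z)) 1)
      - 2 * γ * g (0, Pi.single (.inr (.inl (x, y))) 1) := by
  rw [dual_eq hg _ (Pi.single (.inr (.inr (x, y))) 1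
    + ((∑ z, (-stiffness n ω₀ y z) • Pi.single (.inl (x, z)) 1)
    + (-(2 * γ)) • Pi.single (.inr (.inl (x, y))) 1)) 0]
  · have e (c : ℝ) (w : QuadIndex n → ℝ) : g (0, c • w) = c * g (0, w) := by
      have : ((0 : QuadIndex n → ℝ), c • w) = c • (0, w) := by simp
      rw [this, map_smul, smul_eq_mul]
    have e' (v w : QuadIndex n → ℝ) : g (0, v + w) = g (0, v) + g (0, w) := by
      rw [← map_add]
      simp
    have e2 : g (0, ∑ z, (-stiffness n ω₀ y z) • Pi.single (.inl (x, z)) 1)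
        = ∑ z, (-stiffness n ω₀ y z) * g (0, Pi.single (.inl (x, z)) 1) := by
      have := map_sum (g.comp (LinearMap.inr ℝ (QuadIndex n → ℝ) (QuadIndex n → ℝ)))
        (fun z => (-stiffness n ω₀ y z) • Pi.single (.inl (x, z)) (1 : ℝ)) Finset.univ
      simp only [LinearMap.comp_apply, LinearMap.inr_apply, e] at this
      exact this
    rw [e', e', e2, e]
    simp only [neg_mul, Finset.sum_neg_distrib]
    ring
  · intro z
    rw [quadForm_add, quadForm_add, quadForm_sum, quadForm_smul, quadForm_single_eq]
    simp only [quadForm_smul, quadForm_single, quadMonomial]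
    rw [generator_fst_mul_snd, accel_eq]
    simp only [neg_mul, Finset.sum_neg_distrib, mul_add, mul_neg, Finset.mul_sum]
    have : ∑ i, z.1 x * (stiffness n ω₀ y i * z.1 i) = ∑ i, stiffness n ω₀ y i * (z.1 x * z.1 i) :=
      Finset.sum_congr rfl fun i _ => by ring
    rw [this]
    simp
    ring

lemma dual_snd_snd (hg : ∀ u ∈ dissipationPairs n ω₀ γ T, g u = 0) (x y : Fin (n + 1)) :
    g (Pi.single (.inr (.inr (x, y))) 1, 0)
      = -(∑ z, stiffness n ω₀ x z * g (0, Pi.single (.inr (.inl (z, y))) 1))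
      - (∑ z, stiffness n ω₀ y z * g (0, Pi.single (.inr (.inl (z, x))) 1))
      + 4 * γ * ((if x = y then (if x = 0 then 0 else g (0, Pi.single (.inr (.inr (x, x))) 1)) else 0)
          - g (0, Pi.single (.inr (.inr (x, y))) 1)) := by
  rw [dual_eq hg _ ((∑ z, (-stiffness n ω₀ x z) • Pi.single (.inr (.inl (z, y))) 1)
    + ((∑ z, (-stiffness n ω₀ y z) • Pi.single (.inr (.inl (z, x))) 1)
    + ((4 * γ * if x = y then (if x = 0 then 0 else 1) else 0) • Pi.single (.inr (.inr (x, x))) 1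
      + (-(4 * γ)) • Pi.single (.inr (.inr (x, y))) 1)))
    (if x = y then (if x = 0 then 4 * γ * T else 0) else 0)]
  · have e (c : ℝ) (w : QuadIndex n → ℝ) : g (0, c • w) = c * g (0, w) := by
      have : ((0 : QuadIndex n → ℝ), c • w) = c • (0, w) := by simp
      rw [this, map_smul, smul_eq_mul]
    have e' (v w : QuadIndex n → ℝ) : g (0, v + w) = g (0, v) + g (0, w) := by
      rw [← map_add]
      simp
    have e2 (x y : Fin (n + 1)) :
        g (0, ∑ z, (-stiffness n ω₀ x z) • Pi.single (.inr (.inl (z, y))) 1)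
        = ∑ z, (-stiffness n ω₀ x z) * g (0, Pi.single (.inr (.inl (z, y))) 1) := by
      have := map_sum (g.comp (LinearMap.inr ℝ (QuadIndex n → ℝ) (QuadIndex n → ℝ)))
        (fun z => (-stiffness n ω₀ x z) • Pi.single (.inr (.inl (z, y))) (1 : ℝ)) Finset.univ
      simp only [LinearMap.comp_apply, LinearMap.inr_apply, e] at this
      exact this
    rw [e', e', e2, e', e2, e, e]
    simp only [neg_mul, Finset.sum_neg_distrib]
    split_ifs <;> ring
  · intro z
    rw [quadForm_add, quadForm_add, quadForm_sum, quadForm_sum, quadForm_add, quadForm_single_eq]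
    simp only [quadForm_smul, quadForm_single, quadMonomial]
    rw [generator_snd_mul_snd, accel_eq, accel_eq]
    simp only [neg_mul, Finset.sum_neg_distrib, mul_neg, Finset.mul_sum,
      Finset.sum_mul, ite_self, add_zero]
    have e1 : ∑ i, stiffness n ω₀ x i * z.1 i * z.2 y
        = ∑ i, stiffness n ω₀ x i * (z.1 i * z.2 y) := Finset.sum_congr rfl fun i _ => by ring
    have e2 : ∑ i, z.2 x * (stiffness n ω₀ y i * z.1 i)
        = ∑ i, stiffness n ω₀ y i * (z.1 i * z.2 x) := Finset.sum_congr rfl fun i _ => by ring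
    rw [e1, e2]
    split_ifs <;> ring

lemma linearMap_eq_zero_of_single {h : (QuadIndex n → ℝ) →ₗ[ℝ] ℝ}
    (hh : ∀ i, h (Pi.single i 1) = 0) : h = 0 :=
  LinearMap.pi_ext' fun i => LinearMap.ext_ring (by simpa using hh i)

/-- There is no nonzero stationary state of the second moments at zero temperature. -/
lemma dual_eq_zero (hω₀ : 0 < ω₀) (hγ : 0 < γ)
    (hg : ∀ u ∈ dissipationPairs n ω₀ γ T, g u = 0)
    (hpos : ∀ v w, (∀ z, 0 ≤ quadForm v z) → (∀ z, 0 ≤ quadForm w z) → 0 ≤ g (v, w)) :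
    g = 0 := by
  set A := stiffness n ω₀ with hA
  set Q : Matrix (Fin (n + 1)) (Fin (n + 1)) ℝ :=
    Matrix.of fun x y => g (0, Pi.single (.inl (x, y)) 1) with hQ
  set S : Matrix (Fin (n + 1)) (Fin (n + 1)) ℝ :=
    Matrix.of fun x y => g (0, Pi.single (.inr (.inl (x, y))) 1) with hS
  set P : Matrix (Fin (n + 1)) (Fin (n + 1)) ℝ :=
    Matrix.of fun x y => g (0, Pi.single (.inr (.inr (x, y))) 1) with hP
  have hqq (x y) : g (Pi.single (.inl (x, y)) 1, 0) = S x y + S y x := dual_fst_fst hg x y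
  have hqp (x y) : g (Pi.single (.inr (.inl (x, y))) 1, 0)
      = P x y - ∑ z, A y z * Q x z - 2 * γ * S x y := dual_fst_snd hg x y
  have hpp (x y) : g (Pi.single (.inr (.inr (x, y))) 1, 0)
      = -(∑ z, A x z * S z y) - (∑ z, A y z * S z x)
        + 4 * γ * ((if x = y then (if x = 0 then 0 else P x x) else 0) - P x y) :=
    dual_snd_snd hg x y
  -- the energy
  set H : QuadIndex n → ℝ := (∑ x, ∑ y, (A x y / 2) • Pi.single (.inl (x, y)) 1)
    + ∑ x, (1 / 2 : ℝ) • Pi.single (.inr (.inr (x, x))) 1 with hH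
  set g1 : (QuadIndex n → ℝ) →ₗ[ℝ] ℝ := g.comp (LinearMap.inl ℝ _ _) with hg1
  set g2 : (QuadIndex n → ℝ) →ₗ[ℝ] ℝ := g.comp (LinearMap.inr ℝ _ _) with hg2
  have hg12 (v w) : g (v, w) = g1 v + g2 w := by
    simp [hg1, hg2, ← map_add]
  -- The Hamiltonian flow and the reversals conserve the energy; only the friction at the particle
  -- `0` remains.
  have hHval : g1 H = -(2 * γ) * P 0 0 := by
    have e1 : ∑ x, ∑ y, A x y / 2 * (S x y + S y x) = ∑ x, ∑ z, A x z * S z x := by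
      have : ∑ x, ∑ y, A x y * S x y = ∑ x, ∑ y, A x y * S y x := by
        rw [Finset.sum_comm]
        exact Finset.sum_congr rfl fun x _ => Finset.sum_congr rfl fun y _ => by
          rw [hA, stiffness_symm]
      have e : ∑ x, ∑ y, A x y / 2 * (S x y + S y x)
          = (1 / 2) * ∑ x, ∑ y, A x y * S x y + (1 / 2) * ∑ x, ∑ y, A x y * S y x := by
        simp only [Finset.mul_sum, ← Finset.sum_add_distrib]
        exact Finset.sum_congr rfl fun x _ => Finset.sum_congr rfl fun y _ => by ring
      rw [e, this]
      ring
    have e2 (x) : (1 / 2 : ℝ) * g (Pi.single (.inr (.inr (x, x))) 1, 0)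
        = -(∑ z, A x z * S z x) - if x = 0 then 2 * γ * P 0 0 else 0 := by
      rw [hpp]
      by_cases hx : x = 0
      · subst hx; simp; ring
      · simp [hx]; ring
    rw [hH, map_add, map_sum, map_sum]
    simp only [map_sum, map_smul, smul_eq_mul]
    have e3 (v : QuadIndex n → ℝ) : g1 v = g (v, 0) := by simp [hg1]
    simp only [e3, hqq, e2]
    rw [e1, Finset.sum_sub_distrib, Finset.sum_neg_distrib]
    simp
    ring
  have hHform (z : Phase n) : quadForm H z
      = (1 / 2) * (∑ x, z.1 x * ∑ y, A x y * z.1 y + ∑ x, z.2 x ^ 2) := by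
    rw [hH, quadForm_add, quadForm_sum, quadForm_sum]
    simp only [quadForm_sum, quadForm_smul, quadForm_single, quadMonomial, mul_add, Finset.mul_sum]
    congr 1
    · exact Finset.sum_congr rfl fun x _ => Finset.sum_congr rfl fun y _ => by ring
    · exact Finset.sum_congr rfl fun x _ => by ring
  set c := min (ω₀ ^ 2) 1 / 2 with hc
  have hc0 : 0 < c := by positivity
  have hHpos (z : Phase n) : c * sqNorm z ≤ quadForm H z := by
    rw [hHform]
    have h1 := sum_mul_stiffness_ge ω₀ z.1
    have h2 : 0 ≤ ∑ x, z.1 x ^ 2 := Finset.sum_nonneg fun _ _ => sq_nonneg _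
    have h3 : 0 ≤ ∑ x, z.2 x ^ 2 := Finset.sum_nonneg fun _ _ => sq_nonneg _
    have h4 := mul_le_mul_of_nonneg_right (min_le_left (ω₀ ^ 2) 1) h2
    have h5 := mul_le_mul_of_nonneg_right (min_le_right (ω₀ ^ 2) 1) h3
    unfold sqNorm
    rw [hc]
    linarith
  have hP00 : 0 ≤ P 0 0 := by
    refine hpos 0 _ (fun z => by simp [quadForm]) fun z => ?_
    rw [quadForm_single]
    exact mul_self_nonneg _
  have hg1H : 0 ≤ g1 H := by
    have := hpos H 0 (fun z => (mul_nonneg hc0.le (sqNorm_nonneg z)).trans (hHpos z))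
      (fun z => by simp [quadForm])
    simpa [hg12] using this
  -- `g1 H` is nonnegative by positivity of `g` and nonpositive by `hHval`, hence both sides vanish.
  have hP0 : P 0 0 = 0 := by
    have : 2 * γ * P 0 0 ≤ 0 := by linarith
    have := nonpos_of_mul_nonpos_right this (by positivity)
    linarith
  have hg1H0 : g1 H = 0 := by rw [hHval, hP0, mul_zero]
  have hg1z : g1 = 0 := by
    refine linearMap_eq_zero_of_single fun i => ?_
    -- Each monomial is bounded by `sqNorm`, hence by `c⁻¹ H`, so `c⁻¹ H ± monomial` is a
    -- nonnegative form. As `g1 H = 0`, this forces `g1` to vanish on the monomial.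
    have key (s : ℝ) (hs : |s| = 1) : 0 ≤ s * g1 (Pi.single i 1) := by
      have := hpos (c⁻¹ • H + s • Pi.single i 1) 0 (fun z => ?_) (fun z => by simp [quadForm])
      · simpa [hg12, hg1H0] using this
      · rw [quadForm_add, quadForm_smul, quadForm_smul, quadForm_single]
        have h1 : sqNorm z ≤ c⁻¹ * quadForm H z := by
          rw [← div_eq_inv_mul, le_div_iff₀ hc0]
          linarith [hHpos z]
        have h2 := abs_quadMonomial_le i z
        have h3 := neg_abs_le (s * quadMonomial z i)
        rw [abs_mul, hs, one_mul] at h3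
        linarith
    have h1 := key 1 (by simp)
    have h2 := key (-1) (by simp)
    linarith
  have hg1s (i) : g (Pi.single i 1, 0) = 0 := by simp [hg12, hg1z]
  have hSt : S.transpose = -S := by
    ext x y
    have := hqq x y
    rw [hg1s] at this
    rw [Matrix.transpose_apply, Matrix.neg_apply]
    linarith
  have hQt : Q.transpose = Q := by
    ext x y
    refine dual_swap hg fun z => ?_
    simp only [quadForm_single, quadMonomial]
    ring
  have hPt : P.transpose = P := by
    ext x y
    refine dual_swap hg fun z => ?_
    simp only [quadForm_single, quadMonomial]
    ring
  set d : Fin (n + 1) → ℝ := fun x => if x = 0 then 0 else P x x with hd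
  have h1 : P = Q * A + (2 * γ) • S := by
    ext x y
    have := hqp x y
    rw [hg1s] at this
    have e : (Q * A) x y = ∑ z, A y z * Q x z := by
      rw [Matrix.mul_apply]
      exact Finset.sum_congr rfl fun z _ => by rw [hA, stiffness_symm]; ring
    rw [Matrix.add_apply, Matrix.smul_apply, smul_eq_mul, e]
    linarith
  have h2 : A * S - S * A = (4 * γ) • (Matrix.diagonal d - P) := by
    ext x y
    have := hpp x y
    rw [hg1s] at this
    have e : (S * A) x y = -∑ z, A y z * S z x := by
      rw [Matrix.mul_apply, ← Finset.sum_neg_distrib]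
      refine Finset.sum_congr rfl fun z _ => ?_
      have e' := congrFun (congrFun hSt z) x
      rw [Matrix.transpose_apply, Matrix.neg_apply] at e'
      rw [e', hA, stiffness_symm]
      ring
    rw [Matrix.sub_apply, e, Matrix.mul_apply, Matrix.smul_apply, Matrix.sub_apply,
      Matrix.diagonal_apply, smul_eq_mul, hd]
    linarith
  -- With `g1 = 0` the moments are stationary. The dissipation vanishes termwise: `d_x = P_xx` for
  -- `x ≥ 1`, and `d_0 = 0`.
  have hS0 : S = 0 := by
    have := hsNormSq_current_le hγ hPt hQt hSt h1 h2
    have e : ∑ x, d x * (d x - P x x) = 0 := by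
      refine Finset.sum_eq_zero fun x _ => ?_
      simp only [hd]
      split_ifs <;> ring
    rw [e] at this
    exact eq_zero_of_hsNormSq_le_zero (nonpos_of_mul_nonpos_right this (by positivity))
  have hdP : Matrix.diagonal d = P := by
    rw [hS0] at h2
    simp only [mul_zero, zero_mul, sub_zero] at h2
    have := (smul_eq_zero.1 h2.symm).resolve_left (by positivity)
    exact sub_eq_zero.1 this
  -- Without currents the profile is constant, and it starts from `d_0 = 0`.
  have hd0 : ∀ x, d x = 0 := by
    have h3 := sum_sq_gradient_le hγ hPt hQt hSt h1 h2
    have h4 : hsNormSq S = 0 := by simp [hS0, hsNormSq]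
    rw [h4, mul_zero] at h3
    have h5 (x : Fin n) : d x.castSucc = d x.succ := by
      have := (Finset.sum_eq_zero_iff_of_nonneg (fun x _ => sq_nonneg (d x.castSucc - d x.succ))).1
        (le_antisymm h3 (Finset.sum_nonneg fun x _ => sq_nonneg _)) x (Finset.mem_univ _)
      exact sub_eq_zero.1 (pow_eq_zero_iff two_ne_zero |>.1 this)
    intro x
    refine Fin.induction ?_ (fun i hi => ?_) x
    · simp [hd]
    · rw [← h5, hi]
  have hPz : P = 0 := by
    rw [← hdP]
    ext x y
    simp [Matrix.diagonal_apply, hd0]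
  have hQz : Q = 0 := by
    have h3 : Q * A = 0 := by
      rw [hPz, hS0] at h1
      simpa using h1.symm
    have h4 := hsNormSq_le_trace ω₀ Q
    rw [← Matrix.mul_assoc, ← hA, hQt] at h4
    have h5 : A * Q = 0 := by
      have := congrArg Matrix.transpose h3
      rwa [Matrix.transpose_mul, hQt, hA, stiffness_transpose, Matrix.transpose_zero] at this
    rw [h5, zero_mul, Matrix.trace_zero] at h4
    exact eq_zero_of_hsNormSq_le_zero (nonpos_of_mul_nonpos_right h4 (by positivity))
  have hg2z : g2 = 0 := by
    refine linearMap_eq_zero_of_single fun i => ?_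
    rcases i with i | i | i
    · exact congrFun (congrFun hQz i.1) i.2
    · exact congrFun (congrFun hS0 i.1) i.2
    · exact congrFun (congrFun hPz i.1) i.2
  ext u
  all_goals simp [hg12, hg1z, hg2z]

end duality

/-- A functional that separates a subspace from an open convex cone. -/
lemma exists_dual_of_disjoint {E : Type*} [AddCommGroup E] [Module ℝ E] [TopologicalSpace E]
    [IsTopologicalAddGroup E] [ContinuousSMul ℝ E] {s : Set E} (hs : Convex ℝ s) (ho : IsOpen s)
    (p : Submodule ℝ E) (hd : Disjoint s p) :
    ∃ g : E →ₗ[ℝ] ℝ, (∀ x ∈ s, 0 < g x) ∧ ∀ x ∈ p, g x = 0 := by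
  obtain ⟨f, u, hf1, hf2⟩ := geometric_hahn_banach_open hs ho p.convex hd
  have hu : u ≤ 0 := by simpa using hf2 0 (Submodule.zero_mem _)
  refine ⟨-(f : E →ₗ[ℝ] ℝ), fun x hx => ?_, fun x hx => ?_⟩
  · have := hf1 x hx
    simp only [LinearMap.neg_apply, ContinuousLinearMap.coe_coe]
    linarith
  -- A linear functional bounded below on a subspace is zero there: otherwise `x` could be scaled to
  -- the value `u - 1`, below the bound `u`.
  · by_contra h
    simp only [LinearMap.neg_apply, ContinuousLinearMap.coe_coe, neg_eq_zero] at h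
    have := hf2 (((u - 1) / f x) • x) (Submodule.smul_mem _ _ hx)
    rw [map_smul, smul_eq_mul, div_mul_cancel₀ _ h] at this
    linarith

/-- Without force, there is a quadratic Lyapunov function. -/
lemma exists_quadForm_lyapunov {ω₀ γ : ℝ} (T : ℝ) (hω₀ : 0 < ω₀) (hγ : 0 < γ) :
    ∃ v w : QuadIndex n → ℝ, v ∈ posForms n ∧ w ∈ posForms n ∧
      ∃ k : ℝ, ∀ z, generator ω₀ γ T 0 (quadForm v) z + quadForm w z = k := by
  by_contra hcon
  have hid : sqNormCoeff n ∈ posForms n := ⟨1, one_pos, fun z => by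
    rw [quadForm_sqNormCoeff, one_mul]⟩
  have hdisj : Disjoint (posForms n ×ˢ posForms n)
      (dissipationPairs n ω₀ γ T : Set ((QuadIndex n → ℝ) × (QuadIndex n → ℝ))) := by
    rw [Set.disjoint_left]
    rintro ⟨v, w⟩ ⟨hv, hw⟩ hk
    exact hcon ⟨v, w, hv, hw, hk⟩
  have hconv : Convex ℝ (posForms n ×ˢ posForms n) := convex_posForms.prod convex_posForms
  have hopen : IsOpen (posForms n ×ˢ posForms n) := isOpen_posForms.prod isOpen_posForms
  obtain ⟨g, hg1, hg2⟩ := exists_dual_of_disjoint hconv hopen (dissipationPairs n ω₀ γ T) hdisj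
  have hs := hg1 (sqNormCoeff n, sqNormCoeff n) ⟨hid, hid⟩
  have hg : g = 0 := by
    -- Separation gives positivity only on positive definite forms. Semidefinite ones are reached by
    -- adding a small multiple of `sqNorm`, scaled so that the cost is exactly `ε`.
    refine dual_eq_zero hω₀ hγ hg2 fun v w hv hw => le_of_forall_pos_le_add fun ε hε => ?_
    set s := g (sqNormCoeff n, sqNormCoeff n)
    have hε' : 0 < ε / s := div_pos hε hs
    have hmem (v' : QuadIndex n → ℝ) (hv' : ∀ z, 0 ≤ quadForm v' z) :
        v' + (ε / s) • sqNormCoeff n ∈ posForms n :=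
      ⟨_, hε', fun z => by
        rw [quadForm_add, quadForm_smul, quadForm_sqNormCoeff]
        linarith [hv' z]⟩
    have h1 := hg1 (v + (ε / s) • sqNormCoeff n, w + (ε / s) • sqNormCoeff n)
      ⟨hmem v hv, hmem w hw⟩
    have e : (v + (ε / s) • sqNormCoeff n, w + (ε / s) • sqNormCoeff n)
        = (v, w) + (ε / s) • (sqNormCoeff n, sqNormCoeff n) := by
      rw [Prod.smul_mk, Prod.mk_add_mk]
    rw [e, map_add, map_smul, smul_eq_mul, div_mul_cancel₀ _ hs.ne'] at h1
    exact h1.le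
  rw [hg, LinearMap.zero_apply] at hs
  exact lt_irrefl _ hs

lemma abs_partialP_quadMonomial_le (y : Fin (n + 1)) (i : QuadIndex n) (z : Phase n) :
    |partialP y (fun z => quadMonomial z i) z| ≤ 2 * √(sqNorm z) := by
  have h0 := Real.sqrt_nonneg (sqNorm z)
  have aux (a b s : ℝ) (x x' : Fin (n + 1)) (ha : |a| ≤ s) (hb : |b| ≤ s) (hs : 0 ≤ s) :
      |a * (if x = y then 1 else 0) + b * (if x' = y then 1 else 0)| ≤ 2 * s := by
    rw [abs_le] at *
    split_ifs <;> constructor <;> linarith [ha.1, ha.2, hb.1, hb.2]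
  rcases i with i | i | i <;> simp only [quadMonomial]
  · rw [partialP_mul (contDiff_fst_apply _) (contDiff_fst_apply _)]
    simp [partialP_fst_apply]
  · rw [partialP_mul (contDiff_fst_apply _) (contDiff_snd_apply _)]
    simp only [partialP_fst_apply, partialP_snd_apply]
    simpa using aux _ 0 _ i.2 i.2 (abs_fst_le_sqrt z i.1) (by simp) h0
  · rw [partialP_mul (contDiff_snd_apply _) (contDiff_snd_apply _)]
    simp only [partialP_snd_apply]
    exact aux _ _ _ i.2 i.1 (abs_snd_le_sqrt z i.1) (abs_snd_le_sqrt z i.2) h0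

lemma partialP_sum {ι : Type*} (s : Finset ι) {F : ι → Phase n → ℝ}
    (hF : ∀ i, ContDiff ℝ ∞ (F i)) (x : Fin (n + 1)) (z : Phase n) :
    partialP x (fun z => ∑ i ∈ s, F i z) z = ∑ i ∈ s, partialP x (F i) z := by
  unfold partialP
  rw [fderiv_fun_sum fun i _ => (hF i).differentiable (by simp) z]
  simp

lemma exists_abs_partialP_quadForm_le (y : Fin (n + 1)) (v : QuadIndex n → ℝ) :
    ∃ B : ℝ, 0 ≤ B ∧ ∀ z, |partialP y (quadForm v) z| ≤ B * √(sqNorm z) := by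
  refine ⟨∑ i, |v i| * 2, Finset.sum_nonneg fun _ _ => by positivity, fun z => ?_⟩
  unfold quadForm
  rw [partialP_sum _ fun i => contDiff_const.mul (contDiff_quadMonomial i), Finset.sum_mul]
  refine (Finset.abs_sum_le_sum_abs _ _).trans (Finset.sum_le_sum fun i _ => ?_)
  rw [partialP_const_mul (contDiff_quadMonomial i), abs_mul, mul_assoc]
  exact mul_le_mul_of_nonneg_left (abs_partialP_quadMonomial_le y i z) (abs_nonneg _)

/-- A quadratic Lyapunov function, for bounded forces. -/
theorem exists_lyapunov {ω₀ γ : ℝ} (T M : ℝ) (hω₀ : 0 < ω₀) (hγ : 0 < γ) :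
    ∃ V : Phase n → ℝ, ContDiff ℝ ∞ V ∧ ∃ c K : ℝ, 0 < c ∧ 0 ≤ K ∧ ∀ z,
      c * sqNorm z ≤ V z ∧ V z ≤ K * sqNorm z ∧
      ∀ f : ℝ, |f| ≤ M → generator ω₀ γ T f V z ≤ K - c * sqNorm z := by
  obtain ⟨v, w, ⟨c, hc, hv⟩, ⟨d, hd, hw⟩, k, hk⟩ := exists_quadForm_lyapunov (n := n) T hω₀ hγ
  obtain ⟨B, hB, hB'⟩ := exists_abs_partialP_quadForm_le (Fin.last n) v
  set N : ℝ := Fintype.card (QuadIndex n) * ‖v‖ with hN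
  -- The force contributes at most `M B √sqNorm ≤ (M B)²/(2d) + (d/2) sqNorm`, so half of the
  -- dissipation `d` survives.
  refine ⟨quadForm v, contDiff_quadForm v, min c (d / 2),
    max N (max 0 (k + (M * B) ^ 2 / (2 * d))), by positivity, by positivity, fun z => ⟨?_, ?_, ?_⟩⟩
  · exact (mul_le_mul_of_nonneg_right (min_le_left _ _) (sqNorm_nonneg z)).trans (hv z)
  · exact (le_abs_self _).trans ((abs_quadForm_le v z).trans
      (mul_le_mul_of_nonneg_right (le_max_left _ _) (sqNorm_nonneg z)))
  · intro f hf
    rw [generator_eq_zero_add]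
    have h1 := mul_le_mul_of_nonneg_right (min_le_right c (d / 2)) (sqNorm_nonneg z)
    have h2 : k + (M * B) ^ 2 / (2 * d) ≤ max N (max 0 (k + (M * B) ^ 2 / (2 * d))) :=
      (le_max_right _ _).trans (le_max_right _ _)
    have h3 : f * partialP (Fin.last n) (quadForm v) z ≤ M * B * √(sqNorm z) := by
      refine (le_abs_self _).trans ?_
      rw [abs_mul, mul_assoc]
      exact mul_le_mul hf (hB' z) (abs_nonneg _) ((abs_nonneg _).trans hf)
    have h4 : M * B * √(sqNorm z) ≤ (M * B) ^ 2 / (2 * d) + d / 2 * sqNorm z := by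
      have hs := Real.sq_sqrt (sqNorm_nonneg z)
      have : (M * B) ^ 2 / (2 * d) + d / 2 * sqNorm z - M * B * √(sqNorm z)
          = (M * B - d * √(sqNorm z)) ^ 2 / (2 * d) := by
        field_simp
        rw [sub_sq, mul_pow d, hs]
        ring
      have h5 : 0 ≤ (M * B - d * √(sqNorm z)) ^ 2 / (2 * d) := by positivity
      linarith
    have h5 := hw z
    have h6 := hk z
    linarith

/-! ### Smooth truncations -/

/-- A smooth decreasing cutoff, equal to `1` below `R` and to `0` above `2R`. -/
noncomputable def cutoff (R v : ℝ) : ℝ := Real.smoothTransition (2 - v / R)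

/-- A smooth concave truncation of the identity, constant above `2R`. -/
noncomputable def truncation (R v : ℝ) : ℝ := ∫ u in (0 : ℝ)..v, cutoff R u

lemma contDiff_cutoff (R : ℝ) : ContDiff ℝ ∞ (cutoff R) := by
  unfold cutoff
  exact Real.smoothTransition.contDiff.comp (contDiff_const.sub (contDiff_id.div_const R))

lemma cutoff_nonneg (R v : ℝ) : 0 ≤ cutoff R v := Real.smoothTransition.nonneg _

lemma cutoff_le_one (R v : ℝ) : cutoff R v ≤ 1 := Real.smoothTransition.le_one _

lemma cutoff_eq_one {R v : ℝ} (hR : 0 < R) (h : v ≤ R) : cutoff R v = 1 := by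
  refine Real.smoothTransition.one_of_one_le ?_
  have : v / R ≤ 1 := (div_le_one hR).2 h
  linarith

lemma cutoff_eq_zero {R v : ℝ} (hR : 0 < R) (h : 2 * R ≤ v) : cutoff R v = 0 := by
  refine Real.smoothTransition.zero_of_nonpos ?_
  have : 2 ≤ v / R := (le_div_iff₀ hR).2 h
  linarith

lemma cutoff_antitone {R : ℝ} (hR : 0 < R) : Antitone (cutoff R) := fun u v h =>
  Real.smoothTransition.monotone (by
    have := div_le_div_of_nonneg_right h hR.le
    linarith)

lemma cutoff_mono_left {R R' v : ℝ} (hR : 0 < R) (h : R ≤ R') (hv : 0 ≤ v) :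
    cutoff R v ≤ cutoff R' v :=
  Real.smoothTransition.monotone (by
    have := div_le_div_of_nonneg_left hv hR h
    linarith)

lemma tendsto_cutoff (v : ℝ) : Tendsto (fun k : ℕ => cutoff (k + 1) v) atTop (𝓝 1) := by
  obtain ⟨N, hN⟩ := exists_nat_ge v
  refine tendsto_const_nhds.congr' ?_
  filter_upwards [eventually_ge_atTop N] with k hk
  have : (N : ℝ) ≤ k := Nat.cast_le.2 hk
  exact (cutoff_eq_one (by positivity) (by linarith)).symm

lemma hasDerivAt_truncation (R v : ℝ) : HasDerivAt (truncation R) (cutoff R v) v :=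
  (contDiff_cutoff R).continuous.integral_hasStrictDerivAt 0 v |>.hasDerivAt

lemma deriv_truncation (R : ℝ) : deriv (truncation R) = cutoff R :=
  funext fun v => (hasDerivAt_truncation R v).deriv

lemma contDiff_truncation (R : ℝ) : ContDiff ℝ ∞ (truncation R) := by
  rw [contDiff_infty_iff_deriv, deriv_truncation]
  exact ⟨fun v => (hasDerivAt_truncation R v).differentiableAt, contDiff_cutoff R⟩

lemma deriv_deriv_truncation_nonpos {R : ℝ} (hR : 0 < R) (v : ℝ) :
    deriv (deriv (truncation R)) v ≤ 0 := by
  rw [deriv_truncation]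
  exact (cutoff_antitone hR).deriv_nonpos

lemma intervalIntegrable_cutoff (R u v : ℝ) : IntervalIntegrable (cutoff R) volume u v :=
  (contDiff_cutoff R).continuous.intervalIntegrable u v

lemma truncation_sub (R u v : ℝ) :
    truncation R u - truncation R v = ∫ s in v..u, cutoff R s := by
  unfold truncation
  rw [intervalIntegral.integral_interval_sub_left] <;> exact intervalIntegrable_cutoff _ _ _

lemma truncation_concave {R : ℝ} (hR : 0 < R) (u v : ℝ) :
    truncation R u ≤ truncation R v + deriv (truncation R) v * (u - v) := by
  have h : truncation R u - truncation R v ≤ cutoff R v * (u - v) := by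
    rw [truncation_sub]
    rcases le_total v u with huv | huv
    · have := intervalIntegral.integral_mono_on huv (intervalIntegrable_cutoff R v u)
        intervalIntegrable_const fun s hs => cutoff_antitone hR hs.1
      rw [intervalIntegral.integral_const, smul_eq_mul] at this
      linarith
    · have := intervalIntegral.integral_mono_on huv intervalIntegrable_const
        (intervalIntegrable_cutoff R u v) fun s hs => cutoff_antitone hR hs.2
      rw [intervalIntegral.integral_const, smul_eq_mul] at this
      rw [intervalIntegral.integral_symm]
      linarith
  rw [deriv_truncation]
  linarith

lemma truncation_zero (R : ℝ) : truncation R 0 = 0 := by simp [truncation]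

lemma truncation_nonneg {R v : ℝ} (hv : 0 ≤ v) : 0 ≤ truncation R v :=
  intervalIntegral.integral_nonneg hv fun s _ => cutoff_nonneg R s

lemma truncation_le {R : ℝ} (hR : 0 < R) (v : ℝ) : truncation R v ≤ v := by
  have := truncation_concave hR v 0
  rw [truncation_zero, deriv_truncation, cutoff_eq_one hR hR.le] at this
  linarith

/-- Concavity, compared at the point `0`. It recovers a truncated second moment from the truncated
Lyapunov function. -/
lemma cutoff_mul_le_truncation {R : ℝ} (hR : 0 < R) (v : ℝ) : cutoff R v * v ≤ truncation R v := by
  have := truncation_concave hR 0 v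
  rw [truncation_zero, deriv_truncation] at this
  linarith

lemma truncation_eq {R v : ℝ} (hR : 0 < R) (hv : 2 * R ≤ v) :
    truncation R v = truncation R (2 * R) := by
  rw [← sub_eq_zero, truncation_sub]
  rw [intervalIntegral.integral_congr (g := fun _ => 0)]
  · simp
  · intro s hs
    rw [Set.uIcc_of_le hv] at hs
    exact cutoff_eq_zero hR hs.1

/-! ### Moments of the periodic stationary states -/

lemma hasCompactSupport_of_le_sqNorm {F : Phase n → ℝ} (R : ℝ)
    (h : ∀ z, R ≤ sqNorm z → F z = 0) : HasCompactSupport F := by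
  refine HasCompactSupport.intro (isCompact_closedBall (0 : Phase n) √R) fun z hz => h z ?_
  have h1 : √R < ‖z‖ := by simpa using hz
  by_contra h2
  push Not at h2
  exact absurd (h1.trans_le (norm_le_sqrt_sqNorm z)) (not_lt.2 (Real.sqrt_le_sqrt h2.le))

lemma integrable_of_compactSupport {ν : Measure (Phase n)} [IsProbabilityMeasure ν]
    {F : Phase n → ℝ} (hF : ContDiff ℝ ∞ F) (hc : HasCompactSupport F) : Integrable F ν :=
  hF.continuous.integrable_of_hasCompactSupport hc

namespace IsPeriodicStationaryState

variable {ω₀ γ T τ : ℝ} {f : ℝ → ℝ} {μ : ℝ → Measure (Phase n)}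

lemma continuousOn_integral (h : IsPeriodicStationaryState ω₀ γ T f τ μ) {F : Phase n → ℝ}
    (hF : ContDiff ℝ ∞ F) (hc : HasCompactSupport F) :
    ContinuousOn (fun t => ∫ z, F z ∂(μ t)) (Set.Ici 0) :=
  fun t ht => (h.forward F hF hc t ht).continuousWithinAt

lemma continuousOn_integral_generator (h : IsPeriodicStationaryState ω₀ γ T f τ μ)
    (hf : Continuous f) {F : Phase n → ℝ} (hF : ContDiff ℝ ∞ F) (hc : HasCompactSupport F) :
    ContinuousOn (fun t => ∫ z, generator ω₀ γ T (f t) F z ∂(μ t)) (Set.Ici 0) := by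
  have h1 := h.continuousOn_integral (contDiff_generator ω₀ γ T 0 hF)
    (hasCompactSupport_generator ω₀ γ T 0 hc)
  have h2 := h.continuousOn_integral (contDiff_partialP hF (Fin.last n))
    (hasCompactSupport_partialP hc (Fin.last n))
  refine (h1.add (hf.continuousOn.mul h2)).congr fun t ht => ?_
  have := h.isProbabilityMeasure t ht
  simp only [generator_eq_zero_add ω₀ γ T (f t) F]
  rw [integral_add (integrable_of_compactSupport (contDiff_generator ω₀ γ T 0 hF)
    (hasCompactSupport_generator ω₀ γ T 0 hc))
    ((integrable_of_compactSupport (contDiff_partialP hF (Fin.last n))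
    (hasCompactSupport_partialP hc (Fin.last n))).const_mul _), integral_const_mul]
  rfl

lemma integral_sub_integral (h : IsPeriodicStationaryState ω₀ γ T f τ μ)
    (hf : Continuous f) {F : Phase n → ℝ} (hF : ContDiff ℝ ∞ F) (hc : HasCompactSupport F)
    {s t : ℝ} (hs : 0 ≤ s) (hst : s ≤ t) :
    ∫ z, F z ∂(μ t) - ∫ z, F z ∂(μ s)
      = ∫ r in s..t, ∫ z, generator ω₀ γ T (f r) F z ∂(μ r) := by
  have hsub : Set.Icc s t ⊆ Set.Ici 0 := fun r hr => hs.trans hr.1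
  refine (intervalIntegral.integral_eq_sub_of_hasDerivAt_of_le hst
    ((h.continuousOn_integral hF hc).mono hsub) (fun r hr => ?_) ?_).symm
  · exact (h.forward F hF hc r (hs.trans hr.1.le)).hasDerivAt
      (Ici_mem_nhds (lt_of_le_of_lt hs hr.1))
  · refine ContinuousOn.intervalIntegrable ?_
    rw [Set.uIcc_of_le hst]
    exact (h.continuousOn_integral_generator hf hF hc).mono hsub

lemma periodic_nat (h : IsPeriodicStationaryState ω₀ γ T f τ μ) (hτ : 0 ≤ τ) {t : ℝ}
    (ht : 0 ≤ t) (k : ℕ) : μ (t + k * τ) = μ t := by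
  induction k with
  | zero => simp
  | succ k ih =>
    rw [← ih, ← h.periodic (t + k * τ) (by positivity)]
    congr 1
    push_cast
    ring

end IsPeriodicStationaryState

/-- Monotone convergence for the truncated second moments. -/
lemma lintegral_sqNorm_eq_iSup {V : Phase n → ℝ} (hV : ContDiff ℝ ∞ V) (hV0 : ∀ z, 0 ≤ V z)
    (ν : Measure (Phase n)) :
    ∫⁻ z, ENNReal.ofReal (sqNorm z) ∂ν
      = ⨆ k : ℕ, ∫⁻ z, ENNReal.ofReal (cutoff (k + 1) (V z) * sqNorm z) ∂ν := by
  rw [← lintegral_iSup]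
  · refine lintegral_congr fun z => (iSup_eq_of_tendsto ?_ ?_).symm
    · intro k l hkl
      have : (k : ℝ) ≤ l := Nat.cast_le.2 hkl
      exact ENNReal.ofReal_le_ofReal (mul_le_mul_of_nonneg_right
        (cutoff_mono_left (by positivity) (by linarith) (hV0 z)) (sqNorm_nonneg z))
    · refine (ENNReal.continuous_ofReal.tendsto _).comp ?_
      simpa using (tendsto_cutoff (V z)).mul_const (sqNorm z)
  · intro k
    exact (((contDiff_cutoff _).comp hV).mul contDiff_sqNorm).continuous.measurable.ennreal_ofReal
  · intro k l hkl z
    have : (k : ℝ) ≤ l := Nat.cast_le.2 hkl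
    exact ENNReal.ofReal_le_ofReal (mul_le_mul_of_nonneg_right
      (cutoff_mono_left (by positivity) (by linarith) (hV0 z)) (sqNorm_nonneg z))

section moments

variable {V : Phase n → ℝ} {c : ℝ}

lemma contDiff_cutoff_mul_sqNorm (hV : ContDiff ℝ ∞ V) (R : ℝ) :
    ContDiff ℝ ∞ fun z => cutoff R (V z) * sqNorm z :=
  ((contDiff_cutoff R).comp hV).mul contDiff_sqNorm

lemma hasCompactSupport_cutoff_mul_sqNorm (hc : 0 < c) (hVc : ∀ z, c * sqNorm z ≤ V z) {R : ℝ}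
    (hR : 0 < R) : HasCompactSupport fun z => cutoff R (V z) * sqNorm z := by
  refine hasCompactSupport_of_le_sqNorm (2 * R / c) fun z hz => ?_
  rw [cutoff_eq_zero hR, zero_mul]
  rw [div_le_iff₀ hc] at hz
  linarith [hVc z]

lemma ofReal_integral_cutoff (hV : ContDiff ℝ ∞ V) (hc : 0 < c)
    (hVc : ∀ z, c * sqNorm z ≤ V z) (ν : Measure (Phase n)) [IsProbabilityMeasure ν] (k : ℕ) :
    ∫⁻ z, ENNReal.ofReal (cutoff (k + 1) (V z) * sqNorm z) ∂ν
      = ENNReal.ofReal (∫ z, cutoff (k + 1) (V z) * sqNorm z ∂ν) := by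
  rw [ofReal_integral_eq_lintegral_ofReal]
  · exact integrable_of_compactSupport (contDiff_cutoff_mul_sqNorm hV _)
      (hasCompactSupport_cutoff_mul_sqNorm hc hVc (by positivity))
  · exact Eventually.of_forall fun z => mul_nonneg (cutoff_nonneg _ _) (sqNorm_nonneg z)

lemma integrable_sqNorm_of_lintegral_lt_top {ν : Measure (Phase n)}
    (h : ∫⁻ z, ENNReal.ofReal (sqNorm z) ∂ν < ⊤) : Integrable (sqNorm : Phase n → ℝ) ν := by
  refine ⟨contDiff_sqNorm.continuous.aestronglyMeasurable, ?_⟩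
  rw [hasFiniteIntegral_iff_ofReal (Eventually.of_forall sqNorm_nonneg)]
  exact h

lemma integrable_sqNorm_of_cutoff_le (hV : ContDiff ℝ ∞ V) (hc : 0 < c)
    (hVc : ∀ z, c * sqNorm z ≤ V z) {ν : Measure (Phase n)} [IsProbabilityMeasure ν] {B : ℝ}
    (hB : ∀ k : ℕ, ∫ z, cutoff (k + 1) (V z) * sqNorm z ∂ν ≤ B) :
    Integrable (sqNorm : Phase n → ℝ) ν ∧ ∫ z, sqNorm z ∂ν ≤ B := by
  have hV0 (z) : 0 ≤ V z := (mul_nonneg hc.le (sqNorm_nonneg z)).trans (hVc z)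
  have h1 : ∫⁻ z, ENNReal.ofReal (sqNorm z) ∂ν ≤ ENNReal.ofReal B := by
    rw [lintegral_sqNorm_eq_iSup hV hV0]
    refine iSup_le fun k => ?_
    rw [ofReal_integral_cutoff hV hc hVc]
    exact ENNReal.ofReal_le_ofReal (hB k)
  have h2 := integrable_sqNorm_of_lintegral_lt_top (h1.trans_lt ENNReal.ofReal_lt_top)
  refine ⟨h2, ?_⟩
  rw [← ofReal_integral_eq_lintegral_ofReal h2 (Eventually.of_forall sqNorm_nonneg)] at h1
  refine (ENNReal.ofReal_le_ofReal_iff ?_).1 h1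
  -- `ENNReal.ofReal` forgets the sign of `B`; its nonnegativity follows from the bound at `k = 0`.
  refine le_trans ?_ (hB 0)
  exact integral_nonneg fun z => mul_nonneg (cutoff_nonneg _ _) (sqNorm_nonneg z)

end moments

namespace IsPeriodicStationaryState

variable {ω₀ γ T τ : ℝ} {f : ℝ → ℝ} {μ : ℝ → Measure (Phase n)} {V : Phase n → ℝ} {c K : ℝ}

/-- The dissipation of the truncated Lyapunov function. -/
lemma integral_truncation_sub_le (h : IsPeriodicStationaryState ω₀ γ T f τ μ)
    (hf : Continuous f) (hγ : 0 ≤ γ) (hT : 0 ≤ T) (hV : ContDiff ℝ ∞ V) (hc : 0 < c) (hK : 0 ≤ K)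
    (hVc : ∀ z, c * sqNorm z ≤ V z)
    (hVg : ∀ t z, generator ω₀ γ T (f t) V z ≤ K - c * sqNorm z) {R : ℝ} (hR : 0 < R) {s t : ℝ}
    (hs : 0 ≤ s) (hst : s ≤ t) :
    ∫ z, (truncation R (V z) - truncation R (2 * R)) ∂(μ t)
        - ∫ z, (truncation R (V z) - truncation R (2 * R)) ∂(μ s)
      ≤ K * (t - s) - c * ∫ r in s..t, ∫ z, cutoff R (V z) * sqNorm z ∂(μ r) := by
  -- Subtracting the constant value taken where `V` is large makes the truncated function compactly
  -- supported, hence an admissible test function.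
  set F : Phase n → ℝ := fun z => truncation R (V z) - truncation R (2 * R) with hF
  have hFs : ContDiff ℝ ∞ F := ((contDiff_truncation R).comp hV).sub contDiff_const
  have hFc : HasCompactSupport F := by
    refine hasCompactSupport_of_le_sqNorm (2 * R / c) fun z hz => ?_
    rw [div_le_iff₀ hc] at hz
    rw [hF]
    simp only
    rw [truncation_eq hR (by linarith [hVc z]), sub_self]
  have hGs := contDiff_cutoff_mul_sqNorm hV R
  have hGc := hasCompactSupport_cutoff_mul_sqNorm hc hVc hR
  have hsub : Set.uIcc s t ⊆ Set.Ici 0 := by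
    rw [Set.uIcc_of_le hst]
    exact fun r hr => hs.trans hr.1
  have i1 : IntervalIntegrable (fun r => ∫ z, generator ω₀ γ T (f r) F z ∂(μ r)) volume s t :=
    ((h.continuousOn_integral_generator hf hFs hFc).mono hsub).intervalIntegrable
  have i2 : IntervalIntegrable (fun r => ∫ z, cutoff R (V z) * sqNorm z ∂(μ r)) volume s t :=
    ((h.continuousOn_integral hGs hGc).mono hsub).intervalIntegrable
  rw [h.integral_sub_integral hf hFs hFc hs hst]
  have hle : ∫ r in s..t, ∫ z, generator ω₀ γ T (f r) F z ∂(μ r)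
      ≤ ∫ r in s..t, (K - c * ∫ z, cutoff R (V z) * sqNorm z ∂(μ r)) := by
    refine intervalIntegral.integral_mono_on hst i1
      (intervalIntegrable_const.sub (i2.const_mul c)) fun r hr => ?_
    have := h.isProbabilityMeasure r (hs.trans hr.1)
    have e : K - c * ∫ z, cutoff R (V z) * sqNorm z ∂(μ r)
        = ∫ z, (K - c * (cutoff R (V z) * sqNorm z)) ∂(μ r) := by
      rw [integral_sub (integrable_const _) ((integrable_of_compactSupport hGs hGc).const_mul c),
        integral_const_mul]
      simp
    rw [e]
    refine integral_mono (integrable_of_compactSupport (contDiff_generator _ _ _ _ hFs)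
      (hasCompactSupport_generator _ _ _ _ hFc)) ((integrable_const _).sub
        ((integrable_of_compactSupport hGs hGc).const_mul c)) fun z => ?_
    have g1 : generator ω₀ γ T (f r) F z
        = generator ω₀ γ T (f r) (fun z => truncation R (V z)) z := by
      have := generator_add ω₀ γ T (f r) hFs (contDiff_const (c := truncation R (2 * R))) z
      rw [generator_const, add_zero] at this
      rw [← this]
      simp [hF]
    -- By concavity the drift is at most `cutoff · (K - c sqNorm)`, and `cutoff ≤ 1` turns this into
    -- `K - c · cutoff · sqNorm`.
    have g2 := generator_comp_le (ω₀ := ω₀) (f r) hγ hT hV (contDiff_truncation R)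
      (truncation_concave hR) (deriv_deriv_truncation_nonpos hR) z
    rw [deriv_truncation] at g2
    have g3 := mul_le_mul_of_nonneg_left (hVg r z) (cutoff_nonneg R (V z))
    have g4 := mul_le_mul_of_nonneg_right (cutoff_le_one R (V z)) hK
    rw [g1]
    simp only
    linarith
  refine hle.trans (le_of_eq ?_)
  rw [intervalIntegral.integral_sub intervalIntegrable_const (i2.const_mul c),
    intervalIntegral.integral_const, intervalIntegral.integral_const_mul, smul_eq_mul]
  ring

/-- A periodic stationary state has finite second moments at some time. -/
lemma exists_integrable_sqNorm (h : IsPeriodicStationaryState ω₀ γ T f τ μ) (hτ : 0 < τ)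
    (hf : Continuous f) (hγ : 0 ≤ γ) (hT : 0 ≤ T) (hV : ContDiff ℝ ∞ V) (hc : 0 < c) (hK : 0 ≤ K)
    (hVc : ∀ z, c * sqNorm z ≤ V z)
    (hVg : ∀ t z, generator ω₀ γ T (f t) V z ≤ K - c * sqNorm z) :
    ∃ t₀, 0 ≤ t₀ ∧ t₀ ≤ τ ∧ Integrable (sqNorm : Phase n → ℝ) (μ t₀) := by
  have hV0 (z) : 0 ≤ V z := (mul_nonneg hc.le (sqNorm_nonneg z)).trans (hVc z)
  set G : ℕ → ℝ → ℝ := fun k t => ∫ z, cutoff (k + 1) (V z) * sqNorm z ∂(μ t) with hG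
  have hGcont (k) : ContinuousOn (G k) (Set.Ici 0) := h.continuousOn_integral
    (contDiff_cutoff_mul_sqNorm hV _) (hasCompactSupport_cutoff_mul_sqNorm hc hVc (by positivity))
  have hG0 (k t) : 0 ≤ G k t :=
    integral_nonneg fun z => mul_nonneg (cutoff_nonneg _ _) (sqNorm_nonneg z)
  have hGint (k) : IntegrableOn (G k) (Set.Ioc 0 τ) := by
    rw [← intervalIntegrable_iff_integrableOn_Ioc_of_le hτ.le]
    refine ((hGcont k).mono ?_).intervalIntegrable
    rw [Set.uIcc_of_le hτ.le]
    exact fun r hr => hr.1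
  -- Over a whole period the boundary terms cancel, which bounds the truncated second moments
  -- uniformly in the level.
  have hbound (k) : ∫ t in Set.Ioc 0 τ, G k t ≤ K * τ / c := by
    have h1 := h.integral_truncation_sub_le hf hγ hT hV hc hK hVc hVg
      (R := k + 1) (by positivity) le_rfl hτ.le
    have h2 : μ τ = μ 0 := by simpa using h.periodic 0 le_rfl
    rw [h2, sub_self, sub_zero, intervalIntegral.integral_of_le hτ.le] at h1
    rw [le_div_iff₀ hc]
    linarith
  have hlint : ∫⁻ t in Set.Ioc 0 τ, ⨆ k, ENNReal.ofReal (G k t) ≤ ENNReal.ofReal (K * τ / c) := by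
    rw [lintegral_iSup']
    · refine iSup_le fun k => ?_
      rw [← ofReal_integral_eq_lintegral_ofReal (hGint k) (Eventually.of_forall (hG0 k))]
      exact ENNReal.ofReal_le_ofReal (hbound k)
    · exact fun k => (hGint k).aestronglyMeasurable.aemeasurable.ennreal_ofReal
    · refine (ae_restrict_mem measurableSet_Ioc).mono fun t ht k l hkl => ?_
      have := h.isProbabilityMeasure t ht.1.le
      have hkl' : (k : ℝ) ≤ l := Nat.cast_le.2 hkl
      refine ENNReal.ofReal_le_ofReal (integral_mono ?_ ?_ fun z => ?_)
      · exact integrable_of_compactSupport (contDiff_cutoff_mul_sqNorm hV _)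
          (hasCompactSupport_cutoff_mul_sqNorm hc hVc (by positivity))
      · exact integrable_of_compactSupport (contDiff_cutoff_mul_sqNorm hV _)
          (hasCompactSupport_cutoff_mul_sqNorm hc hVc (by positivity))
      · exact mul_le_mul_of_nonneg_right
          (cutoff_mono_left (by positivity) (by linarith) (hV0 z)) (sqNorm_nonneg z)
  have hae := ae_lt_top' (μ := volume.restrict (Set.Ioc 0 τ))
    (f := fun t => ⨆ k, ENNReal.ofReal (G k t))
    (AEMeasurable.iSup fun k => (hGint k).aestronglyMeasurable.aemeasurable.ennreal_ofReal)
    (hlint.trans_lt ENNReal.ofReal_lt_top).ne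
  have hne : (ae (volume.restrict (Set.Ioc 0 τ))).NeBot := by
    rw [ae_neBot, Ne, Measure.restrict_eq_zero, Real.volume_Ioc]
    simpa using hτ
  -- By monotone convergence in both time and phase space the second moment is finite at almost
  -- every time of the period; one such time is enough.
  obtain ⟨t₀, ht₀, hmem⟩ := (hae.and (ae_restrict_mem measurableSet_Ioc)).exists
  have := h.isProbabilityMeasure t₀ hmem.1.le
  refine ⟨t₀, hmem.1.le, hmem.2, integrable_sqNorm_of_lintegral_lt_top ?_⟩
  rw [lintegral_sqNorm_eq_iSup hV hV0]
  simpa only [ofReal_integral_cutoff hV hc hVc, hG] using ht₀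

/-- The second moments of a periodic stationary state are finite and bounded in time. -/
theorem exists_moment_bound (h : IsPeriodicStationaryState ω₀ γ T f τ μ) (hτ : 0 < τ)
    (hf : Continuous f) (hω₀ : 0 < ω₀) (hγ : 0 < γ) (hT : 0 ≤ T) {M : ℝ} (hM : ∀ t, |f t| ≤ M) :
    ∃ B : ℝ, 0 ≤ B ∧ ∀ t, 0 ≤ t →
      Integrable (sqNorm : Phase n → ℝ) (μ t) ∧ ∫ z, sqNorm z ∂(μ t) ≤ B := by
  obtain ⟨V, hV, c, K, hc, hK, hVall⟩ := exists_lyapunov (n := n) T M hω₀ hγ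
  have hVc := fun z => (hVall z).1
  have hVK := fun z => (hVall z).2.1
  have hVg : ∀ t z, generator ω₀ γ T (f t) V z ≤ K - c * sqNorm z :=
    fun t z => (hVall z).2.2 _ (hM t)
  have hV0 (z) : 0 ≤ V z := (mul_nonneg hc.le (sqNorm_nonneg z)).trans (hVc z)
  obtain ⟨t₀, ht₀, ht₀τ, hint⟩ := h.exists_integrable_sqNorm hτ hf hγ.le hT hV hc hK hVc hVg
  set B := (K * ∫ z, sqNorm z ∂(μ t₀) + K * τ) / c with hB
  have hB0 : 0 ≤ B := by
    have : 0 ≤ ∫ z, sqNorm z ∂(μ t₀) := integral_nonneg sqNorm_nonneg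
    positivity
  -- The bound does not involve the truncation level: at `t₀` the truncated function lies below `K
  -- sqNorm`, and at `t` it lies above `c · cutoff · sqNorm`.
  have main : ∀ t, t₀ ≤ t → t ≤ t₀ + τ →
      Integrable (sqNorm : Phase n → ℝ) (μ t) ∧ ∫ z, sqNorm z ∂(μ t) ≤ B := by
    intro t h1 h2
    have := h.isProbabilityMeasure t (ht₀.trans h1)
    have := h.isProbabilityMeasure t₀ ht₀
    refine integrable_sqNorm_of_cutoff_le hV hc hVc fun k => ?_
    have hk : (0 : ℝ) < k + 1 := by positivity
    have h3 := h.integral_truncation_sub_le hf hγ.le hT hV hc hK hVc hVg hk ht₀ h1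
    have hI (s) (hs : 0 ≤ s) : Integrable (fun z => truncation (k + 1) (V z)) (μ s) := by
      have := h.isProbabilityMeasure s hs
      refine Integrable.of_bound (C := truncation (k + 1) (2 * (k + 1)))
        ((contDiff_truncation _).continuous.comp hV.continuous).aestronglyMeasurable
        (Eventually.of_forall fun z => ?_)
      rw [Real.norm_of_nonneg (truncation_nonneg (hV0 z))]
      have := truncation_concave hk (V z) (2 * (k + 1))
      rw [deriv_truncation, cutoff_eq_zero hk le_rfl, zero_mul, add_zero] at this
      exact this
    have h4 : 0 ≤ ∫ r in t₀..t, ∫ z, cutoff (k + 1) (V z) * sqNorm z ∂(μ r) :=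
      intervalIntegral.integral_nonneg h1 fun r _ =>
        integral_nonneg fun z => mul_nonneg (cutoff_nonneg _ _) (sqNorm_nonneg z)
    rw [integral_sub (hI t (ht₀.trans h1)) (integrable_const _),
      integral_sub (hI t₀ ht₀) (integrable_const _)] at h3
    simp only [integral_const, probReal_univ, one_smul] at h3
    have h5 : ∫ z, truncation (k + 1) (V z) ∂(μ t₀) ≤ K * ∫ z, sqNorm z ∂(μ t₀) := by
      rw [← integral_const_mul]
      exact integral_mono (hI t₀ ht₀) (hint.const_mul K) fun z =>
        (truncation_le hk _).trans (hVK z)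
    have h6 : c * ∫ z, cutoff (k + 1) (V z) * sqNorm z ∂(μ t)
        ≤ ∫ z, truncation (k + 1) (V z) ∂(μ t) := by
      rw [← integral_const_mul]
      refine integral_mono ((integrable_of_compactSupport (contDiff_cutoff_mul_sqNorm hV _)
          (hasCompactSupport_cutoff_mul_sqNorm hc hVc hk)).const_mul c)
        (hI t (ht₀.trans h1)) fun z => ?_
      have := mul_le_mul_of_nonneg_left (hVc z) (cutoff_nonneg (k + 1) (V z))
      have := cutoff_mul_le_truncation hk (V z)
      simp only
      linarith
    rw [hB, le_div_iff₀ hc]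
    have h7 : K * (t - t₀) ≤ K * τ := mul_le_mul_of_nonneg_left (by linarith) hK
    have h8 := mul_nonneg hc.le h4
    linarith
  refine ⟨B, hB0, fun t ht => ?_⟩
  -- Times before `t₀` move one period forward and land in the window because `t₀ ≤ τ`; later times
  -- move back by whole periods.
  rcases lt_or_ge t t₀ with hlt | hge
  · rw [← h.periodic t ht]
    exact main _ (by linarith) (by linarith)
  · have hk0 : 0 ≤ (t - t₀) / τ := div_nonneg (by linarith) hτ.le
    set k := ⌊(t - t₀) / τ⌋₊ with hk
    have h1 : (k : ℝ) * τ ≤ t - t₀ := by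
      rw [← le_div_iff₀ hτ]
      exact Nat.floor_le hk0
    have h2 : t - t₀ < (k + 1) * τ := by
      rw [← div_lt_iff₀ hτ]
      exact Nat.lt_floor_add_one _
    have h3 := h.periodic_nat hτ.le (t := t - k * τ) (by linarith) k
    rw [sub_add_cancel] at h3
    rw [h3]
    exact main _ (by linarith) (by linarith)

end IsPeriodicStationaryState

/-! ### The forward equation for observables of quadratic growth -/

/-- The observables of at most quadratic growth. -/
def QuadGrowth (F : Phase n → ℝ) : Prop := ∃ C : ℝ, 0 ≤ C ∧ ∀ z, |F z| ≤ C * (1 + sqNorm z)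

namespace QuadGrowth

lemma add {F G : Phase n → ℝ} (hF : QuadGrowth F) (hG : QuadGrowth G) :
    QuadGrowth fun z => F z + G z := by
  obtain ⟨C, hC, hF⟩ := hF
  obtain ⟨D, hD, hG⟩ := hG
  refine ⟨C + D, add_nonneg hC hD, fun z => (abs_add_le _ _).trans ?_⟩
  linarith [hF z, hG z]

lemma const_mul {F : Phase n → ℝ} (hF : QuadGrowth F) (c : ℝ) : QuadGrowth fun z => c * F z := by
  obtain ⟨C, hC, hF⟩ := hF
  refine ⟨|c| * C, by positivity, fun z => ?_⟩
  rw [abs_mul, mul_assoc]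
  exact mul_le_mul_of_nonneg_left (hF z) (abs_nonneg c)

lemma const (c : ℝ) : QuadGrowth fun _ : Phase n => c :=
  ⟨|c|, abs_nonneg c, fun z => le_mul_of_one_le_right (abs_nonneg c)
    (by linarith [sqNorm_nonneg z])⟩

lemma sum {ι : Type*} (s : Finset ι) {F : ι → Phase n → ℝ} (hF : ∀ i, QuadGrowth (F i)) :
    QuadGrowth fun z => ∑ i ∈ s, F i z := by
  classical
  induction s using Finset.induction_on with
  | empty => simpa using QuadGrowth.const (n := n) 0
  | insert i s his ih =>
    simp only [Finset.sum_insert his]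
    exact (hF i).add ih

lemma of_abs_le_sqrt {F : Phase n → ℝ} (C : ℝ) (hC : 0 ≤ C) (h : ∀ z, |F z| ≤ C * √(sqNorm z)) :
    QuadGrowth F := by
  refine ⟨C, hC, fun z => (h z).trans (mul_le_mul_of_nonneg_left ?_ hC)⟩
  nlinarith [Real.sq_sqrt (sqNorm_nonneg z), sq_nonneg (√(sqNorm z) - 1), sqNorm_nonneg z]

lemma fst_apply (x : Fin (n + 1)) : QuadGrowth fun z : Phase n => z.1 x :=
  of_abs_le_sqrt 1 zero_le_one fun z => by simpa using abs_fst_le_sqrt z x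

lemma snd_apply (x : Fin (n + 1)) : QuadGrowth fun z : Phase n => z.2 x :=
  of_abs_le_sqrt 1 zero_le_one fun z => by simpa using abs_snd_le_sqrt z x

lemma quadMonomial (i : QuadIndex n) : QuadGrowth fun z : Phase n => quadMonomial z i :=
  ⟨1, zero_le_one, fun z => by linarith [abs_quadMonomial_le i z]⟩

lemma fst_mul_fst (x y : Fin (n + 1)) : QuadGrowth fun z : Phase n => z.1 x * z.1 y :=
  quadMonomial (.inl (x, y))

lemma fst_mul_snd (x y : Fin (n + 1)) : QuadGrowth fun z : Phase n => z.1 x * z.2 y :=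
  quadMonomial (.inr (.inl (x, y)))

lemma snd_mul_snd (x y : Fin (n + 1)) : QuadGrowth fun z : Phase n => z.2 x * z.2 y :=
  quadMonomial (.inr (.inr (x, y)))

end QuadGrowth

/-- A multiple of the acceleration, expanded in the positions. -/
lemma mul_accel (ω₀ f a : ℝ) (q : Fin (n + 1) → ℝ) (x : Fin (n + 1)) :
    a * accel ω₀ f q x = (∑ y, -stiffness n ω₀ x y * (q y * a))
      + (if x = Fin.last n then f else 0) * a := by
  rw [accel_eq, mul_add, ← Finset.sum_neg_distrib, Finset.mul_sum]
  congr 1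
  · exact Finset.sum_congr rfl fun y _ => by ring
  · ring

lemma quadGrowth_generator_fst (ω₀ γ T : ℝ) (x : Fin (n + 1)) :
    QuadGrowth (generator ω₀ γ T 0 fun z : Phase n => z.1 x) := by
  simp only [funext (generator_fst_apply ω₀ γ T 0 x)]
  exact .snd_apply x

lemma quadGrowth_generator_snd (ω₀ γ T : ℝ) (x : Fin (n + 1)) :
    QuadGrowth (generator ω₀ γ T 0 fun z : Phase n => z.2 x) := by
  simp only [funext (generator_snd_apply ω₀ γ T 0 x), accel_eq, ite_self, add_zero,
    ← Finset.sum_neg_distrib, ← neg_mul, sub_eq_add_neg]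
  exact (QuadGrowth.sum _ fun y => (QuadGrowth.fst_apply y).const_mul _).add
    ((QuadGrowth.snd_apply x).const_mul _)

/-- The drift is linear, the reversals are linear and the diffusion is constant, so the degree does
not increase. This is what closes the moment hierarchy at second order. -/
lemma quadGrowth_generator_quadMonomial (ω₀ γ T : ℝ) (i : QuadIndex n) :
    QuadGrowth (generator ω₀ γ T 0 fun z : Phase n => quadMonomial z i) := by
  rcases i with ⟨x, y⟩ | ⟨x, y⟩ | ⟨x, y⟩ <;> simp only [quadMonomial]
  · have e : (generator ω₀ γ T 0 fun z : Phase n => z.1 x * z.1 y)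
        = fun z => z.1 y * z.2 x + z.1 x * z.2 y := by
      ext z
      rw [generator_fst_mul_fst]
      ring
    rw [e]
    exact (QuadGrowth.fst_mul_snd y x).add (.fst_mul_snd x y)
  · have e : (generator ω₀ γ T 0 fun z : Phase n => z.1 x * z.2 y)
        = fun z => z.2 x * z.2 y + (∑ w, -stiffness n ω₀ y w * (z.1 w * z.1 x))
          + -(2 * γ) * (z.1 x * z.2 y) := by
      ext z
      rw [generator_fst_mul_snd, mul_accel]
      simp
      ring
    rw [e]
    exact ((QuadGrowth.snd_mul_snd x y).add
      (.sum _ fun w => (QuadGrowth.fst_mul_fst w x).const_mul _)).add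
      ((QuadGrowth.fst_mul_snd x y).const_mul _)
  · have e : (generator ω₀ γ T 0 fun z : Phase n => z.2 x * z.2 y)
        = fun z => (∑ w, -stiffness n ω₀ x w * (z.1 w * z.2 y))
          + (∑ w, -stiffness n ω₀ y w * (z.1 w * z.2 x)) + -(4 * γ) * (z.2 x * z.2 y)
          + ((if x = y then if x = 0 then 0 else 4 * γ else 0) * (z.2 x * z.2 x)
          + if x = y then if x = 0 then 4 * γ * T else 0 else 0) := by
      ext z
      rw [generator_snd_mul_snd, mul_accel, mul_comm (accel ω₀ 0 z.1 x), mul_accel]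
      split_ifs <;> simp <;> ring
    rw [e]
    exact (((QuadGrowth.sum _ fun w => (QuadGrowth.fst_mul_snd w y).const_mul _).add
      (.sum _ fun w => (QuadGrowth.fst_mul_snd w x).const_mul _)).add
      ((QuadGrowth.snd_mul_snd x y).const_mul _)).add
      (((QuadGrowth.snd_mul_snd x x).const_mul _).add (.const _))

lemma sqNorm_eq_quadForm : (sqNorm : Phase n → ℝ) = quadForm (sqNormCoeff n) :=
  funext fun z => (quadForm_sqNormCoeff z).symm

lemma quadGrowth_generator_sqNorm (ω₀ γ T : ℝ) :
    QuadGrowth (generator ω₀ γ T 0 (sqNorm : Phase n → ℝ)) := by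
  rw [sqNorm_eq_quadForm]
  unfold quadForm
  simp only [funext (generator_sum ω₀ γ T 0 Finset.univ
    fun i => contDiff_const.mul (contDiff_quadMonomial (n := n) i)),
    generator_const_mul ω₀ γ T 0 _ (contDiff_quadMonomial _)]
  exact QuadGrowth.sum _ fun i => (quadGrowth_generator_quadMonomial ω₀ γ T i).const_mul _

/-! ### Derivative bounds for the cutoffs -/

lemma deriv_smoothTransition_eq_zero_left {u : ℝ} (hu : u < 0) :
    deriv Real.smoothTransition u = 0 := by
  have : Real.smoothTransition =ᶠ[𝓝 u] fun _ => 0 := by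
    filter_upwards [Iio_mem_nhds hu] with v hv
    exact Real.smoothTransition.zero_of_nonpos (le_of_lt hv)
  rw [this.deriv_eq, deriv_const]

lemma deriv_smoothTransition_eq_zero_right {u : ℝ} (hu : 1 < u) :
    deriv Real.smoothTransition u = 0 := by
  have : Real.smoothTransition =ᶠ[𝓝 u] fun _ => 1 := by
    filter_upwards [Ioi_mem_nhds hu] with v hv
    exact Real.smoothTransition.one_of_one_le (le_of_lt hv)
  rw [this.deriv_eq, deriv_const]

lemma deriv_deriv_smoothTransition_eq_zero_left {u : ℝ} (hu : u < 0) :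
    deriv (deriv Real.smoothTransition) u = 0 := by
  have : deriv Real.smoothTransition =ᶠ[𝓝 u] fun _ => 0 := by
    filter_upwards [Iio_mem_nhds hu] with v hv
    exact deriv_smoothTransition_eq_zero_left hv
  rw [this.deriv_eq, deriv_const]

lemma deriv_deriv_smoothTransition_eq_zero_right {u : ℝ} (hu : 1 < u) :
    deriv (deriv Real.smoothTransition) u = 0 := by
  have : deriv Real.smoothTransition =ᶠ[𝓝 u] fun _ => 0 := by
    filter_upwards [Ioi_mem_nhds hu] with v hv
    exact deriv_smoothTransition_eq_zero_right hv
  rw [this.deriv_eq, deriv_const]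

lemma exists_bound_of_eq_zero {g : ℝ → ℝ} (hg : Continuous g) (h0 : ∀ u < 0, g u = 0)
    (h1 : ∀ u, 1 < u → g u = 0) : ∃ C : ℝ, 0 ≤ C ∧ ∀ u, |g u| ≤ C := by
  have hc : HasCompactSupport g := by
    refine HasCompactSupport.intro (isCompact_Icc (a := (0 : ℝ)) (b := 1)) fun u hu => ?_
    rw [Set.mem_Icc, not_and_or, not_le, not_le] at hu
    exact hu.elim (h0 u) (h1 u)
  obtain ⟨C, hC⟩ := hc.exists_bound_of_continuous hg
  exact ⟨C, (norm_nonneg _).trans (hC 0), hC⟩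

lemma contDiff_deriv_smoothTransition : ContDiff ℝ ∞ (deriv Real.smoothTransition) :=
  (contDiff_infty_iff_deriv.1 Real.smoothTransition.contDiff).2

lemma hasDerivAt_cutoff (R v : ℝ) :
    HasDerivAt (cutoff R) (-(deriv Real.smoothTransition (2 - v / R) / R)) v := by
  have h1 : HasDerivAt (fun v : ℝ => 2 - v / R) (-(1 / R)) v := by
    simpa using ((hasDerivAt_id v).div_const R).const_sub 2
  have h2 := ((Real.smoothTransition.contDiff (n := ⊤)).differentiable (by simp)
    (2 - v / R)).hasDerivAt
  refine (h2.comp v h1).congr_deriv ?_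
  ring

lemma deriv_cutoff (R : ℝ) :
    deriv (cutoff R) = fun v => -(deriv Real.smoothTransition (2 - v / R) / R) :=
  funext fun v => (hasDerivAt_cutoff R v).deriv

lemma deriv_deriv_cutoff (R v : ℝ) :
    deriv (deriv (cutoff R)) v = deriv (deriv Real.smoothTransition) (2 - v / R) / R ^ 2 := by
  rw [deriv_cutoff]
  have h1 : HasDerivAt (fun v : ℝ => 2 - v / R) (-(1 / R)) v := by
    simpa using ((hasDerivAt_id v).div_const R).const_sub 2
  have h2 := (contDiff_deriv_smoothTransition.differentiable (by simp) (2 - v / R)).hasDerivAt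
  refine (((h2.comp v h1).div_const R).neg.congr_deriv ?_).deriv
  ring

lemma deriv_cutoff_eq_zero {R v : ℝ} (hR : 0 < R) (h : v < R) : deriv (cutoff R) v = 0 := by
  have : v / R < 1 := (div_lt_one hR).2 h
  rw [deriv_cutoff]
  simp only
  rw [deriv_smoothTransition_eq_zero_right (by linarith)]
  simp

lemma deriv_deriv_cutoff_eq_zero {R v : ℝ} (hR : 0 < R) (h : v < R) :
    deriv (deriv (cutoff R)) v = 0 := by
  have : v / R < 1 := (div_lt_one hR).2 h
  rw [deriv_deriv_cutoff, deriv_deriv_smoothTransition_eq_zero_right (by linarith), zero_div]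

/-- The derivatives of the cutoffs decay at the scale of the cutoff. -/
lemma exists_deriv_cutoff_bound : ∃ C : ℝ, 0 ≤ C ∧ ∀ R v : ℝ, 1 ≤ R → 0 ≤ v →
    |deriv (cutoff R) v| * (1 + v) ≤ C ∧ |deriv (deriv (cutoff R)) v| * (1 + v) ≤ C := by
  obtain ⟨C, hC, h1⟩ := exists_bound_of_eq_zero contDiff_deriv_smoothTransition.continuous
    (fun u => deriv_smoothTransition_eq_zero_left)
    (fun u => deriv_smoothTransition_eq_zero_right)
  obtain ⟨D, hD, h2⟩ := exists_bound_of_eq_zero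
    (contDiff_infty_iff_deriv.1 contDiff_deriv_smoothTransition).2.continuous
    (fun u => deriv_deriv_smoothTransition_eq_zero_left)
    (fun u => deriv_deriv_smoothTransition_eq_zero_right)
  -- The derivative lives on `v ≤ 2R`, where `1 + v ≤ 3R` because `R ≥ 1`; this absorbs the factor
  -- `1/R` from the scaling.
  have key (g : ℝ → ℝ) (B : ℝ) (hB : ∀ u, |g u| ≤ B) (h0 : ∀ u < 0, g u = 0) (R v : ℝ)
      (hR : 1 ≤ R) (hv : 0 ≤ v) : |g (2 - v / R)| / R * (1 + v) ≤ 3 * B := by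
    have hR0 : 0 < R := by linarith
    have hB0 : 0 ≤ B := (abs_nonneg _).trans (hB 0)
    rcases lt_or_ge (2 * R) v with hlt | hge
    · have : 2 < v / R := (lt_div_iff₀ hR0).2 hlt
      rw [h0 _ (by linarith), abs_zero, zero_div, zero_mul]
      linarith
    · rw [div_mul_eq_mul_div, div_le_iff₀ hR0]
      calc |g (2 - v / R)| * (1 + v) ≤ B * (3 * R) :=
            mul_le_mul (hB _) (by linarith) (by linarith) hB0
        _ = 3 * B * R := by ring
  refine ⟨max (3 * C) (3 * D), by positivity, fun R v hR hv => ⟨?_, ?_⟩⟩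
  · rw [deriv_cutoff, abs_neg, abs_div, abs_of_pos (by linarith : 0 < R)]
    exact (key _ C h1 (fun u => deriv_smoothTransition_eq_zero_left) R v hR hv).trans
      (le_max_left _ _)
  · rw [deriv_deriv_cutoff, abs_div, abs_of_pos (by positivity : 0 < R ^ 2)]
    refine le_trans ?_ ((key _ D h2 (fun u => deriv_deriv_smoothTransition_eq_zero_left)
      R v hR hv).trans (le_max_right _ _))
    refine mul_le_mul_of_nonneg_right ?_ (by linarith)
    exact div_le_div_of_nonneg_left (abs_nonneg _) (by linarith) (by nlinarith)

lemma partialP_comp {φ : ℝ → ℝ} (hφ : ContDiff ℝ ∞ φ) {V : Phase n → ℝ} (hV : ContDiff ℝ ∞ V)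
    (x : Fin (n + 1)) :
    partialP x (fun z => φ (V z)) = fun z => deriv φ (V z) * partialP x V z := by
  ext z
  have := ((hφ.differentiable (by simp) (V z)).hasDerivAt.comp_hasFDerivAt z
      (hV.differentiable (by simp) z).hasFDerivAt).fderiv
  simp only [Function.comp_def] at this
  simp [partialP, this]

/-- The chain rule for an observable that does not depend on the signs of the velocities. -/
lemma generator_comp_of_flip (ω₀ γ T f : ℝ) {φ : ℝ → ℝ} (hφ : ContDiff ℝ ∞ φ) {V : Phase n → ℝ}
    (hV : ContDiff ℝ ∞ V) (hflip : ∀ x z, V (flipAt x z) = V z) (z : Phase n) :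
    generator ω₀ γ T f (fun z => φ (V z)) z
      = deriv φ (V z) * generator ω₀ γ T f V z
        + 2 * γ * T * (deriv (deriv φ) (V z) * partialP 0 V z ^ 2) := by
  have hφ' : ContDiff ℝ ∞ (deriv φ) := (contDiff_infty_iff_deriv.1 hφ).2
  have hfd := ((hφ.differentiable (by simp) (V z)).hasDerivAt.comp_hasFDerivAt z
      (hV.differentiable (by simp) z).hasFDerivAt).fderiv
  simp only [Function.comp_def] at hfd
  have h2 : partialP 0 (partialP 0 (fun z => φ (V z))) z
      = deriv φ (V z) * partialP 0 (partialP 0 V) z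
        + partialP 0 V z * (deriv (deriv φ) (V z) * partialP 0 V z) := by
    rw [partialP_comp hφ hV, partialP_mul (F := fun z => deriv φ (V z)) (hφ'.comp hV)
      (contDiff_partialP hV 0), partialP_comp hφ' hV]
  have h3 : flipPart (fun z => φ (V z)) z = 0 := by simp [flipPart, hflip]
  have h4 : flipPart V z = 0 := by simp [flipPart, hflip]
  unfold generator
  simp only [hamiltonianPart_eq, thermostatPart, h2, h3, h4]
  rw [hfd, partialP_comp hφ hV]
  simp
  ring

/-- The smooth cutoff of the phase space at scale `√(k + 1)`. -/
noncomputable def phaseCutoff (k : ℕ) (z : Phase n) : ℝ := cutoff (k + 1) (sqNorm z)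

lemma contDiff_phaseCutoff (k : ℕ) : ContDiff ℝ ∞ (phaseCutoff k : Phase n → ℝ) :=
  (contDiff_cutoff _).comp contDiff_sqNorm

lemma phaseCutoff_flipAt (k : ℕ) (x : Fin (n + 1)) (z : Phase n) :
    phaseCutoff k (flipAt x z) = phaseCutoff k z := by
  rw [phaseCutoff, sqNorm_flipAt, phaseCutoff]

lemma abs_phaseCutoff_le_one (k : ℕ) (z : Phase n) : |phaseCutoff k z| ≤ 1 := by
  rw [phaseCutoff, abs_of_nonneg (cutoff_nonneg _ _)]
  exact cutoff_le_one _ _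

lemma hasCompactSupport_mul_phaseCutoff (F : Phase n → ℝ) (k : ℕ) :
    HasCompactSupport fun z => F z * phaseCutoff k z := by
  refine hasCompactSupport_of_le_sqNorm (2 * (k + 1)) fun z hz => ?_
  rw [phaseCutoff, cutoff_eq_zero (by positivity) hz, mul_zero]

lemma abs_partialP_sqNorm_bound : ∃ B : ℝ, 0 ≤ B ∧ ∀ (y : Fin (n + 1)) (z : Phase n),
    |partialP y sqNorm z| ≤ B * √(sqNorm z) := by
  choose B hB h using fun y => exists_abs_partialP_quadForm_le y (sqNormCoeff n)
  refine ⟨∑ y, B y, Finset.sum_nonneg fun y _ => hB y, fun y z => ?_⟩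
  have hy := h y z
  rw [← sqNorm_eq_quadForm] at hy
  refine hy.trans (mul_le_mul_of_nonneg_right ?_ (Real.sqrt_nonneg _))
  exact Finset.single_le_sum (fun y _ => hB y) (Finset.mem_univ y)

/-- The generator of `sqNorm` and the square of its `p_0`-derivative grow at most like `1 + sqNorm`,
which the decay of the cutoff derivatives compensates uniformly in `k`. The cutoff is built on
`sqNorm` and not on the Lyapunov function, because `sqNorm` is invariant under reversals. -/
lemma exists_phaseCutoff_bound (ω₀ γ T M : ℝ) : ∃ C : ℝ, 0 ≤ C ∧ ∀ (k : ℕ) (z : Phase n),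
    |partialP 0 (phaseCutoff k) z| ≤ C ∧
      ∀ f, |f| ≤ M → |generator ω₀ γ T f (phaseCutoff k) z| ≤ C := by
  obtain ⟨C, hC, hcut⟩ := exists_deriv_cutoff_bound
  obtain ⟨B, hB, hpart⟩ := abs_partialP_sqNorm_bound (n := n)
  obtain ⟨D, hD, hgen⟩ := quadGrowth_generator_sqNorm (n := n) ω₀ γ T
  have hsqrt (z : Phase n) : √(sqNorm z) ≤ 1 + sqNorm z := by
    nlinarith [Real.sq_sqrt (sqNorm_nonneg z), sq_nonneg (√(sqNorm z) - 1), sqNorm_nonneg z]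
  have hpart' (y) (z : Phase n) : |partialP y sqNorm z| ≤ B * (1 + sqNorm z) :=
    (hpart y z).trans (mul_le_mul_of_nonneg_left (hsqrt z) hB)
  have hmul {a b e : ℝ} {z : Phase n} (he : 0 ≤ e) (ha : |a| * (1 + sqNorm z) ≤ C)
      (hb : |b| ≤ e * (1 + sqNorm z)) : |a * b| ≤ C * e := by
    rw [abs_mul]
    calc |a| * |b| ≤ |a| * (e * (1 + sqNorm z)) := mul_le_mul_of_nonneg_left hb (abs_nonneg _)
      _ = |a| * (1 + sqNorm z) * e := by ring
      _ ≤ C * e := mul_le_mul_of_nonneg_right ha he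
  refine ⟨C * B + (C * (D + |M| * B) + |2 * γ * T| * (C * B ^ 2)), by positivity,
    fun k z => ?_⟩
  have hk : (1 : ℝ) ≤ k + 1 := by linarith [(Nat.cast_nonneg k : (0 : ℝ) ≤ k)]
  obtain ⟨h1, h2⟩ := hcut (k + 1) (sqNorm z) hk (sqNorm_nonneg z)
  constructor
  · have e : partialP 0 (phaseCutoff k) z
        = deriv (cutoff (k + 1)) (sqNorm z) * partialP 0 sqNorm z := by
      have := congrFun (partialP_comp (contDiff_cutoff (k + 1)) (contDiff_sqNorm (n := n)) 0) z
      exact this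
    rw [e]
    refine (hmul hB h1 (hpart' 0 z)).trans (le_add_of_nonneg_right (by positivity))
  · intro f hf
    have e := generator_comp_of_flip ω₀ γ T f (contDiff_cutoff (k + 1)) (contDiff_sqNorm (n := n))
      sqNorm_flipAt z
    have e' : generator ω₀ γ T f (phaseCutoff k) z
      = generator ω₀ γ T f (fun z => cutoff (k + 1) (sqNorm z)) z := rfl
    rw [e', e]
    have h3 : |generator ω₀ γ T f sqNorm z| ≤ (D + |M| * B) * (1 + sqNorm z) := by
      rw [generator_eq_zero_add]
      refine (abs_add_le _ _).trans ?_
      rw [abs_mul, add_mul, mul_assoc]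
      exact add_le_add (hgen z) (mul_le_mul (hf.trans (le_abs_self M)) (hpart' _ z)
        (abs_nonneg _) (abs_nonneg _))
    have h4 : |partialP 0 sqNorm z ^ 2| ≤ B ^ 2 * (1 + sqNorm z) := by
      rw [abs_pow]
      calc |partialP 0 sqNorm z| ^ 2 ≤ (B * √(sqNorm z)) ^ 2 :=
            pow_le_pow_left₀ (abs_nonneg _) (hpart 0 z) 2
        _ = B ^ 2 * sqNorm z := by rw [mul_pow, Real.sq_sqrt (sqNorm_nonneg z)]
        _ ≤ B ^ 2 * (1 + sqNorm z) := mul_le_mul_of_nonneg_left (by linarith) (sq_nonneg B)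
    have h5 := hmul (by positivity) h1 h3
    have h6 := hmul (by positivity) h2 h4
    have h7 : |2 * γ * T * (deriv (deriv (cutoff (k + 1))) (sqNorm z) * partialP 0 sqNorm z ^ 2)|
        ≤ |2 * γ * T| * (C * B ^ 2) := by
      rw [abs_mul]
      exact mul_le_mul_of_nonneg_left h6 (abs_nonneg _)
    refine (abs_add_le _ _).trans ((add_le_add h5 h7).trans (le_add_of_nonneg_left ?_))
    positivity

lemma eventually_phaseCutoff (ω₀ γ T f : ℝ) (z : Phase n) : ∀ᶠ k : ℕ in atTop,
    phaseCutoff k z = 1 ∧ partialP 0 (phaseCutoff k) z = 0 ∧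
      generator ω₀ γ T f (phaseCutoff k) z = 0 := by
  obtain ⟨N, hN⟩ := exists_nat_ge (sqNorm z)
  filter_upwards [eventually_ge_atTop N] with k hk
  have hk' : (N : ℝ) ≤ k := Nat.cast_le.2 hk
  have hk0 : (0 : ℝ) < k + 1 := by positivity
  have hlt : sqNorm z < k + 1 := by linarith
  refine ⟨cutoff_eq_one hk0 hlt.le, ?_, ?_⟩
  · have := congrFun (partialP_comp (contDiff_cutoff (k + 1)) (contDiff_sqNorm (n := n)) 0) z
    rw [deriv_cutoff_eq_zero hk0 hlt, zero_mul] at this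
    exact this
  · have := generator_comp_of_flip ω₀ γ T f (contDiff_cutoff (k + 1)) (contDiff_sqNorm (n := n))
      sqNorm_flipAt z
    rw [deriv_cutoff_eq_zero hk0 hlt, deriv_deriv_cutoff_eq_zero hk0 hlt] at this
    rw [zero_mul, zero_mul, mul_zero, add_zero] at this
    exact this

lemma QuadGrowth.integrable {F : Phase n → ℝ} (hF : QuadGrowth F) (hc : Continuous F)
    {ν : Measure (Phase n)} [IsProbabilityMeasure ν] (hν : Integrable (sqNorm : Phase n → ℝ) ν) :
    Integrable F ν := by
  obtain ⟨C, hC, h⟩ := hF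
  refine (((integrable_const (1 : ℝ)).add hν).const_mul C).mono' hc.aestronglyMeasurable
    (Eventually.of_forall fun z => h z)

lemma abs_integral_le_of_quadGrowth {F : Phase n → ℝ} {C B : ℝ}
    (hF : ∀ z, |F z| ≤ C * (1 + sqNorm z)) (hC : 0 ≤ C)
    {ν : Measure (Phase n)} [IsProbabilityMeasure ν]
    (hν : Integrable (sqNorm : Phase n → ℝ) ν) (hB : ∫ z, sqNorm z ∂ν ≤ B) :
    |∫ z, F z ∂ν| ≤ C * (1 + B) := by
  have hi : Integrable (fun z => C * (1 + sqNorm z)) ν :=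
    ((integrable_const (1 : ℝ)).add hν).const_mul C
  have h1 : ‖∫ z, F z ∂ν‖ ≤ ∫ z, C * (1 + sqNorm z) ∂ν :=
    norm_integral_le_of_norm_le hi (Eventually.of_forall fun z => hF z)
  refine h1.trans ?_
  rw [integral_const_mul, integral_add (integrable_const _) hν]
  simp only [integral_const, probReal_univ, one_smul]
  exact mul_le_mul_of_nonneg_left (by linarith) hC

namespace IsPeriodicStationaryState

variable {ω₀ γ T τ : ℝ} {f : ℝ → ℝ} {μ : ℝ → Measure (Phase n)} {B M : ℝ}

/-- The integrated forward equation for observables of quadratic growth. -/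
lemma integral_sub_integral_of_quadGrowth (h : IsPeriodicStationaryState ω₀ γ T f τ μ)
    (hf : Continuous f) (hM : ∀ t, |f t| ≤ M)
    (hB : ∀ t, 0 ≤ t → Integrable (sqNorm : Phase n → ℝ) (μ t) ∧ ∫ z, sqNorm z ∂(μ t) ≤ B)
    {F : Phase n → ℝ} (hF : ContDiff ℝ ∞ F) (hFq : QuadGrowth F)
    (hp : QuadGrowth fun z => partialP 0 F z ^ 2) (hg : QuadGrowth (generator ω₀ γ T 0 F))
    (hl : QuadGrowth (partialP (Fin.last n) F)) {s t : ℝ} (hs : 0 ≤ s) (hst : s ≤ t) :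
    IntervalIntegrable (fun r => ∫ z, generator ω₀ γ T (f r) F z ∂(μ r)) volume s t ∧
    ∫ z, F z ∂(μ t) - ∫ z, F z ∂(μ s)
      = ∫ r in s..t, ∫ z, generator ω₀ γ T (f r) F z ∂(μ r) := by
  obtain ⟨C₁, hC₁, h1⟩ := hFq
  obtain ⟨C₂, hC₂, h2⟩ := hp
  obtain ⟨C₃, hC₃, h3⟩ := hg
  obtain ⟨C₄, hC₄, h4⟩ := hl
  obtain ⟨C₅, hC₅, h5⟩ := exists_phaseCutoff_bound (n := n) ω₀ γ T M
  have hgen : ∀ r z, |generator ω₀ γ T (f r) F z| ≤ (C₃ + |M| * C₄) * (1 + sqNorm z) := by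
    intro r z
    rw [generator_eq_zero_add, add_mul, mul_assoc]
    refine (abs_add_le _ _).trans (add_le_add (h3 z) ?_)
    rw [abs_mul]
    exact mul_le_mul ((hM r).trans (le_abs_self M)) (h4 z) (abs_nonneg _) (abs_nonneg _)
  set C₆ := (C₃ + |M| * C₄) + C₁ * C₅ + |4 * γ * T| * (C₂ + C₅ ^ 2) with hC₆
  have hC₆0 : 0 ≤ C₆ := by positivity
  set Fk : ℕ → Phase n → ℝ := fun k z => F z * phaseCutoff k z with hFk
  have hFks (k) : ContDiff ℝ ∞ (Fk k) := hF.mul (contDiff_phaseCutoff k)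
  have hFkc (k) : HasCompactSupport (Fk k) := hasCompactSupport_mul_phaseCutoff F k
  have hmul (k r z) : generator ω₀ γ T (f r) (Fk k) z
      = phaseCutoff k z * generator ω₀ γ T (f r) F z
        + F z * generator ω₀ γ T (f r) (phaseCutoff k) z
        + 4 * γ * T * partialP 0 F z * partialP 0 (phaseCutoff k) z :=
    generator_mul ω₀ γ T (f r) hF (contDiff_phaseCutoff k) (phaseCutoff_flipAt k) z
  have hgenk (k r z) : |generator ω₀ γ T (f r) (Fk k) z| ≤ C₆ * (1 + sqNorm z) := by
    have hN := sqNorm_nonneg z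
    have a1 : |phaseCutoff k z * generator ω₀ γ T (f r) F z|
        ≤ (C₃ + |M| * C₄) * (1 + sqNorm z) := by
      rw [abs_mul]
      exact (mul_le_of_le_one_left (abs_nonneg _) (abs_phaseCutoff_le_one k z)).trans (hgen r z)
    have a2 : |F z * generator ω₀ γ T (f r) (phaseCutoff k) z|
        ≤ C₁ * C₅ * (1 + sqNorm z) := by
      rw [abs_mul, mul_right_comm]
      exact mul_le_mul (h1 z) ((h5 k z).2 _ (hM r)) (abs_nonneg _) (by positivity)
    -- The carré du champ term is split by `2ab ≤ a² + b²`; this is where the quadratic growth of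
    -- the square of the `p_0`-derivative of `F` enters.
    have a3 : |4 * γ * T * partialP 0 F z * partialP 0 (phaseCutoff k) z|
        ≤ |4 * γ * T| * (C₂ + C₅ ^ 2) * (1 + sqNorm z) := by
      rw [mul_assoc, abs_mul, mul_assoc |4 * γ * T|]
      refine mul_le_mul_of_nonneg_left ?_ (abs_nonneg _)
      have b1 : |partialP 0 F z ^ 2| ≤ C₂ * (1 + sqNorm z) := h2 z
      rw [abs_of_nonneg (sq_nonneg _), ← sq_abs] at b1
      have b2 := pow_le_pow_left₀ (abs_nonneg _) (h5 k z).1 2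
      rw [abs_mul]
      have b3 : C₅ ^ 2 ≤ C₅ ^ 2 * (1 + sqNorm z) :=
        le_mul_of_one_le_right (sq_nonneg _) (by linarith)
      nlinarith [sq_nonneg (|partialP 0 F z| - |partialP 0 (phaseCutoff k) z|),
        sq_nonneg |partialP 0 F z|, sq_nonneg |partialP 0 (phaseCutoff k) z|]
    rw [hmul]
    refine (abs_add_le _ _).trans ((add_le_add ((abs_add_le _ _).trans (add_le_add a1 a2)) a3).trans
      (le_of_eq ?_))
    rw [hC₆]
    ring
  have hbd (r) (hr : 0 ≤ r) : Integrable (fun z => C₆ * (1 + sqNorm z)) (μ r) := by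
    have := h.isProbabilityMeasure r hr
    exact ((integrable_const (1 : ℝ)).add (hB r hr).1).const_mul C₆
  have hlim (r) (hr : 0 ≤ r) :
      Tendsto (fun k => ∫ z, generator ω₀ γ T (f r) (Fk k) z ∂(μ r)) atTop
        (𝓝 (∫ z, generator ω₀ γ T (f r) F z ∂(μ r))) := by
    refine tendsto_integral_of_dominated_convergence _
      (fun k => (contDiff_generator _ _ _ _ (hFks k)).continuous.aestronglyMeasurable)
      (hbd r hr) (fun k => Eventually.of_forall fun z => hgenk k r z)
      (Eventually.of_forall fun z => ?_)
    refine tendsto_const_nhds.congr' ?_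
    filter_upwards [eventually_phaseCutoff ω₀ γ T (f r) z] with k hk
    rw [hmul, hk.1, hk.2.1, hk.2.2]
    ring
  have hlimF (r) (hr : 0 ≤ r) :
      Tendsto (fun k => ∫ z, Fk k z ∂(μ r)) atTop (𝓝 (∫ z, F z ∂(μ r))) := by
    have := h.isProbabilityMeasure r hr
    refine tendsto_integral_of_dominated_convergence (fun z => C₁ * (1 + sqNorm z))
      (fun k => (hFks k).continuous.aestronglyMeasurable)
      (((integrable_const (1 : ℝ)).add (hB r hr).1).const_mul C₁)
      (fun k => Eventually.of_forall fun z => ?_) (Eventually.of_forall fun z => ?_)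
    · rw [Real.norm_eq_abs, abs_mul]
      exact (mul_le_of_le_one_right (abs_nonneg _) (abs_phaseCutoff_le_one k z)).trans (h1 z)
    · refine tendsto_const_nhds.congr' ?_
      filter_upwards [eventually_phaseCutoff ω₀ γ T (f r) z] with k hk
      simp only [hFk, hk.1, mul_one]
  have hsub : Set.Ioc s t ⊆ Set.Ici 0 := fun r hr => hs.trans hr.1.le
  -- For compactly supported observables the mean of the generator is continuous in time;
  -- measurability for `F` itself is inherited in the limit.
  have hmeas (k) : AEStronglyMeasurable (fun r => ∫ z, generator ω₀ γ T (f r) (Fk k) z ∂(μ r))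
      (volume.restrict (Set.Ioc s t)) :=
    ((h.continuousOn_integral_generator hf (hFks k) (hFkc k)).mono hsub).aestronglyMeasurable
      measurableSet_Ioc
  have hbdt (r) (hr : 0 ≤ r) (k) :
      |∫ z, generator ω₀ γ T (f r) (Fk k) z ∂(μ r)| ≤ C₆ * (1 + B) := by
    have := h.isProbabilityMeasure r hr
    exact abs_integral_le_of_quadGrowth (hgenk k r) hC₆0 (hB r hr).1 (hB r hr).2
  have hae : ∀ᵐ r ∂(volume.restrict (Set.Ioc s t)),
      Tendsto (fun k => ∫ z, generator ω₀ γ T (f r) (Fk k) z ∂(μ r)) atTop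
        (𝓝 (∫ z, generator ω₀ γ T (f r) F z ∂(μ r))) :=
    (ae_restrict_mem measurableSet_Ioc).mono fun r hr => hlim r (hsub hr)
  have hint : IntervalIntegrable (fun r => ∫ z, generator ω₀ γ T (f r) F z ∂(μ r)) volume s t := by
    rw [intervalIntegrable_iff_integrableOn_Ioc_of_le hst]
    refine Integrable.of_bound (C := C₆ * (1 + B)) (aestronglyMeasurable_of_tendsto_ae _ hmeas hae) ?_
    refine (ae_restrict_mem measurableSet_Ioc).mono fun r hr => ?_
    exact le_of_tendsto (hlim r (hsub hr)).norm
      (Eventually.of_forall fun k => hbdt r (hsub hr) k)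
  refine ⟨hint, ?_⟩
  refine tendsto_nhds_unique ((hlimF t (hs.trans hst)).sub (hlimF s hs)) ?_
  simp only [h.integral_sub_integral hf (hFks _) (hFkc _) hs hst, intervalIntegral.integral_of_le hst]
  exact tendsto_integral_of_dominated_convergence (fun _ => C₆ * (1 + B)) hmeas
    (integrable_const _) (fun k => (ae_restrict_mem measurableSet_Ioc).mono fun r hr =>
      hbdt r (hsub hr) k) hae

/-- The integrated equation exhibits the mean as a primitive of an integrable function. Continuity
of the right-hand sides of the moment equations then upgrades them to genuine derivatives. -/
lemma continuousOn_integral_of_quadGrowth (h : IsPeriodicStationaryState ω₀ γ T f τ μ)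
    (hf : Continuous f) (hM : ∀ t, |f t| ≤ M)
    (hB : ∀ t, 0 ≤ t → Integrable (sqNorm : Phase n → ℝ) (μ t) ∧ ∫ z, sqNorm z ∂(μ t) ≤ B)
    {F : Phase n → ℝ} (hF : ContDiff ℝ ∞ F) (hFq : QuadGrowth F)
    (hp : QuadGrowth fun z => partialP 0 F z ^ 2) (hg : QuadGrowth (generator ω₀ γ T 0 F))
    (hl : QuadGrowth (partialP (Fin.last n) F)) :
    ContinuousOn (fun t => ∫ z, F z ∂(μ t)) (Set.Ici 0) := by
  intro t ht
  have hI := (h.integral_sub_integral_of_quadGrowth hf hM hB hF hFq hp hg hl le_rfl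
    (t := t + 1) (by linarith [ht.out])).1
  have hc : ContinuousOn (fun x => ∫ r in (0 : ℝ)..x, ∫ z, generator ω₀ γ T (f r) F z ∂(μ r))
      (Set.Icc 0 (t + 1)) := by
    have := intervalIntegral.continuousOn_primitive_interval' hI Set.left_mem_uIcc
    rwa [Set.uIcc_of_le (by linarith [ht.out])] at this
  have hc2 : ContinuousOn (fun t => ∫ z, F z ∂(μ t)) (Set.Icc 0 (t + 1)) := by
    refine (hc.add (continuousOn_const (c := ∫ z, F z ∂(μ 0)))).congr fun x hx => ?_
    have := (h.integral_sub_integral_of_quadGrowth hf hM hB hF hFq hp hg hl le_rfl hx.1).2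
    exact sub_eq_iff_eq_add.1 this
  have := hc2 t ⟨ht, by linarith⟩
  refine this.mono_of_mem_nhdsWithin ?_
  rw [← Set.Ici_inter_Iic]
  exact inter_mem self_mem_nhdsWithin (mem_nhdsWithin_of_mem_nhds (Iic_mem_nhds (by linarith)))

/-- The differential form of the forward equation for observables of quadratic growth. -/
lemma hasDerivWithinAt_of_quadGrowth (h : IsPeriodicStationaryState ω₀ γ T f τ μ)
    (hf : Continuous f) (hM : ∀ t, |f t| ≤ M)
    (hB : ∀ t, 0 ≤ t → Integrable (sqNorm : Phase n → ℝ) (μ t) ∧ ∫ z, sqNorm z ∂(μ t) ≤ B)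
    {F : Phase n → ℝ} (hF : ContDiff ℝ ∞ F) (hFq : QuadGrowth F)
    (hp : QuadGrowth fun z => partialP 0 F z ^ 2) (hg : QuadGrowth (generator ω₀ γ T 0 F))
    (hl : QuadGrowth (partialP (Fin.last n) F)) {g : ℝ → ℝ} (hgc : ContinuousOn g (Set.Ici 0))
    (hgeq : ∀ r, 0 ≤ r → ∫ z, generator ω₀ γ T (f r) F z ∂(μ r) = g r) {t : ℝ} (ht : 0 ≤ t) :
    HasDerivWithinAt (fun t => ∫ z, F z ∂(μ t)) (g t) (Set.Ici 0) t := by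
  -- A continuous extension to negative times lets the two-sided fundamental theorem of calculus
  -- apply at `t = 0` too.
  set G : ℝ → ℝ := fun r => g (max r 0) with hG
  have hGc : Continuous G :=
    hgc.comp_continuous (by fun_prop) fun r => Set.mem_Ici.2 (le_max_right _ _)
  have hd : HasDerivAt (fun x => ∫ r in (0 : ℝ)..x, G r) (G t) t :=
    (hGc.integral_hasStrictDerivAt 0 t).hasDerivAt
  have hGt : G t = g t := by simp [hG, ht]
  rw [hGt] at hd
  have heq : ∀ x ∈ Set.Ici (0 : ℝ), ∫ z, F z ∂(μ x)
      = (∫ r in (0 : ℝ)..x, G r) + ∫ z, F z ∂(μ 0) := by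
    intro x hx
    have := (h.integral_sub_integral_of_quadGrowth hf hM hB hF hFq hp hg hl le_rfl hx.out).2
    rw [← sub_eq_iff_eq_add, this]
    refine intervalIntegral.integral_congr fun r hr => ?_
    rw [Set.uIcc_of_le hx.out] at hr
    simp only [hG, max_eq_left hr.1]
    exact hgeq r hr.1
  exact (hd.hasDerivWithinAt.add_const _).congr heq (heq t ht)

end IsPeriodicStationaryState

/-! ### The equations of the first and second moments -/

/-- The mean position. -/
noncomputable def meanQ (μ : ℝ → Measure (Phase n)) (x : Fin (n + 1)) (t : ℝ) : ℝ :=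
  ∫ z, z.1 x ∂(μ t)

/-- The mean momentum. -/
noncomputable def meanP (μ : ℝ → Measure (Phase n)) (x : Fin (n + 1)) (t : ℝ) : ℝ :=
  ∫ z, z.2 x ∂(μ t)

/-- The second moments of the positions. -/
noncomputable def momentQQ (μ : ℝ → Measure (Phase n)) (x y : Fin (n + 1)) (t : ℝ) : ℝ :=
  ∫ z, z.1 x * z.1 y ∂(μ t)

/-- The mixed second moments. -/
noncomputable def momentQP (μ : ℝ → Measure (Phase n)) (x y : Fin (n + 1)) (t : ℝ) : ℝ :=
  ∫ z, z.1 x * z.2 y ∂(μ t)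

/-- The second moments of the momenta. -/
noncomputable def momentPP (μ : ℝ → Measure (Phase n)) (x y : Fin (n + 1)) (t : ℝ) : ℝ :=
  ∫ z, z.2 x * z.2 y ∂(μ t)

lemma quadGrowth_partialP_fst (y x : Fin (n + 1)) :
    QuadGrowth (partialP y fun z : Phase n => z.1 x) := by
  rw [partialP_fst_apply]
  exact .const 0

lemma quadGrowth_partialP_snd (y x : Fin (n + 1)) :
    QuadGrowth (partialP y fun z : Phase n => z.2 x) := by
  rw [partialP_snd_apply]
  exact .const _

lemma quadGrowth_partialP_fst_sq (y x : Fin (n + 1)) :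
    QuadGrowth fun z => partialP y (fun z : Phase n => z.1 x) z ^ 2 := by
  rw [partialP_fst_apply]
  exact .const _

lemma quadGrowth_partialP_snd_sq (y x : Fin (n + 1)) :
    QuadGrowth fun z => partialP y (fun z : Phase n => z.2 x) z ^ 2 := by
  rw [partialP_snd_apply]
  exact .const _

lemma quadGrowth_partialP_quadMonomial (y : Fin (n + 1)) (i : QuadIndex n) :
    QuadGrowth (partialP y fun z : Phase n => quadMonomial z i) :=
  .of_abs_le_sqrt 2 zero_le_two fun z => abs_partialP_quadMonomial_le y i z

lemma quadGrowth_partialP_quadMonomial_sq (y : Fin (n + 1)) (i : QuadIndex n) :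
    QuadGrowth fun z => partialP y (fun z : Phase n => quadMonomial z i) z ^ 2 := by
  refine ⟨4, by norm_num, fun z => ?_⟩
  rw [abs_pow]
  calc _ ≤ (2 * √(sqNorm z)) ^ 2 :=
        pow_le_pow_left₀ (abs_nonneg _) (abs_partialP_quadMonomial_le y i z) 2
    _ = 4 * sqNorm z := by rw [mul_pow, Real.sq_sqrt (sqNorm_nonneg z)]; norm_num
    _ ≤ 4 * (1 + sqNorm z) := by linarith

/-- `F` is integrable with mean `m`. -/
def HasMean (ν : Measure (Phase n)) (F : Phase n → ℝ) (m : ℝ) : Prop :=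
  Integrable F ν ∧ ∫ z, F z ∂ν = m

namespace HasMean

variable {ν : Measure (Phase n)} {F G : Phase n → ℝ} {a b : ℝ}

lemma add (hF : HasMean ν F a) (hG : HasMean ν G b) : HasMean ν (fun z => F z + G z) (a + b) :=
  ⟨hF.1.add hG.1, by rw [integral_add hF.1 hG.1, hF.2, hG.2]⟩

lemma const_mul (hF : HasMean ν F a) (c : ℝ) : HasMean ν (fun z => c * F z) (c * a) :=
  ⟨hF.1.const_mul c, by rw [integral_const_mul, hF.2]⟩

lemma const [IsProbabilityMeasure ν] (c : ℝ) : HasMean ν (fun _ => c) c :=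
  ⟨integrable_const c, by simp⟩

lemma sum {ι : Type*} (s : Finset ι) {F : ι → Phase n → ℝ} {a : ι → ℝ}
    (hF : ∀ i, HasMean ν (F i) (a i)) : HasMean ν (fun z => ∑ i ∈ s, F i z) (∑ i ∈ s, a i) :=
  ⟨integrable_finsetSum _ fun i _ => (hF i).1, by
    rw [integral_finsetSum _ fun i _ => (hF i).1]
    exact Finset.sum_congr rfl fun i _ => (hF i).2⟩

end HasMean

/-- A periodic stationary state with second moments bounded by `B`, under a force bounded
by `M`. -/
structure HasBoundedMoments (ω₀ γ T : ℝ) (f : ℝ → ℝ) (τ : ℝ) (μ : ℝ → Measure (Phase n))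
    (B M : ℝ) : Prop where
  state : IsPeriodicStationaryState ω₀ γ T f τ μ
  continuous_force : Continuous f
  abs_force_le : ∀ t, |f t| ≤ M
  moments : ∀ t, 0 ≤ t → Integrable (sqNorm : Phase n → ℝ) (μ t) ∧ ∫ z, sqNorm z ∂(μ t) ≤ B

namespace HasBoundedMoments

variable {ω₀ γ T τ : ℝ} {f : ℝ → ℝ} {μ : ℝ → Measure (Phase n)} {B M : ℝ}

lemma integrable (h : HasBoundedMoments ω₀ γ T f τ μ B M) {F : Phase n → ℝ}
    (hF : QuadGrowth F) (hc : ContDiff ℝ ∞ F) {t : ℝ} (ht : 0 ≤ t) : Integrable F (μ t) := by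
  have := h.state.isProbabilityMeasure t ht
  exact hF.integrable hc.continuous (h.moments t ht).1

lemma hasMean_fst (h : HasBoundedMoments ω₀ γ T f τ μ B M) {t : ℝ} (ht : 0 ≤ t)
    (x : Fin (n + 1)) : HasMean (μ t) (fun z => z.1 x) (meanQ μ x t) :=
  ⟨h.integrable (.fst_apply x) (contDiff_fst_apply x) ht, rfl⟩

lemma hasMean_snd (h : HasBoundedMoments ω₀ γ T f τ μ B M) {t : ℝ} (ht : 0 ≤ t)
    (x : Fin (n + 1)) : HasMean (μ t) (fun z => z.2 x) (meanP μ x t) :=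
  ⟨h.integrable (.snd_apply x) (contDiff_snd_apply x) ht, rfl⟩

lemma hasMean_fst_mul_fst (h : HasBoundedMoments ω₀ γ T f τ μ B M) {t : ℝ} (ht : 0 ≤ t)
    (x y : Fin (n + 1)) : HasMean (μ t) (fun z => z.1 x * z.1 y) (momentQQ μ x y t) :=
  ⟨h.integrable (.fst_mul_fst x y) (contDiff_quadMonomial (.inl (x, y))) ht, rfl⟩

lemma hasMean_fst_mul_snd (h : HasBoundedMoments ω₀ γ T f τ μ B M) {t : ℝ} (ht : 0 ≤ t)
    (x y : Fin (n + 1)) : HasMean (μ t) (fun z => z.1 x * z.2 y) (momentQP μ x y t) :=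
  ⟨h.integrable (.fst_mul_snd x y) (contDiff_quadMonomial (.inr (.inl (x, y)))) ht, rfl⟩

lemma hasMean_snd_mul_snd (h : HasBoundedMoments ω₀ γ T f τ μ B M) {t : ℝ} (ht : 0 ≤ t)
    (x y : Fin (n + 1)) : HasMean (μ t) (fun z => z.2 x * z.2 y) (momentPP μ x y t) :=
  ⟨h.integrable (.snd_mul_snd x y) (contDiff_quadMonomial (.inr (.inr (x, y)))) ht, rfl⟩

lemma continuousOn_meanQ (h : HasBoundedMoments ω₀ γ T f τ μ B M) (x : Fin (n + 1)) :
    ContinuousOn (meanQ μ x) (Set.Ici 0) :=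
  h.state.continuousOn_integral_of_quadGrowth h.continuous_force h.abs_force_le h.moments
    (contDiff_fst_apply x) (.fst_apply x) (quadGrowth_partialP_fst_sq 0 x)
    (quadGrowth_generator_fst ω₀ γ T x) (quadGrowth_partialP_fst _ x)

lemma continuousOn_meanP (h : HasBoundedMoments ω₀ γ T f τ μ B M) (x : Fin (n + 1)) :
    ContinuousOn (meanP μ x) (Set.Ici 0) :=
  h.state.continuousOn_integral_of_quadGrowth h.continuous_force h.abs_force_le h.moments
    (contDiff_snd_apply x) (.snd_apply x) (quadGrowth_partialP_snd_sq 0 x)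
    (quadGrowth_generator_snd ω₀ γ T x) (quadGrowth_partialP_snd _ x)

lemma continuousOn_quadMonomial (h : HasBoundedMoments ω₀ γ T f τ μ B M) (i : QuadIndex n) :
    ContinuousOn (fun t => ∫ z, quadMonomial z i ∂(μ t)) (Set.Ici 0) :=
  h.state.continuousOn_integral_of_quadGrowth h.continuous_force h.abs_force_le h.moments
    (contDiff_quadMonomial i) (.quadMonomial i) (quadGrowth_partialP_quadMonomial_sq 0 i)
    (quadGrowth_generator_quadMonomial ω₀ γ T i) (quadGrowth_partialP_quadMonomial _ i)

lemma continuousOn_momentQQ (h : HasBoundedMoments ω₀ γ T f τ μ B M) (x y : Fin (n + 1)) :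
    ContinuousOn (momentQQ μ x y) (Set.Ici 0) := h.continuousOn_quadMonomial (.inl (x, y))

lemma continuousOn_momentQP (h : HasBoundedMoments ω₀ γ T f τ μ B M) (x y : Fin (n + 1)) :
    ContinuousOn (momentQP μ x y) (Set.Ici 0) := h.continuousOn_quadMonomial (.inr (.inl (x, y)))

lemma continuousOn_momentPP (h : HasBoundedMoments ω₀ γ T f τ μ B M) (x y : Fin (n + 1)) :
    ContinuousOn (momentPP μ x y) (Set.Ici 0) := h.continuousOn_quadMonomial (.inr (.inr (x, y)))

lemma hasDerivWithinAt_meanQ (h : HasBoundedMoments ω₀ γ T f τ μ B M) (x : Fin (n + 1)) {t : ℝ}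
    (ht : 0 ≤ t) : HasDerivWithinAt (meanQ μ x) (meanP μ x t) (Set.Ici 0) t :=
  h.state.hasDerivWithinAt_of_quadGrowth h.continuous_force h.abs_force_le h.moments
    (contDiff_fst_apply x) (.fst_apply x) (quadGrowth_partialP_fst_sq 0 x)
    (quadGrowth_generator_fst ω₀ γ T x) (quadGrowth_partialP_fst _ x) (h.continuousOn_meanP x)
    (fun r _ => by simp only [generator_fst_apply]; rfl) ht

/-- The mean acceleration. -/
noncomputable def meanAccel (ω₀ γ : ℝ) (f : ℝ → ℝ) (μ : ℝ → Measure (Phase n)) (x : Fin (n + 1))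
    (t : ℝ) : ℝ :=
  ∑ y, -stiffness n ω₀ x y * meanQ μ y t + (if x = Fin.last n then f t else 0)
    + -(2 * γ) * meanP μ x t

lemma continuousOn_ite_force (h : HasBoundedMoments ω₀ γ T f τ μ B M) (x : Fin (n + 1)) :
    ContinuousOn (fun t => if x = Fin.last n then f t else 0) (Set.Ici 0) := by
  split_ifs
  · exact h.continuous_force.continuousOn
  · exact continuousOn_const

lemma hasDerivWithinAt_meanP (h : HasBoundedMoments ω₀ γ T f τ μ B M) (x : Fin (n + 1)) {t : ℝ}
    (ht : 0 ≤ t) :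
    HasDerivWithinAt (meanP μ x) (meanAccel ω₀ γ f μ x t) (Set.Ici 0) t := by
  refine h.state.hasDerivWithinAt_of_quadGrowth h.continuous_force h.abs_force_le h.moments
    (contDiff_snd_apply x) (.snd_apply x) (quadGrowth_partialP_snd_sq 0 x)
    (quadGrowth_generator_snd ω₀ γ T x) (quadGrowth_partialP_snd _ x) (g := meanAccel ω₀ γ f μ x)
    ?_ (fun r hr => ?_) ht
  · exact ((continuousOn_finsetSum _ fun y _ => continuousOn_const.mul
      (h.continuousOn_meanQ y)).add (h.continuousOn_ite_force x)).add
      (continuousOn_const.mul (h.continuousOn_meanP x))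
  · have := h.state.isProbabilityMeasure r hr
    have e (z : Phase n) : generator ω₀ γ T (f r) (fun z => z.2 x) z
        = (∑ y, -stiffness n ω₀ x y * z.1 y) + (if x = Fin.last n then f r else 0)
          + -(2 * γ) * z.2 x := by
      rw [generator_snd_apply, accel_eq]
      simp only [neg_mul, Finset.sum_neg_distrib]
      ring
    simp only [e]
    exact (((HasMean.sum _ fun y => (h.hasMean_fst hr y).const_mul _).add (.const _)).add
      ((h.hasMean_snd hr x).const_mul _)).2

lemma hasDerivWithinAt_momentQQ (h : HasBoundedMoments ω₀ γ T f τ μ B M) (x y : Fin (n + 1))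
    {t : ℝ} (ht : 0 ≤ t) : HasDerivWithinAt (momentQQ μ x y)
      (momentQP μ y x t + momentQP μ x y t) (Set.Ici 0) t := by
  refine h.state.hasDerivWithinAt_of_quadGrowth h.continuous_force h.abs_force_le h.moments
    (contDiff_quadMonomial (.inl (x, y))) (.quadMonomial (.inl (x, y)))
    (quadGrowth_partialP_quadMonomial_sq 0 (.inl (x, y)))
    (quadGrowth_generator_quadMonomial ω₀ γ T (.inl (x, y)))
    (quadGrowth_partialP_quadMonomial _ (.inl (x, y)))
    (g := fun t => momentQP μ y x t + momentQP μ x y t)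
    ((h.continuousOn_momentQP y x).add (h.continuousOn_momentQP x y)) (fun r hr => ?_) ht
  have e (z : Phase n) : generator ω₀ γ T (f r) (fun z => quadMonomial z (.inl (x, y))) z
      = z.1 y * z.2 x + z.1 x * z.2 y := by
    simp only [quadMonomial]
    rw [generator_fst_mul_fst]
    ring
  simp only [e]
  exact ((h.hasMean_fst_mul_snd hr y x).add (h.hasMean_fst_mul_snd hr x y)).2

lemma hasDerivWithinAt_momentQP (h : HasBoundedMoments ω₀ γ T f τ μ B M) (x y : Fin (n + 1))
    {t : ℝ} (ht : 0 ≤ t) : HasDerivWithinAt (momentQP μ x y)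
      (momentPP μ x y t + ∑ w, -stiffness n ω₀ y w * momentQQ μ w x t
        + (if y = Fin.last n then f t else 0) * meanQ μ x t + -(2 * γ) * momentQP μ x y t)
      (Set.Ici 0) t := by
  refine h.state.hasDerivWithinAt_of_quadGrowth h.continuous_force h.abs_force_le h.moments
    (contDiff_quadMonomial (.inr (.inl (x, y)))) (.quadMonomial (.inr (.inl (x, y))))
    (quadGrowth_partialP_quadMonomial_sq 0 (.inr (.inl (x, y))))
    (quadGrowth_generator_quadMonomial ω₀ γ T (.inr (.inl (x, y))))
    (quadGrowth_partialP_quadMonomial _ (.inr (.inl (x, y))))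
    (g := fun t => momentPP μ x y t + ∑ w, -stiffness n ω₀ y w * momentQQ μ w x t
        + (if y = Fin.last n then f t else 0) * meanQ μ x t + -(2 * γ) * momentQP μ x y t)
    ?_ (fun r hr => ?_) ht
  · exact (((h.continuousOn_momentPP x y).add (continuousOn_finsetSum _ fun w _ =>
      continuousOn_const.mul (h.continuousOn_momentQQ w x))).add
      ((h.continuousOn_ite_force y).mul (h.continuousOn_meanQ x))).add
      (continuousOn_const.mul (h.continuousOn_momentQP x y))
  · have e (z : Phase n) : generator ω₀ γ T (f r) (fun z => quadMonomial z (.inr (.inl (x, y)))) z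
        = z.2 x * z.2 y + (∑ w, -stiffness n ω₀ y w * (z.1 w * z.1 x))
          + (if y = Fin.last n then f r else 0) * z.1 x + -(2 * γ) * (z.1 x * z.2 y) := by
      simp only [quadMonomial]
      rw [generator_fst_mul_snd, mul_accel]
      ring
    simp only [e]
    exact ((((h.hasMean_snd_mul_snd hr x y).add
      (.sum _ fun w => (h.hasMean_fst_mul_fst hr w x).const_mul _)).add
      ((h.hasMean_fst hr x).const_mul _)).add ((h.hasMean_fst_mul_snd hr x y).const_mul _)).2

lemma hasDerivWithinAt_momentPP (h : HasBoundedMoments ω₀ γ T f τ μ B M) (x y : Fin (n + 1))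
    {t : ℝ} (ht : 0 ≤ t) : HasDerivWithinAt (momentPP μ x y)
      (∑ w, -stiffness n ω₀ x w * momentQP μ w y t + (if x = Fin.last n then f t else 0) * meanP μ y t
        + (∑ w, -stiffness n ω₀ y w * momentQP μ w x t
          + (if y = Fin.last n then f t else 0) * meanP μ x t) + -(4 * γ) * momentPP μ x y t
        + if x = y then 4 * γ * (if x = 0 then T else momentPP μ x x t) else 0)
      (Set.Ici 0) t := by
  refine h.state.hasDerivWithinAt_of_quadGrowth h.continuous_force h.abs_force_le h.moments
    (contDiff_quadMonomial (.inr (.inr (x, y)))) (.quadMonomial (.inr (.inr (x, y))))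
    (quadGrowth_partialP_quadMonomial_sq 0 (.inr (.inr (x, y))))
    (quadGrowth_generator_quadMonomial ω₀ γ T (.inr (.inr (x, y))))
    (quadGrowth_partialP_quadMonomial _ (.inr (.inr (x, y))))
    (g := fun t => ∑ w, -stiffness n ω₀ x w * momentQP μ w y t
        + (if x = Fin.last n then f t else 0) * meanP μ y t
        + (∑ w, -stiffness n ω₀ y w * momentQP μ w x t
          + (if y = Fin.last n then f t else 0) * meanP μ x t) + -(4 * γ) * momentPP μ x y t
        + if x = y then 4 * γ * (if x = 0 then T else momentPP μ x x t) else 0)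
    ?_ (fun r hr => ?_) ht
  · have c1 (x y : Fin (n + 1)) : ContinuousOn (fun t => ∑ w, -stiffness n ω₀ x w * momentQP μ w y t
        + (if x = Fin.last n then f t else 0) * meanP μ y t) (Set.Ici 0) :=
      (continuousOn_finsetSum _ fun w _ =>
        continuousOn_const.mul (h.continuousOn_momentQP w y)).add
        ((h.continuousOn_ite_force x).mul (h.continuousOn_meanP y))
    refine (((c1 x y).add (c1 y x)).add
      (continuousOn_const.mul (h.continuousOn_momentPP x y))).add ?_
    split_ifs
    · exact continuousOn_const
    · exact continuousOn_const.mul (h.continuousOn_momentPP x x)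
    · exact continuousOn_const
  · have := h.state.isProbabilityMeasure r hr
    have e (z : Phase n) : generator ω₀ γ T (f r) (fun z => quadMonomial z (.inr (.inr (x, y)))) z
        = (∑ w, -stiffness n ω₀ x w * (z.1 w * z.2 y)) + (if x = Fin.last n then f r else 0) * z.2 y
          + ((∑ w, -stiffness n ω₀ y w * (z.1 w * z.2 x))
            + (if y = Fin.last n then f r else 0) * z.2 x) + -(4 * γ) * (z.2 x * z.2 y)
          + if x = y then 4 * γ * (if x = 0 then T else z.2 x * z.2 x) else 0 := by
      simp only [quadMonomial]
      rw [generator_snd_mul_snd, mul_accel, mul_comm (accel ω₀ (f r) z.1 x), mul_accel, sq]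
      ring
    have i1 (x y : Fin (n + 1)) := (HasMean.sum Finset.univ fun w =>
      (h.hasMean_fst_mul_snd hr w y).const_mul (-stiffness n ω₀ x w)).add
      ((h.hasMean_snd hr y).const_mul (if x = Fin.last n then f r else 0))
    have i2 : HasMean (μ r)
        (fun z => if x = y then 4 * γ * (if x = 0 then T else z.2 x * z.2 x) else 0)
        (if x = y then 4 * γ * (if x = 0 then T else momentPP μ x x r) else 0) := by
      split_ifs
      · exact .const _
      · exact (h.hasMean_snd_mul_snd hr x x).const_mul _
      · exact .const _
    simp only [e]
    exact ((((i1 x y).add (i1 y x)).add ((h.hasMean_snd_mul_snd hr x y).const_mul _)).add i2).2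

end HasBoundedMoments

/-! ### Averages over a period -/

/-- `g` is continuous on `[0, ∞)`, with average `m` over the period `[0, τ]`. -/
def HasAverage (τ : ℝ) (g : ℝ → ℝ) (m : ℝ) : Prop :=
  ContinuousOn g (Set.Ici 0) ∧ τ⁻¹ * ∫ t in (0 : ℝ)..τ, g t = m

lemma intervalIntegrable_of_continuousOn_Ici {g : ℝ → ℝ} (hg : ContinuousOn g (Set.Ici 0)) {τ : ℝ}
    (hτ : 0 ≤ τ) : IntervalIntegrable g volume 0 τ := by
  refine (hg.mono ?_).intervalIntegrable
  rw [Set.uIcc_of_le hτ]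
  exact fun t ht => ht.1

namespace HasAverage

variable {τ : ℝ} {g k : ℝ → ℝ} {a b : ℝ}

lemma of_continuousOn (hg : ContinuousOn g (Set.Ici 0)) :
    HasAverage τ g (τ⁻¹ * ∫ t in (0 : ℝ)..τ, g t) := ⟨hg, rfl⟩

lemma unique (h : HasAverage τ g a) (h' : HasAverage τ g b) : a = b := h.2.symm.trans h'.2

lemma add (hτ : 0 < τ) (hg : HasAverage τ g a) (hk : HasAverage τ k b) :
    HasAverage τ (fun t => g t + k t) (a + b) := by
  refine ⟨hg.1.add hk.1, ?_⟩
  rw [intervalIntegral.integral_add (intervalIntegrable_of_continuousOn_Ici hg.1 hτ.le)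
    (intervalIntegrable_of_continuousOn_Ici hk.1 hτ.le), mul_add, hg.2, hk.2]

lemma const_mul (hg : HasAverage τ g a) (c : ℝ) : HasAverage τ (fun t => c * g t) (c * a) := by
  refine ⟨continuousOn_const.mul hg.1, ?_⟩
  rw [intervalIntegral.integral_const_mul, mul_left_comm, hg.2]

lemma const (hτ : 0 < τ) (c : ℝ) : HasAverage τ (fun _ => c) c := by
  refine ⟨continuousOn_const, ?_⟩
  rw [intervalIntegral.integral_const, smul_eq_mul, sub_zero, ← mul_assoc,
    inv_mul_cancel₀ hτ.ne', one_mul]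

lemma sum (hτ : 0 < τ) {ι : Type*} (s : Finset ι) {g : ι → ℝ → ℝ} {a : ι → ℝ}
    (hg : ∀ i, HasAverage τ (g i) (a i)) :
    HasAverage τ (fun t => ∑ i ∈ s, g i t) (∑ i ∈ s, a i) := by
  classical
  induction s using Finset.induction_on with
  | empty => simpa using HasAverage.const hτ 0
  | insert i s his ih =>
    simp only [Finset.sum_insert his]
    exact (hg i).add hτ ih

lemma mono (hτ : 0 < τ) (hg : HasAverage τ g a) (hk : HasAverage τ k b)
    (h : ∀ t, 0 ≤ t → g t ≤ k t) : a ≤ b := by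
  rw [← hg.2, ← hk.2]
  exact mul_le_mul_of_nonneg_left (intervalIntegral.integral_mono_on hτ.le
    (intervalIntegrable_of_continuousOn_Ici hg.1 hτ.le)
    (intervalIntegrable_of_continuousOn_Ici hk.1 hτ.le) fun t ht => h t ht.1) (by positivity)

/-- The derivative of a periodic function has average zero. -/
lemma of_hasDerivWithinAt (hτ : 0 < τ) (hd : ∀ t, 0 ≤ t → HasDerivWithinAt k (g t) (Set.Ici 0) t)
    (hg : HasAverage τ g a) (hper : k τ = k 0) : a = 0 := by
  rw [← hg.2, intervalIntegral.integral_eq_sub_of_hasDerivAt_of_le hτ.le (f := k)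
    (fun t ht => ((hd t ht.1).continuousWithinAt.mono fun s hs => hs.1))
    (fun t ht => (hd t ht.1.le).hasDerivAt (Ici_mem_nhds ht.1))
    (intervalIntegrable_of_continuousOn_Ici hg.1 hτ.le), hper, sub_self, mul_zero]

end HasAverage

/-! ### The mean motion -/

lemma sum_mul_stiffness_comm (ω₀ : ℝ) (u v : Fin (n + 1) → ℝ) :
    ∑ x, u x * ∑ y, stiffness n ω₀ x y * v y = ∑ x, v x * ∑ y, stiffness n ω₀ x y * u y := by
  simp only [Finset.mul_sum]
  rw [Finset.sum_comm]
  refine Finset.sum_congr rfl fun x _ => Finset.sum_congr rfl fun y _ => ?_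
  rw [stiffness_symm]
  ring

/-- The damped chain driven by the derivative of the force: the velocities are bounded by the
force in mean square, uniformly in the length of the chain. -/
lemma average_sq_velocity_le {ω₀ γ τ : ℝ} (hω₀ : 0 < ω₀) (hγ : 0 < γ) (hτ : 0 < τ)
    {p r : Fin (n + 1) → ℝ → ℝ} {φ : ℝ → ℝ} (hφ : ContinuousOn φ (Set.Ici 0))
    (hp : ∀ x t, 0 ≤ t → HasDerivWithinAt (p x) (r x t) (Set.Ici 0) t)
    (hr : ∀ x t, 0 ≤ t → HasDerivWithinAt (r x) (∑ y, -stiffness n ω₀ x y * p y t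
      + (if x = Fin.last n then φ t else 0) + -(2 * γ) * r x t) (Set.Ici 0) t)
    (hpτ : ∀ x, p x τ = p x 0) (hrτ : ∀ x, r x τ = r x 0) {W Φ : ℝ}
    (hW : HasAverage τ (fun t => ∑ x, p x t ^ 2) W) (hΦ : HasAverage τ (fun t => φ t ^ 2) Φ) :
    W ≤ (1 / (2 * γ ^ 2 * ω₀ ^ 2) + 1 / ω₀ ^ 4) * Φ := by
  have hpc (x) : ContinuousOn (p x) (Set.Ici 0) := fun t ht => (hp x t ht).continuousWithinAt
  have hrc (x) : ContinuousOn (r x) (Set.Ici 0) := fun t ht => (hr x t ht).continuousWithinAt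
  set a : Fin (n + 1) → ℝ → ℝ := fun x t => ∑ y, stiffness n ω₀ x y * p y t with ha
  have hac (x) : ContinuousOn (a x) (Set.Ici 0) :=
    continuousOn_finsetSum _ fun y _ => continuousOn_const.mul (hpc y)
  -- The energy alone dissipates only `r`. Adding `⟨p, r⟩` produces the dissipation `⟨p, Ap⟩` at the
  -- price of `|r|²`, which the weight `1/(2γ)` on the energy compensates; `γ|p|²` cancels the
  -- friction cross term.
  set E : ℝ → ℝ := fun t => 1 / (2 * γ) * (∑ x, r x t ^ 2 + ∑ x, p x t * a x t)
    + ∑ x, p x t * r x t + γ * ∑ x, p x t ^ 2 with hE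
  set E' : ℝ → ℝ := fun t => 1 / γ * (φ t * r (Fin.last n) t) - ∑ x, r x t ^ 2
    - ∑ x, p x t * a x t + φ t * p (Fin.last n) t with hE'
  have hE'c : ContinuousOn E' (Set.Ici 0) :=
    (((continuousOn_const.mul (hφ.mul (hrc _))).sub
      (continuousOn_finsetSum _ fun x _ => (hrc x).pow 2)).sub
      (continuousOn_finsetSum _ fun x _ => (hpc x).mul (hac x))).add (hφ.mul (hpc _))
  have hEd (t : ℝ) (ht : 0 ≤ t) : HasDerivWithinAt E (E' t) (Set.Ici 0) t := by
    have d1 (x) : HasDerivWithinAt (a x) (∑ y, stiffness n ω₀ x y * r y t) (Set.Ici 0) t :=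
      HasDerivWithinAt.fun_sum fun y _ => (hp y t ht).const_mul _
    have d2 := ((HasDerivWithinAt.fun_sum (u := Finset.univ) fun x _ => (hr x t ht).fun_pow 2).fun_add
      (HasDerivWithinAt.fun_sum (u := Finset.univ) fun x _ => (hp x t ht).fun_mul (d1 x))).const_mul
      (1 / (2 * γ))
    have d3 := HasDerivWithinAt.fun_sum (u := Finset.univ) fun x _ => (hp x t ht).fun_mul (hr x t ht)
    have d4 := (HasDerivWithinAt.fun_sum (u := Finset.univ) fun x _ => (hp x t ht).fun_pow 2).const_mul γ
    refine ((d2.fun_add d3).fun_add d4).congr_deriv ?_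
    have e0 (x) : ∑ y, -stiffness n ω₀ x y * p y t = -a x t := by
      simp [ha, Finset.sum_neg_distrib]
    have e1 : ∑ x, p x t * ∑ y, stiffness n ω₀ x y * r y t = ∑ x, r x t * a x t :=
      sum_mul_stiffness_comm ω₀ (fun x => p x t) fun x => r x t
    have e2 (u : Fin (n + 1) → ℝ) : ∑ x, u x * (-a x t + (if x = Fin.last n then φ t else 0)
        + -(2 * γ) * r x t) = -∑ x, u x * a x t + φ t * u (Fin.last n) - 2 * γ * ∑ x, u x * r x t := by
      simp only [mul_add, Finset.sum_add_distrib, mul_ite, mul_zero, Finset.sum_ite_eq',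
        Finset.mem_univ, if_true, mul_neg, Finset.sum_neg_distrib, Finset.mul_sum]
      have : ∑ x, u x * (-(2 * γ) * r x t) = -∑ x, 2 * γ * (u x * r x t) := by
        rw [← Finset.sum_neg_distrib]
        exact Finset.sum_congr rfl fun x _ => by ring
      rw [this]
      ring
    have e3 : ∑ x, ((2 : ℕ) : ℝ) * r x t ^ (2 - 1) * (∑ y, -stiffness n ω₀ x y * p y t
        + (if x = Fin.last n then φ t else 0) + -(2 * γ) * r x t)
        = 2 * (-∑ x, r x t * a x t + φ t * r (Fin.last n) t - 2 * γ * ∑ x, r x t * r x t) := by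
      rw [← e2, Finset.mul_sum]
      refine Finset.sum_congr rfl fun x _ => ?_
      rw [e0]
      norm_num
      ring
    have e4 : ∑ x, ((2 : ℕ) : ℝ) * p x t ^ (2 - 1) * r x t = 2 * ∑ x, p x t * r x t := by
      rw [Finset.mul_sum]
      refine Finset.sum_congr rfl fun x _ => ?_
      norm_num
      ring
    rw [e3, e4, Finset.sum_add_distrib, Finset.sum_add_distrib, e1]
    simp only [e0]
    rw [e2, hE']
    have e5 : ∑ x, r x t ^ 2 = ∑ x, r x t * r x t := Finset.sum_congr rfl fun x _ => by ring
    simp only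
    rw [e5]
    field_simp
    ring
  have hEτ : E τ = E 0 := by simp only [hE, ha, hpτ, hrτ]
  have h0 := HasAverage.of_hasDerivWithinAt hτ hEd (.of_continuousOn hE'c) hEτ
  -- The spectral gap gives `⟨p, Ap⟩ ≥ ω₀²|p|²`. Young's inequality absorbs the `r`-term of the
  -- force into `|r|²` and its `p`-term into half of the gap.
  have hle := HasAverage.mono hτ (.of_continuousOn hE'c) ((hW.const_mul (-(ω₀ ^ 2 / 2))).add hτ
    (hΦ.const_mul (1 / (4 * γ ^ 2) + 1 / (2 * ω₀ ^ 2)))) fun t _ => ?_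
  · rw [h0] at hle
    have h1 : ω₀ ^ 2 / 2 * W ≤ ω₀ ^ 2 / 2 * ((1 / (2 * γ ^ 2 * ω₀ ^ 2) + 1 / ω₀ ^ 4) * Φ) := by
      have e : ω₀ ^ 2 / 2 * ((1 / (2 * γ ^ 2 * ω₀ ^ 2) + 1 / ω₀ ^ 4) * Φ)
          = (1 / (4 * γ ^ 2) + 1 / (2 * ω₀ ^ 2)) * Φ := by
        field_simp
        ring
      rw [e]
      linarith
    exact le_of_mul_le_mul_left h1 (by positivity)
  · have b1 := sum_mul_stiffness_ge ω₀ fun x => p x t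
    have b2 : r (Fin.last n) t ^ 2 ≤ ∑ x, r x t ^ 2 :=
      Finset.single_le_sum (f := fun x => r x t ^ 2) (fun _ _ => sq_nonneg _) (Finset.mem_univ _)
    have b3 : p (Fin.last n) t ^ 2 ≤ ∑ x, p x t ^ 2 :=
      Finset.single_le_sum (f := fun x => p x t ^ 2) (fun _ _ => sq_nonneg _) (Finset.mem_univ _)
    have b4 : 1 / γ * (φ t * r (Fin.last n) t)
        ≤ r (Fin.last n) t ^ 2 + 1 / (4 * γ ^ 2) * φ t ^ 2 := by
      have : r (Fin.last n) t ^ 2 + 1 / (4 * γ ^ 2) * φ t ^ 2 - 1 / γ * (φ t * r (Fin.last n) t)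
          = (r (Fin.last n) t - φ t / (2 * γ)) ^ 2 := by
        field_simp
        ring
      have := sq_nonneg (r (Fin.last n) t - φ t / (2 * γ))
      linarith
    have b5 : φ t * p (Fin.last n) t
        ≤ ω₀ ^ 2 / 2 * p (Fin.last n) t ^ 2 + 1 / (2 * ω₀ ^ 2) * φ t ^ 2 := by
      have : ω₀ ^ 2 / 2 * p (Fin.last n) t ^ 2 + 1 / (2 * ω₀ ^ 2) * φ t ^ 2
          - φ t * p (Fin.last n) t = (ω₀ * p (Fin.last n) t - φ t / ω₀) ^ 2 / 2 := by
        field_simp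
        ring
      have := sq_nonneg (ω₀ * p (Fin.last n) t - φ t / ω₀)
      linarith
    have b6 := mul_le_mul_of_nonneg_left b3 (by positivity : 0 ≤ ω₀ ^ 2 / 2)
    simp only [hE', ha]
    linarith

/-! ### The covariances -/

/-- The covariances of the positions. -/
noncomputable def covQQ (μ : ℝ → Measure (Phase n)) (x y : Fin (n + 1)) (t : ℝ) : ℝ :=
  momentQQ μ x y t - meanQ μ x t * meanQ μ y t

/-- The covariances of the positions and the momenta. -/
noncomputable def covQP (μ : ℝ → Measure (Phase n)) (x y : Fin (n + 1)) (t : ℝ) : ℝ :=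
  momentQP μ x y t - meanQ μ x t * meanP μ y t

/-- The covariances of the momenta. -/
noncomputable def covPP (μ : ℝ → Measure (Phase n)) (x y : Fin (n + 1)) (t : ℝ) : ℝ :=
  momentPP μ x y t - meanP μ x t * meanP μ y t

lemma momentQQ_symm (μ : ℝ → Measure (Phase n)) (x y : Fin (n + 1)) :
    momentQQ μ x y = momentQQ μ y x := by
  ext t
  simp only [momentQQ, mul_comm]

lemma momentPP_symm (μ : ℝ → Measure (Phase n)) (x y : Fin (n + 1)) :
    momentPP μ x y = momentPP μ y x := by
  ext t
  simp only [momentPP, mul_comm]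

lemma covQQ_symm (μ : ℝ → Measure (Phase n)) (x y : Fin (n + 1)) : covQQ μ x y = covQQ μ y x := by
  ext t
  rw [covQQ, covQQ, momentQQ_symm, mul_comm]

lemma covPP_symm (μ : ℝ → Measure (Phase n)) (x y : Fin (n + 1)) : covPP μ x y = covPP μ y x := by
  ext t
  rw [covPP, covPP, momentPP_symm, mul_comm]

/-- The source of the covariance equations: the temperature profile, where the particle `0` has
the temperature of the thermostat. -/
noncomputable def sourceProfile (T : ℝ) (μ : ℝ → Measure (Phase n)) (x : Fin (n + 1)) (t : ℝ) : ℝ :=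
  if x = 0 then T else momentPP μ x x t

namespace HasBoundedMoments

variable {ω₀ γ T τ : ℝ} {f : ℝ → ℝ} {μ : ℝ → Measure (Phase n)} {B M : ℝ}

lemma continuousOn_covQQ (h : HasBoundedMoments ω₀ γ T f τ μ B M) (x y : Fin (n + 1)) :
    ContinuousOn (covQQ μ x y) (Set.Ici 0) :=
  (h.continuousOn_momentQQ x y).sub ((h.continuousOn_meanQ x).mul (h.continuousOn_meanQ y))

lemma continuousOn_covQP (h : HasBoundedMoments ω₀ γ T f τ μ B M) (x y : Fin (n + 1)) :
    ContinuousOn (covQP μ x y) (Set.Ici 0) :=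
  (h.continuousOn_momentQP x y).sub ((h.continuousOn_meanQ x).mul (h.continuousOn_meanP y))

lemma continuousOn_covPP (h : HasBoundedMoments ω₀ γ T f τ μ B M) (x y : Fin (n + 1)) :
    ContinuousOn (covPP μ x y) (Set.Ici 0) :=
  (h.continuousOn_momentPP x y).sub ((h.continuousOn_meanP x).mul (h.continuousOn_meanP y))

lemma continuousOn_sourceProfile (h : HasBoundedMoments ω₀ γ T f τ μ B M) (x : Fin (n + 1)) :
    ContinuousOn (sourceProfile T μ x) (Set.Ici 0) := by
  unfold sourceProfile
  split_ifs
  · exact continuousOn_const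
  · exact h.continuousOn_momentPP x x

lemma hasDerivWithinAt_covQQ (h : HasBoundedMoments ω₀ γ T f τ μ B M) (x y : Fin (n + 1)) {t : ℝ}
    (ht : 0 ≤ t) :
    HasDerivWithinAt (covQQ μ x y) (covQP μ y x t + covQP μ x y t) (Set.Ici 0) t := by
  refine ((h.hasDerivWithinAt_momentQQ x y ht).fun_sub ((h.hasDerivWithinAt_meanQ x ht).fun_mul
    (h.hasDerivWithinAt_meanQ y ht))).congr_deriv ?_
  simp only [covQP]
  ring

/-- The force, being deterministic, contributes equally to the moment and to the product of the
means, so it cancels. -/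
lemma hasDerivWithinAt_covQP (h : HasBoundedMoments ω₀ γ T f τ μ B M) (x y : Fin (n + 1)) {t : ℝ}
    (ht : 0 ≤ t) :
    HasDerivWithinAt (covQP μ x y) (covPP μ x y t + ∑ w, -stiffness n ω₀ y w * covQQ μ w x t
      + -(2 * γ) * covQP μ x y t) (Set.Ici 0) t := by
  refine ((h.hasDerivWithinAt_momentQP x y ht).fun_sub ((h.hasDerivWithinAt_meanQ x ht).fun_mul
    (h.hasDerivWithinAt_meanP y ht))).congr_deriv ?_
  have e : ∑ w, -stiffness n ω₀ y w * covQQ μ w x t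
      = ∑ w, -stiffness n ω₀ y w * momentQQ μ w x t
        - (∑ w, -stiffness n ω₀ y w * meanQ μ w t) * meanQ μ x t := by
    rw [Finset.sum_mul, ← Finset.sum_sub_distrib]
    refine Finset.sum_congr rfl fun w _ => ?_
    simp only [covQQ]
    ring
  rw [e]
  simp only [covQP, covPP, meanAccel]
  ring

/-- For `x ≥ 1` the source is the full second moment, not the variance, since a reversal conserves
`p_x²` but not the mean. The difference is the square of the mean velocity, through which the force
acts on the profile. -/
lemma hasDerivWithinAt_covPP (h : HasBoundedMoments ω₀ γ T f τ μ B M) (x y : Fin (n + 1)) {t : ℝ}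
    (ht : 0 ≤ t) :
    HasDerivWithinAt (covPP μ x y) (∑ w, -stiffness n ω₀ x w * covQP μ w y t
      + ∑ w, -stiffness n ω₀ y w * covQP μ w x t + -(4 * γ) * covPP μ x y t
      + (if x = y then 4 * γ else 0) * sourceProfile T μ x t) (Set.Ici 0) t := by
  refine ((h.hasDerivWithinAt_momentPP x y ht).fun_sub ((h.hasDerivWithinAt_meanP x ht).fun_mul
    (h.hasDerivWithinAt_meanP y ht))).congr_deriv ?_
  have e (x y) : ∑ w, -stiffness n ω₀ x w * covQP μ w y t
      = ∑ w, -stiffness n ω₀ x w * momentQP μ w y t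
        - (∑ w, -stiffness n ω₀ x w * meanQ μ w t) * meanP μ y t := by
    rw [Finset.sum_mul, ← Finset.sum_sub_distrib]
    refine Finset.sum_congr rfl fun w _ => ?_
    simp only [covQP]
    ring
  rw [e, e]
  simp only [covPP, meanAccel, sourceProfile]
  by_cases hxy : x = y
  · subst hxy; simp only [if_true]; ring
  · simp only [hxy, if_false]; ring

end HasBoundedMoments

/-! ### The temperature profile -/

lemma momentumSq_eq (x : Fin (n + 1)) :
    (momentumSq x : Phase n → ℝ) = fun z => z.2 x * z.2 x := funext fun _ => sq _

namespace HasBoundedMoments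

variable {ω₀ γ T τ : ℝ} {f : ℝ → ℝ} {μ : ℝ → Measure (Phase n)} {B M : ℝ}

lemma hasTimeAverage_momentumSq (h : HasBoundedMoments ω₀ γ T f τ μ B M) (hτ : 0 < τ)
    (x : Fin (n + 1)) : HasTimeAverage τ μ (momentumSq x) := by
  rw [momentumSq_eq]
  exact ⟨fun t ht => (h.hasMean_snd_mul_snd ht x x).1,
    intervalIntegrable_of_continuousOn_Ici (h.continuousOn_momentPP x x) hτ.le⟩

lemma hasAverage_momentPP (h : HasBoundedMoments ω₀ γ T f τ μ B M) (x : Fin (n + 1)) :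
    HasAverage τ (momentPP μ x x) (timeAverage τ μ (momentumSq x)) := by
  rw [momentumSq_eq]
  exact .of_continuousOn (h.continuousOn_momentPP x x)

lemma apply_period (h : HasBoundedMoments ω₀ γ T f τ μ B M) : μ τ = μ 0 := by
  simpa using h.state.periodic 0 le_rfl

/-- The averaged covariance equations bound the gradient of the temperature profile: here `d` is
the temperature profile, up to the replacement of the temperature of the particle `0` by the one of
the thermostat, and `W` is the averaged square of the mean velocities. -/
theorem exists_profile (h : HasBoundedMoments ω₀ γ T f τ μ B M) (hτ : 0 < τ) (hγ : 0 < γ) :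
    ∃ d w : Fin (n + 1) → ℝ, d 0 = T ∧ (∀ x, 0 ≤ w x) ∧
      HasAverage τ (fun t => ∑ x, meanP μ x t ^ 2) (∑ x, w x) ∧
      (∀ x, timeAverage τ μ (momentumSq x) = d x + if x = 0 then ∑ y, w y else 0) ∧
      ω₀ ^ 2 * ∑ x : Fin n, (d x.castSucc - d x.succ) ^ 2
        ≤ gradientConst ω₀ γ * ∑ x, (d x - d 0) * w x := by
  set A := stiffness n ω₀ with hA
  set Q : Matrix (Fin (n + 1)) (Fin (n + 1)) ℝ :=
    Matrix.of fun x y => τ⁻¹ * ∫ t in (0 : ℝ)..τ, covQQ μ x y t with hQ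
  set S : Matrix (Fin (n + 1)) (Fin (n + 1)) ℝ :=
    Matrix.of fun x y => τ⁻¹ * ∫ t in (0 : ℝ)..τ, covQP μ x y t with hS
  set P : Matrix (Fin (n + 1)) (Fin (n + 1)) ℝ :=
    Matrix.of fun x y => τ⁻¹ * ∫ t in (0 : ℝ)..τ, covPP μ x y t with hP
  set d : Fin (n + 1) → ℝ := fun x => τ⁻¹ * ∫ t in (0 : ℝ)..τ, sourceProfile T μ x t with hd
  set w : Fin (n + 1) → ℝ := fun x => τ⁻¹ * ∫ t in (0 : ℝ)..τ, meanP μ x t ^ 2 with hw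
  have aQ (x y) : HasAverage τ (covQQ μ x y) (Q x y) := .of_continuousOn (h.continuousOn_covQQ x y)
  have aS (x y) : HasAverage τ (covQP μ x y) (S x y) := .of_continuousOn (h.continuousOn_covQP x y)
  have aP (x y) : HasAverage τ (covPP μ x y) (P x y) := .of_continuousOn (h.continuousOn_covPP x y)
  have ad (x) : HasAverage τ (sourceProfile T μ x) (d x) :=
    .of_continuousOn (h.continuousOn_sourceProfile x)
  have aw (x) : HasAverage τ (fun t => meanP μ x t ^ 2) (w x) :=
    .of_continuousOn ((h.continuousOn_meanP x).pow 2)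
  have hper := h.apply_period
  have hQt : Q.transpose = Q := by
    ext x y
    simp only [Matrix.transpose_apply, hQ, Matrix.of_apply, covQQ_symm μ x y]
  have hPt : P.transpose = P := by
    ext x y
    simp only [Matrix.transpose_apply, hP, Matrix.of_apply, covPP_symm μ x y]
  have hSt : S.transpose = -S := by
    ext x y
    -- This equation and the two that follow are the covariance equations averaged over a period,
    -- where the time derivatives disappear.
    have := HasAverage.of_hasDerivWithinAt hτ (fun t ht => h.hasDerivWithinAt_covQQ x y ht)
      ((aS y x).add hτ (aS x y)) (by simp only [covQQ, momentQQ, meanQ, hper])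
    rw [Matrix.transpose_apply, Matrix.neg_apply]
    linarith
  have h1 : P = Q * A + (2 * γ) • S := by
    ext x y
    have := HasAverage.of_hasDerivWithinAt hτ (fun t ht => h.hasDerivWithinAt_covQP x y ht)
      (((aP x y).add hτ (.sum hτ Finset.univ fun v => (aQ v x).const_mul (-A y v))).add hτ
        ((aS x y).const_mul _)) (by simp only [covQP, momentQP, meanQ, meanP, hper])
    have e : (Q * A) x y = -∑ v, -A y v * Q v x := by
      rw [Matrix.mul_apply, ← Finset.sum_neg_distrib]
      refine Finset.sum_congr rfl fun v _ => ?_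
      have e' := congrFun (congrFun hQt x) v
      rw [Matrix.transpose_apply] at e'
      rw [e', hA, stiffness_symm]
      ring
    rw [Matrix.add_apply, Matrix.smul_apply, smul_eq_mul, e]
    linarith
  have h2 : A * S - S * A = (4 * γ) • (Matrix.diagonal d - P) := by
    ext x y
    have := HasAverage.of_hasDerivWithinAt hτ (fun t ht => h.hasDerivWithinAt_covPP x y ht)
      ((((HasAverage.sum hτ Finset.univ fun v => (aS v y).const_mul (-A x v)).add hτ
        (.sum hτ Finset.univ fun v => (aS v x).const_mul (-A y v))).add hτ
        ((aP x y).const_mul _)).add hτ ((ad x).const_mul _))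
      (by simp only [covPP, momentPP, meanP, hper])
    have e1 : (A * S) x y = -∑ v, -A x v * S v y := by
      rw [Matrix.mul_apply, ← Finset.sum_neg_distrib]
      exact Finset.sum_congr rfl fun v _ => by ring
    have e2 : (S * A) x y = ∑ v, -A y v * S v x := by
      rw [Matrix.mul_apply]
      refine Finset.sum_congr rfl fun v _ => ?_
      have e' := congrFun (congrFun hSt v) x
      rw [Matrix.transpose_apply, Matrix.neg_apply] at e'
      rw [e', hA, stiffness_symm]
      ring
    rw [Matrix.sub_apply, e1, e2, Matrix.smul_apply, Matrix.sub_apply, Matrix.diagonal_apply,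
      smul_eq_mul]
    split_ifs at this ⊢ <;> linarith
  have hd0 : d 0 = T := by
    have : sourceProfile T μ (0 : Fin (n + 1)) = fun _ => T := by ext t; simp [sourceProfile]
    exact (ad 0).unique (this ▸ HasAverage.const hτ T)
  have hPd (x) : timeAverage τ μ (momentumSq x) = P x x + w x := by
    refine (h.hasAverage_momentPP x).unique ?_
    have := (aP x x).add hτ (aw x)
    have e : (fun t => covPP μ x x t + meanP μ x t ^ 2) = momentPP μ x x := by
      ext t
      simp only [covPP]
      ring
    rwa [e] at this
  have hdx (x) (hx : x ≠ 0) : d x = timeAverage τ μ (momentumSq x) := by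
    have : sourceProfile T μ x = momentPP μ x x := by ext t; simp [sourceProfile, hx]
    exact (ad x).unique (this ▸ h.hasAverage_momentPP x)
  -- A commutator has trace zero: what the mean motion feeds in at the sites `x ≥ 1` must leave at
  -- the thermostat. This determines the entry at `0`.
  have htr : ∑ x, (d x - P x x) = 0 := by
    have := congrArg Matrix.trace h2
    rw [Matrix.trace_sub, Matrix.trace_mul_comm, sub_self, Matrix.trace_smul, smul_eq_mul] at this
    have := (mul_eq_zero.1 this.symm).resolve_left (by positivity)
    simpa [Matrix.trace] using this
  have hdP (x) : d x - P x x = w x - if x = 0 then ∑ y, w y else 0 := by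
    have hne (x) (hx : x ≠ 0) : d x - P x x = w x := by rw [hdx x hx, hPd]; ring
    split_ifs with hx
    · subst hx
      rw [Fin.sum_univ_succ] at htr ⊢
      have : ∑ i : Fin n, (d i.succ - P i.succ i.succ) = ∑ i : Fin n, w i.succ :=
        Finset.sum_congr rfl fun i _ => hne _ (Fin.succ_ne_zero i)
      linarith
    · rw [hne x hx, sub_zero]
  refine ⟨d, w, hd0, fun x => ?_, .sum hτ _ aw, fun x => ?_, ?_⟩
  · exact mul_nonneg (inv_nonneg.2 hτ.le)
      (intervalIntegral.integral_nonneg hτ.le fun t _ => sq_nonneg _)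
  · linarith [hPd x, hdP x]
  · have b1 := hsNormSq_current_le hγ hPt hQt hSt h1 h2
    have b2 := sum_sq_gradient_le hγ hPt hQt hSt h1 h2
    -- Since the sources sum to zero, only differences to `d_0` matter; this is what allows the
    -- dissipation to be bounded by the gradient.
    have e : ∑ x, d x * (d x - P x x) = ∑ x, (d x - d 0) * w x := by
      have : ∑ x, d x * (d x - P x x)
          = ∑ x, (d x * w x - if x = 0 then d 0 * ∑ y, w y else 0) :=
        Finset.sum_congr rfl fun x _ => by
          rw [hdP]
          split_ifs with hx
          · rw [hx]; ring
          · ring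
      rw [this, Finset.sum_sub_distrib]
      simp only [sub_mul, Finset.sum_sub_distrib, Finset.mul_sum, Finset.sum_ite_eq',
        Finset.mem_univ, if_true]
    rw [e] at b1
    calc _ ≤ ω₀ ^ 2 * (gradientConst ω₀ γ * hsNormSq S) :=
          mul_le_mul_of_nonneg_left b2 (sq_nonneg _)
      _ = gradientConst ω₀ γ * (ω₀ ^ 2 * hsNormSq S) := by ring
      _ ≤ _ := mul_le_mul_of_nonneg_left b1 (gradientConst_nonneg _ _)

/-- The mean velocities are bounded by the derivative of the force. -/
lemma average_meanP_sq_le (h : HasBoundedMoments ω₀ γ T f τ μ B M) (hτ : 0 < τ) (hω₀ : 0 < ω₀)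
    (hγ : 0 < γ) {φ : ℝ → ℝ} (hφ : Continuous φ) (hfφ : ∀ t, HasDerivAt f (φ t) t)
    (hfτ : f τ = f 0) {W Φ : ℝ} (hW : HasAverage τ (fun t => ∑ x, meanP μ x t ^ 2) W)
    (hΦ : HasAverage τ (fun t => φ t ^ 2) Φ) :
    W ≤ (1 / (2 * γ ^ 2 * ω₀ ^ 2) + 1 / ω₀ ^ 4) * Φ := by
  -- The mean accelerations serve as velocities of the mean momenta, so the driving term is the
  -- derivative of the force. This gains the factor `1/θ_n`.
  refine average_sq_velocity_le hω₀ hγ hτ (p := meanP μ) (r := meanAccel ω₀ γ f μ)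
    hφ.continuousOn (fun x t ht => h.hasDerivWithinAt_meanP x ht) (fun x t ht => ?_) (fun x => ?_)
    (fun x => ?_) hW hΦ
  · have d1 : HasDerivWithinAt (fun t => if x = Fin.last n then f t else 0)
        (if x = Fin.last n then φ t else 0) (Set.Ici 0) t := by
      split_ifs
      · exact (hfφ t).hasDerivWithinAt
      · exact hasDerivWithinAt_const _ _ _
    exact ((HasDerivWithinAt.fun_sum fun y _ => (h.hasDerivWithinAt_meanQ y ht).const_mul _).fun_add
      d1).fun_add ((h.hasDerivWithinAt_meanP x ht).const_mul _)
  · simp only [meanP, h.apply_period]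
  · simp only [meanAccel, meanQ, meanP, h.apply_period, hfτ]

end HasBoundedMoments

/-- Telescoping along the bonds, then Cauchy–Schwarz over the `n` bonds. -/
lemma abs_sub_zero_le_sqrt (d : Fin (n + 1) → ℝ) (x : Fin (n + 1)) :
    |d x - d 0| ≤ √(n * ∑ y : Fin n, (d y.castSucc - d y.succ) ^ 2) := by
  have h1 : |d x - d 0| ≤ ∑ y : Fin n, |d y.castSucc - d y.succ| := by
    have key : ∀ x : Fin (n + 1), |d x - d 0|
        ≤ ∑ y ∈ Finset.univ.filter (fun y : Fin n => (y : ℕ) < x), |d y.castSucc - d y.succ| := by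
      intro x
      refine Fin.induction ?_ (fun i hi => ?_) x
      · simp
      · have e : Finset.univ.filter (fun y : Fin n => (y : ℕ) < (i.succ : Fin (n + 1)))
            = insert i (Finset.univ.filter fun y : Fin n => (y : ℕ) < (i.castSucc : Fin (n + 1))) := by
          ext y
          simp [Fin.ext_iff]
          omega
        rw [e, Finset.sum_insert (by simp)]
        have := abs_sub_le (d i.succ) (d i.castSucc) (d 0)
        rw [abs_sub_comm (d i.succ) (d i.castSucc)] at this
        linarith
    exact (key x).trans (Finset.sum_le_sum_of_subset_of_nonneg (Finset.filter_subset _ _)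
      fun _ _ _ => abs_nonneg _)
  refine h1.trans (Real.le_sqrt_of_sq_le ?_)
  have := sq_sum_le_card_mul_sum_sq (s := Finset.univ)
    (f := fun y : Fin n => |d y.castSucc - d y.succ|)
  simpa using this

/-- The bounds on a profile whose gradient is controlled by a source of order `1 / n`. -/
lemma profile_bounds {κ c T : ℝ} (hκ : 0 ≤ κ) (hc : 0 ≤ c) (hn : 1 ≤ n)
    {d w : Fin (n + 1) → ℝ} (hd0 : d 0 = T) (hw : ∀ x, 0 ≤ w x) (hwc : n * ∑ x, w x ≤ c)
    (hgrad : ∑ x : Fin n, (d x.castSucc - d x.succ) ^ 2 ≤ κ * ∑ x, (d x - d 0) * w x) :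
    n * ∑ x : Fin n, (d x.castSucc - d x.succ) ^ 2 ≤ (κ * c) ^ 2 ∧ ∀ x, d x ≤ T + κ * c := by
  set s := ∑ x : Fin n, (d x.castSucc - d x.succ) ^ 2 with hs
  have hs0 : 0 ≤ s := Finset.sum_nonneg fun _ _ => sq_nonneg _
  have hn' : (1 : ℝ) ≤ n := Nat.one_le_cast.2 hn
  set u := √(n * s) with hu
  have hu0 : 0 ≤ u := Real.sqrt_nonneg _
  have hu2 : u ^ 2 = n * s := Real.sq_sqrt (by positivity)
  have h1 : ∑ x, (d x - d 0) * w x ≤ u * ∑ x, w x := by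
    rw [Finset.mul_sum]
    exact Finset.sum_le_sum fun x _ => mul_le_mul_of_nonneg_right
      ((le_abs_self _).trans (abs_sub_zero_le_sqrt d x)) (hw x)
  -- The self-bounding step: the source is controlled by the oscillation `u` of the profile, which
  -- is itself the square root of what is estimated.
  have h2 : u ^ 2 ≤ κ * c * u := by
    rw [hu2]
    calc n * s ≤ n * (κ * (u * ∑ x, w x)) := mul_le_mul_of_nonneg_left
          (hgrad.trans (mul_le_mul_of_nonneg_left h1 hκ)) (by linarith)
      _ = κ * u * (n * ∑ x, w x) := by ring
      _ ≤ κ * u * c := mul_le_mul_of_nonneg_left hwc (by positivity)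
      _ = κ * c * u := by ring
  have h3 : u ≤ κ * c := by
    rcases hu0.eq_or_lt with h0 | h0
    · rw [← h0]
      positivity
    · rw [sq] at h2
      exact le_of_mul_le_mul_right h2 h0
  refine ⟨?_, fun x => ?_⟩
  · rw [← hu2]
    exact pow_le_pow_left₀ hu0 h3 2
  · have := (le_abs_self _).trans (abs_sub_zero_le_sqrt d x)
    rw [hd0] at this
    linarith

/-- Only the first bond touches the site `0`, so the correction is paid once, independently of `n`.
-/
lemma sum_sq_gradient_add_le (hn : 1 ≤ n) (d : Fin (n + 1) → ℝ) (W : ℝ) :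
    ∑ x : Fin n, ((d x.castSucc + if x.castSucc = 0 then W else 0)
        - (d x.succ + if x.succ = 0 then W else 0)) ^ 2
      ≤ 2 * ∑ x : Fin n, (d x.castSucc - d x.succ) ^ 2 + 2 * W ^ 2 := by
  obtain ⟨m, rfl⟩ : ∃ m, n = m + 1 := ⟨n - 1, by omega⟩
  have e : ∑ x : Fin (m + 1), (if x = 0 then W ^ 2 else 0) = W ^ 2 := by simp
  rw [← e, Finset.mul_sum, Finset.mul_sum, ← Finset.sum_add_distrib]
  refine Finset.sum_le_sum fun x _ => ?_
  simp only [Fin.castSucc_eq_zero_iff, Fin.succ_ne_zero, if_false, add_zero]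
  split_ifs
  · nlinarith [sq_nonneg (d x.castSucc - d x.succ - W)]
  · nlinarith [sq_nonneg (d x.castSucc - d x.succ)]

/-! ### The force -/

lemma hasDerivAt_force (n : ℕ) (a τ : ℝ) {𝓕 : ℝ → ℝ} (h𝓕 : ContDiff ℝ ∞ 𝓕) (t : ℝ) :
    HasDerivAt (force n a τ 𝓕) ((n : ℝ) ^ a / τ * deriv 𝓕 (t / τ)) t := by
  have h1 : HasDerivAt (fun t : ℝ => t / τ) (1 / τ) t := by
    simpa using (hasDerivAt_id t).div_const τ
  have h2 := (h𝓕.differentiable (by simp) (t / τ)).hasDerivAt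
  refine ((h2.comp t h1).const_mul ((n : ℝ) ^ a)).congr_deriv ?_
  ring

lemma continuous_deriv_of_contDiff {𝓕 : ℝ → ℝ} (h𝓕 : ContDiff ℝ ∞ 𝓕) : Continuous (deriv 𝓕) :=
  (contDiff_infty_iff_deriv.1 h𝓕).2.continuous

lemma exists_force_bound (n : ℕ) (a τ : ℝ) {𝓕 : ℝ → ℝ} (h𝓕 : ContDiff ℝ ∞ 𝓕)
    (hper : Function.Periodic 𝓕 1) : ∃ M : ℝ, ∀ t, |force n a τ 𝓕 t| ≤ M := by
  obtain ⟨C, hC⟩ := isCompact_Icc.exists_bound_of_continuousOn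
    (h𝓕.continuous.continuousOn (s := Set.Icc 0 1))
  refine ⟨|(n : ℝ) ^ a| * C, fun t => ?_⟩
  rw [force, abs_mul]
  refine mul_le_mul_of_nonneg_left ?_ (abs_nonneg _)
  obtain ⟨y, hy, he⟩ := hper.exists_mem_Ico₀ one_pos (t / τ)
  rw [he]
  exact hC y ⟨hy.1, hy.2.le⟩

lemma hasAverage_deriv_force_sq (n : ℕ) (a : ℝ) {τ : ℝ} (hτ : 0 < τ) {𝓕 : ℝ → ℝ}
    (h𝓕 : ContDiff ℝ ∞ 𝓕) :
    HasAverage τ (fun t => ((n : ℝ) ^ a / τ * deriv 𝓕 (t / τ)) ^ 2)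
      (((n : ℝ) ^ a / τ) ^ 2 * ∫ t in (0 : ℝ)..1, deriv 𝓕 t ^ 2) := by
  have hc := continuous_deriv_of_contDiff h𝓕
  refine ⟨Continuous.continuousOn (by fun_prop), ?_⟩
  simp only [mul_pow]
  rw [intervalIntegral.integral_const_mul,
    intervalIntegral.integral_comp_div (fun t => deriv 𝓕 t ^ 2) hτ.ne', zero_div, div_self hτ.ne',
    smul_eq_mul]
  field_simp

end ForcedChain

theorem proposition6p8
    (ω₀ γ T θ a b : ℝ) (hω₀ : 0 < ω₀) (hγ : 0 < γ) (hT : 0 < T) (hθ : 0 < θ)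
    (hab : b - a = 1 / 2) (ha : a ≤ 0) (hb : 0 ≤ b)
    (𝓕 : ℝ → ℝ) (h𝓕 : ContDiff ℝ ∞ 𝓕) (h𝓕_per : Function.Periodic 𝓕 1)
    (h𝓕_mean : ∫ t in (0 : ℝ)..1, 𝓕 t = 0) (h𝓕_sq : 0 < ∫ t in (0 : ℝ)..1, 𝓕 t ^ 2) :
    ∃ C : ℝ, 0 < C ∧ ∀ n : ℕ, 1 ≤ n → ∀ τ : ℝ, τ = (n : ℝ) ^ b * θ →
      ∀ μ : ℝ → Measure (ForcedChain.Phase n),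
        ForcedChain.IsPeriodicStationaryState ω₀ γ T (ForcedChain.force n a τ 𝓕) τ μ →
        (∀ x : Fin (n + 1), ForcedChain.HasTimeAverage τ μ (ForcedChain.momentumSq x)) ∧
        (∑ x : Fin n,
          (ForcedChain.timeAverage τ μ (ForcedChain.momentumSq x.castSucc)
            - ForcedChain.timeAverage τ μ (ForcedChain.momentumSq x.succ)) ^ 2
              ≤ C / ((n : ℝ) + 1)) ∧
        (∀ x : Fin (n + 1),
          ForcedChain.timeAverage τ μ (ForcedChain.momentumSq x) ≤ C) := by
  open ForcedChain in
  set I := ∫ t in (0 : ℝ)..1, deriv 𝓕 t ^ 2 with hI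
  have hI0 : 0 ≤ I := intervalIntegral.integral_nonneg zero_le_one fun t _ => sq_nonneg _
  set c := (1 / (2 * γ ^ 2 * ω₀ ^ 2) + 1 / ω₀ ^ 4) * (I / θ ^ 2) with hc
  have hc0 : 0 ≤ c := by positivity
  set κ := gradientConst ω₀ γ / ω₀ ^ 2 with hκ
  have hκ0 : 0 ≤ κ := div_nonneg (gradientConst_nonneg _ _) (sq_nonneg _)
  -- The first bracket serves the gradient bound, where `n + 1 ≤ 2n` doubles the factors `2` of
  -- `sum_sq_gradient_add_le`; the second serves the supremum.
  refine ⟨(4 * (κ * c) ^ 2 + 4 * c ^ 2) + (T + κ * c + c), by positivity,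
    fun n hn τ hτeq μ hμ => ?_⟩
  have hn' : (1 : ℝ) ≤ n := Nat.one_le_cast.2 hn
  have hn0 : (0 : ℝ) < n := by linarith
  have hτ : 0 < τ := by rw [hτeq]; positivity
  have hfd := hasDerivAt_force n a τ h𝓕
  have hfc : Continuous (force n a τ 𝓕) :=
    continuous_iff_continuousAt.2 fun t => (hfd t).continuousAt
  obtain ⟨M, hM⟩ := exists_force_bound n a τ h𝓕 h𝓕_per
  obtain ⟨B, -, hB⟩ := hμ.exists_moment_bound hτ hfc hω₀ hγ hT.le hM
  have h : HasBoundedMoments ω₀ γ T (force n a τ 𝓕) τ μ B M := ⟨hμ, hfc, hM, hB⟩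
  obtain ⟨d, w, hd0, hw, hW, hprof, hgrad⟩ := h.exists_profile hτ hγ
  have hfτ : force n a τ 𝓕 τ = force n a τ 𝓕 0 := by
    have := h𝓕_per 0
    rw [zero_add] at this
    rw [force, force, div_self hτ.ne', zero_div, this]
  have hφc : Continuous fun t : ℝ => (n : ℝ) ^ a / τ * deriv 𝓕 (t / τ) := by
    have := continuous_deriv_of_contDiff h𝓕
    fun_prop
  have hWle := h.average_meanP_sq_le hτ hω₀ hγ hφc hfd hfτ hW (hasAverage_deriv_force_sq n a hτ h𝓕)
  -- The relation `b - a = 1/2` enters here: the averaged square of the derivative of the force is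
  -- exactly of order `1/n`.
  have hscale : ((n : ℝ) ^ a / τ) ^ 2 = 1 / (n * θ ^ 2) := by
    have e : b = a + 1 / 2 := by linarith
    rw [hτeq, e, Real.rpow_add hn0, ← Real.sqrt_eq_rpow]
    have hs : √(n : ℝ) ^ 2 = n := Real.sq_sqrt hn0.le
    have hs0 : 0 < √(n : ℝ) := Real.sqrt_pos.2 hn0
    have ha0 : 0 < (n : ℝ) ^ a := Real.rpow_pos_of_pos hn0 a
    rw [div_pow, mul_pow, mul_pow, hs]
    field_simp
  have hwc : n * ∑ x, w x ≤ c := by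
    rw [hscale] at hWle
    calc n * ∑ x, w x ≤ n * ((1 / (2 * γ ^ 2 * ω₀ ^ 2) + 1 / ω₀ ^ 4) * (1 / (n * θ ^ 2) * I)) :=
          mul_le_mul_of_nonneg_left hWle hn0.le
      _ = c := by
        rw [hc]
        field_simp
  have hgrad' : ∑ x : Fin n, (d x.castSucc - d x.succ) ^ 2 ≤ κ * ∑ x, (d x - d 0) * w x := by
    rw [hκ, div_mul_eq_mul_div, le_div_iff₀ (by positivity), mul_comm]
    exact hgrad
  obtain ⟨b1, b2⟩ := profile_bounds hκ0 hc0 hn hd0 hw hwc hgrad'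
  set W := ∑ x, w x with hWdef
  have hW0 : 0 ≤ W := Finset.sum_nonneg fun x _ => hw x
  have hWc : W ≤ c := (le_mul_of_one_le_left hW0 hn').trans hwc
  refine ⟨fun x => h.hasTimeAverage_momentumSq hτ x, ?_, fun x => ?_⟩
  · simp only [hprof]
    refine (sum_sq_gradient_add_le hn d W).trans ?_
    rw [le_div_iff₀ (by positivity)]
    set s := ∑ x : Fin n, (d x.castSucc - d x.succ) ^ 2 with hs
    have hs0 : 0 ≤ s := Finset.sum_nonneg fun _ _ => sq_nonneg _
    -- Both `nW ≤ c` and `W ≤ c` hold, so the correction at the particle `0` is of the admissible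
    -- order.
    have h1 : n * W ^ 2 ≤ c ^ 2 := by
      calc n * W ^ 2 = n * W * W := by ring
        _ ≤ c * c := mul_le_mul hwc hWc hW0 hc0
        _ = c ^ 2 := by ring
    have h2 : (2 * s + 2 * W ^ 2) * (n + 1) ≤ (2 * s + 2 * W ^ 2) * (2 * n) :=
      mul_le_mul_of_nonneg_left (by linarith) (by positivity)
    have h3 : 0 ≤ T + κ * c + c := by positivity
    linarith
  · rw [hprof]
    have h1 := b2 x
    have h2 : (if x = 0 then W else 0) ≤ c := by split_ifs <;> linarith
    have h3 : 0 ≤ 4 * (κ * c) ^ 2 + 4 * c ^ 2 := by positivity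
    linarith
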